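/- **Setting.** Let $X$ and $Z$ be independent, square-integrable random vectors in $\mathbb{R}^N$ and $\mathbb{R}^M$ with mean zero and invertible covariance matrices $C_{XX}$, $C_{ZZ}$. Let $A\in\mathbb{R}^{M\times N}$, $Y:=AX+Z$, and let $C_{YY}$ be the covariance matrix of $Y$. Let $\Theta_*\in\mathbb{R}^{M\times N}$ be the matrix of the linear minimum mean squared error (LMMSE) estimator $y\mapsto\Theta_*^\top y$, that is, $\Theta_*^\top:=(A^\top C_{ZZ}^{-1}A+C_{XX}^{-1})^{-1}A^\top C_{ZZ}^{-1}$, and let $E:=X-\Theta_*^\top Y$ be its estimation error. Let $(X_1,Y_1),\dots,(X_n,Y_n)$ be independent copies of $(X,Y)$. The least squares estimator is $y\mapsto\hat\Theta^\top y$, where $\hat\Theta\in\mathbb{R}^{M\times N}$ is the minimizer of $\Theta\mapsto\frac1n\sum_{i=1}^n\|\Theta^\top Y_i-X_i\|_2^2$, provided that it is unique. Below, $\|\cdot\|_2$ is the Euclidean norm of a vector and the spectral norm of a matrix. A real random variable $V$ is sub-Gaussian with parameter $\sigma\ge0$ if $\mathbb{E}[e^{\lambda(V-\mathbb{E}V)}]\le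 e^{\sigma^2\lambda^2/2}$ for all $\lambda\in\mathbb{R}$. A random vector $V$ is $\sigma$-sub-Gaussian if $a^\top V$ is sub-Gaussian with parameter $\sigma$ for every unit vector $a$. **The constant.** Call $c>0$ a *singular value constant* if for all $n\ge0$, $M\ge1$, $\rho\ge0$, every random $n\times M$ matrix $\boldsymbol{Z}$ whose rows are independent, square-integrable, mean-zero, $\rho$-sub-Gaussian random vectors with identity covariance matrix, and every $t\ge0$, with probability at least $1-2e^{-t}$, $$\sqrt n-c\rho^2(\sqrt M+\sqrt t)\le\sigma_{\min}(\boldsymbol{Z})\le\sigma_{\max}(\boldsymbol{Z})\le\sqrt n+c\rho^2(\sqrt M+\sqrt t),$$ where $\sigma_{\min}(\boldsymbol{Z})$ and $\sigma_{\max}(\boldsymbol{Z})$ are the smallest and the largest of the $M$ square roots of the eigenvalues of $\boldsymbol{Z}^\top\boldsymbol{Z}$. **Theorem.** A singular value constant exists (it is absolute: it depends on nothing). Moreover, let $c>0$ be any singular value constant, and assume that 1. there is a symmetric positive definite matrix $C\in\mathbb{R}^{N\times N}$ such that, almost surely, the conditional distribution of $E$ given $Y$ is sub-Gaussian with companion matrix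 $C$, i.e. $$\mathbb{E}\big[\exp\big(\alpha^\top C^{-1/2}(E-\mathbb{E}[E\mid Y])\big)\,\big|\,Y\big]\le\exp(\|\alpha\|_2^2/2)\quad\text{for all }\alpha\in\mathbb{R}^N;$$ 2. there is $\mu=(\mu_1,\dots,\mu_N)\in\mathbb{R}^N$ such that $|\mathbb{E}[E\mid Y]_i|\le\mu_i$ almost surely for $1\le i\le N$; 3. $C_{YY}^{-1/2}Y$ is a $\rho$-sub-Gaussian random vector, $\rho\ge0$. Then for all $t\ge0$ with $\sqrt n-c\rho^2(\sqrt M+\sqrt t)>0$ and all $s\ge0$, with probability at least $1-3e^{-t}-Ne^{-s}$ (over the samples), the least squares estimator $\hat\Theta$ is uniquely determined and $$\mathbb{E}_Y\big[\|\hat\Theta^\top Y-\Theta_*^\top Y\|_2^2\big]\le\varepsilon_{\mathrm{err}}+\varepsilon_{\mathrm{bias}},$$ where $\mathbb{E}_Y$ is the expectation over $Y$ only, with the samples (hence $\hat\Theta$) fixed, and $$\varepsilon_{\mathrm{err}}:=\frac{\operatorname{tr}(C)\,M+2\sqrt{M\operatorname{tr}(C^2)\,t}+2\|C\|_2t}{\big(\sqrt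 n-c\rho^2(\sqrt M+\sqrt t)\big)^2},$$ $$\varepsilon_{\mathrm{bias}}:=\frac{(3/2)\rho^2\|\mu\|_2^2\,n\,\big(M+2\sqrt{Ms}+2s\big)}{\big(\sqrt n-c\rho^2(\sqrt M+\sqrt t)\big)^4}\left(1+\frac{2\sqrt t\,\|C\|_2}{\sqrt{M\operatorname{tr}(C^2)}}\left(\frac{\sqrt n+c\rho^2(\sqrt M+\sqrt t)}{\sqrt n-c\rho^2(\sqrt M+\sqrt t)}\right)^2\right)$$ (for $M=0$ or $N=0$ the quotient with denominator $\sqrt{M\operatorname{tr}(C^2)}=0$ is read as $0$). -/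

import Mathlib

open MeasureTheory ProbabilityTheory
open scoped NNReal Matrix InnerProductSpace

noncomputable section

namespace LMMSE

/-- The matrix-vector product `A v`, as a map between Euclidean spaces. -/
abbrev mulVecE {m k : ℕ} (A : Matrix (Fin m) (Fin k) ℝ) (v : EuclideanSpace ℝ (Fin k)) :
    EuclideanSpace ℝ (Fin m) :=
  Matrix.toEuclideanLin A v

/-- The spectral norm `‖C‖₂` of a square matrix: the operator norm for Euclidean norms. -/
def spectralNorm {k : ℕ} (C : Matrix (Fin k) (Fin k) ℝ) : ℝ :=
  ‖Matrix.toEuclideanCLM (𝕜 := ℝ) C‖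

open scoped MatrixOrder in
/-- `C^{-1/2}`, the positive semidefinite square root of `C⁻¹` (for positive definite `C`). -/
def invSqrt {k : ℕ} (C : Matrix (Fin k) (Fin k) ℝ) : Matrix (Fin k) (Fin k) ℝ :=
  CFC.sqrt C⁻¹

section RandomVectors

variable {Ω : Type*} [MeasurableSpace Ω]

/-- The covariance matrix of a random vector. -/
def covMat {k : ℕ} (V : Ω → EuclideanSpace ℝ (Fin k)) (P : Measure Ω) :
    Matrix (Fin k) (Fin k) ℝ :=
  Matrix.of fun i j => cov[fun ω => V ω i, fun ω => V ω j; P]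

/-- The real random variable `V` is sub-Gaussian with parameter `σ`:
`E exp (l (V - E V)) ≤ exp (σ² l² / 2)` for all real `l`. -/
def IsSubGaussian (V : Ω → ℝ) (σ : ℝ≥0) (P : Measure Ω) : Prop :=
  HasSubgaussianMGF (fun ω => V ω - ∫ ω', V ω' ∂P) (σ ^ 2) P

/-- `V` is a `σ`-sub-Gaussian random vector: `aᵀ V` is sub-Gaussian with parameter `σ`
for every unit vector `a`. -/
def IsSubGaussianVector {k : ℕ} (V : Ω → EuclideanSpace ℝ (Fin k)) (σ : ℝ≥0) (P : Measure Ω) :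
    Prop :=
  ∀ a : EuclideanSpace ℝ (Fin k), ‖a‖ = 1 → IsSubGaussian (fun ω => ⟪a, V ω⟫_ℝ) σ P

end RandomVectors

/-- The law `ν` on `ℝ^N` is sub-Gaussian with companion matrix `C`: if `e` has law `ν`, then
`E exp (αᵀ C^{-1/2} (e - E e)) ≤ exp (‖α‖² / 2)` for all `α`, with finite expectation. -/
def HasCompanionMatrix {N : ℕ} (ν : Measure (EuclideanSpace ℝ (Fin N)))
    (C : Matrix (Fin N) (Fin N) ℝ) : Prop :=
  ∀ α : EuclideanSpace ℝ (Fin N),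
    Integrable (fun e => Real.exp ⟪α, mulVecE (invSqrt C) (e - ∫ e', e' ∂ν)⟫_ℝ) ν ∧
    ∫ e, Real.exp ⟪α, mulVecE (invSqrt C) (e - ∫ e', e' ∂ν)⟫_ℝ ∂ν ≤ Real.exp (‖α‖ ^ 2 / 2)

/-- The `n × M` matrix with the given rows. -/
def rowMatrix {n M : ℕ} (v : Fin n → EuclideanSpace ℝ (Fin M)) : Matrix (Fin n) (Fin M) ℝ :=
  Matrix.of fun i j => v i j

/-- The smallest of the `M` singular values of an `n × M` matrix, `M ≥ 1`
(Mathlib's sequence of singular values is decreasing and starts with index `0`). -/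
def sigmaMin {n M : ℕ} (Z : Matrix (Fin n) (Fin M) ℝ) : ℝ :=
  (Matrix.toEuclideanLin Z).singularValues (M - 1)

/-- The largest singular value of an `n × M` matrix. -/
def sigmaMax {n M : ℕ} (Z : Matrix (Fin n) (Fin M) ℝ) : ℝ :=
  (Matrix.toEuclideanLin Z).singularValues 0

/-- `c` is an admissible absolute constant in the singular value bound for random matrices with
independent, centred, isotropic, `ρ`-sub-Gaussian rows: for all `n`, `M ≥ 1`, `ρ`, all such
`n × M` random matrices `Z` and all `t ≥ 0`, with probability at least `1 - 2 exp (-t)`,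
`√n - c ρ² (√M + √t) ≤ σ_min(Z) ≤ σ_max(Z) ≤ √n + c ρ² (√M + √t)`.
(Only the law of the rows matters, so sample spaces in the lowest universe suffice.) -/
def IsSingularValueConstant (c : ℝ) : Prop :=
  ∀ (n M : ℕ), 0 < M → ∀ (ρ : ℝ≥0) (Ω : Type) [MeasurableSpace Ω] (P : Measure Ω)
    [IsProbabilityMeasure P] (V : Fin n → Ω → EuclideanSpace ℝ (Fin M)),
    (∀ i, MemLp (V i) 2 P) → iIndepFun V P →
    (∀ i, ∫ ω, V i ω ∂P = 0) → (∀ i, covMat (V i) P = 1) →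
    (∀ i, IsSubGaussianVector (V i) ρ P) →
    ∀ t : ℝ, 0 ≤ t →
      1 - 2 * Real.exp (-t) ≤
        P.real {ω |
          √n - c * ρ ^ 2 * (√M + √t) ≤ sigmaMin (rowMatrix fun i => V i ω) ∧
          sigmaMax (rowMatrix fun i => V i ω) ≤ √n + c * ρ ^ 2 * (√M + √t)}

/-- The data `Y = A X + Z`. -/
def obs {Ω : Type*} {N M : ℕ} (A : Matrix (Fin M) (Fin N) ℝ)
    (X : Ω → EuclideanSpace ℝ (Fin N)) (Z : Ω → EuclideanSpace ℝ (Fin M)) :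
    Ω → EuclideanSpace ℝ (Fin M) :=
  fun ω => mulVecE A (X ω) + Z ω

/-- The matrix `Θ` of the LMMSE estimator `y ↦ Θᵀ y`, with
`Θᵀ = (Aᵀ C_ZZ⁻¹ A + C_XX⁻¹)⁻¹ Aᵀ C_ZZ⁻¹`. -/
def lmmseMatrix {N M : ℕ} (A : Matrix (Fin M) (Fin N) ℝ) (CXX : Matrix (Fin N) (Fin N) ℝ)
    (CZZ : Matrix (Fin M) (Fin M) ℝ) : Matrix (Fin M) (Fin N) ℝ :=
  ((Aᵀ * CZZ⁻¹ * A + CXX⁻¹)⁻¹ * Aᵀ * CZZ⁻¹)ᵀ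

/-- The estimation error `E = X - Θᵀ Y` of the linear estimator with matrix `Θ`. -/
def estError {Ω : Type*} {N M : ℕ} (Θ : Matrix (Fin M) (Fin N) ℝ)
    (X : Ω → EuclideanSpace ℝ (Fin N)) (Y : Ω → EuclideanSpace ℝ (Fin M)) :
    Ω → EuclideanSpace ℝ (Fin N) :=
  fun ω => X ω - mulVecE Θᵀ (Y ω)

/-- The empirical mean squared error of the linear estimator `y ↦ Θᵀ y`. -/
def empMSE {n N M : ℕ} (x : Fin n → EuclideanSpace ℝ (Fin N))
    (y : Fin n → EuclideanSpace ℝ (Fin M)) (Θ : Matrix (Fin M) (Fin N) ℝ) : ℝ :=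
  (1 / n) * ∑ i, ‖mulVecE Θᵀ (y i) - x i‖ ^ 2

/-- `Θ` is the least squares estimator for the sample `(x i, y i)`: the unique minimizer of the
empirical mean squared error over all linear estimators. -/
def IsLeastSquaresEstimator {n N M : ℕ} (x : Fin n → EuclideanSpace ℝ (Fin N))
    (y : Fin n → EuclideanSpace ℝ (Fin M)) (Θ : Matrix (Fin M) (Fin N) ℝ) : Prop :=
  ∀ Θ' : Matrix (Fin M) (Fin N) ℝ, Θ' ≠ Θ → empMSE x y Θ < empMSE x y Θ'

/-- `E_Y ‖Θ₁ᵀ Y - Θ₂ᵀ Y‖²`. -/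
def approxError {Ω : Type*} [MeasurableSpace Ω] {N M : ℕ} (P : Measure Ω)
    (Y : Ω → EuclideanSpace ℝ (Fin M)) (Θ₁ Θ₂ : Matrix (Fin M) (Fin N) ℝ) : ℝ :=
  ∫ ω, ‖mulVecE Θ₁ᵀ (Y ω) - mulVecE Θ₂ᵀ (Y ω)‖ ^ 2 ∂P

/-- The error term of the bound. -/
def epsErr (n M : ℕ) {N : ℕ} (c ρ t : ℝ) (C : Matrix (Fin N) (Fin N) ℝ) : ℝ :=
  (C.trace * M + 2 * √(M * (C ^ 2).trace * t) + 2 * spectralNorm C * t) /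
    (√n - c * ρ ^ 2 * (√M + √t)) ^ 2

/-- The bias term of the bound. -/
def epsBias (n M : ℕ) {N : ℕ} (c ρ t s : ℝ) (C : Matrix (Fin N) (Fin N) ℝ)
    (μ : EuclideanSpace ℝ (Fin N)) : ℝ :=
  ((3 / 2) * ρ ^ 2 * ‖μ‖ ^ 2 * n * (M + 2 * √(M * s) + 2 * s)) /
      (√n - c * ρ ^ 2 * (√M + √t)) ^ 4 *
    (1 + 2 * √t * spectralNorm C / √(M * (C ^ 2).trace) *
      ((√n + c * ρ ^ 2 * (√M + √t)) / (√n - c * ρ ^ 2 * (√M + √t))) ^ 2)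

end LMMSE

end

/-!
The singular value constant. For a unit vector `a`, the squares `⟪a, V i⟫ ^ 2` of the linear forms
of the rows are sub-exponential with mean one, so Bernstein's inequality
(`measure_sum_sq_inner_deviation_le`) controls `‖Z a‖ ^ 2 - n`. A union bound over a `1 / 2`-net of
the sphere with at most `5 ^ M` points and a polarization argument (`abs_sum_sq_sub_le_of_net`) make
this uniform in `a`, which is the claim about the singular values. The parameter enters only as
`ρ ^ 2` because unit variance forces `ρ ≥ 1` (`one_le_of_integral_sq_eq_one`).

The error bound. Let `R = C_YY^{-1/2}`, let `W` be the matrix with rows `R (Y i)`, and let `E` be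
the matrix whose rows are the errors `X i - Θsᵀ (Y i)`. If `W` has full column rank, the least
squares estimator is `Θs + R D E` with `D = (Wᵀ W)⁻¹ Wᵀ` (`isLeastSquaresEstimator_whitened`), and since
`R Y` has identity covariance, its approximation error is the squared Frobenius norm of `D E`
(`approxError_whitened`). Everything therefore reduces to a tail bound for `‖D E‖ ^ 2`.

The tool is the tail bound of Hsu, Kakade and Zhang for quadratic forms of sub-Gaussian vectors
(`measure_sum_sq_gt_le`). It follows from writing `exp (η ‖L‖ ^ 2)` as a Gaussian average of
exponentials of linear forms of `L`, which bounds its expectation by the one for a Gaussian vector.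
It is used twice.

* Given the data `Y i`, the errors are independent with the conditional laws of `X - Θsᵀ Y`
  (`map_sample_eq`), hence sub-Gaussian about their conditional means `m (Y i)`. On the event
  `σ_min(W) ≥ σ` the norm of `D` is at most `σ⁻¹`, and the tail bound, applied conditionally on the
  data, controls `‖D E‖ ^ 2` by the error term plus `‖D m‖ ^ 2` times the parenthesis of the bias
  term, without the ratio of singular values (`measure_noise_gt_le`).
* The matrix `D m = (Wᵀ W)⁻¹ (Wᵀ m)` has squared norm at most `σ⁻⁴ ‖Wᵀ m‖ ^ 2`, and the `j`-th
  column of `Wᵀ m` is `∑ i, m_j (Y i) R (Y i)`. By the orthogonality principle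
  (`integral_inner_obs_mul_inner_estError`) the summands are centred, and they are sub-Gaussian
  since `m_j` is bounded: from `exp x - x ≤ cosh (√(3/2) x)` the variance proxy is
  `(3/2) ρ ^ 2 μ_j ^ 2` (`lintegral_exp_mul_bounded_le`). The second use of the tail bound then
  controls the column (`measure_bias_gt_le`).

The singular value constant bounds the probability of `σ_min(W) < σ` by `2 exp (-t)`, the noise
bound fails with probability at most `exp (-t)`, and each of the `N` bias bounds with probability at
most `exp (-s)` (`exists_measurableSet_good`).
-/

noncomputable section

namespace LMMSE

/-! ### Elementary inequalities -/

/-- Together with `cosh_sqrt_three_halves_ge` this gives `sinh x - x ≤ cosh (√(3/2) x) - cosh x`: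
both compare with the same combination of `cosh x - 1` and `x ^ 2`, term by term in the power
series. -/
lemma sinh_sub_self_le {x : ℝ} (hx : 0 ≤ x) :
    Real.sinh x - x ≤ 7 / 6 * (Real.cosh x - 1) - x ^ 2 / 3 := by
  have hs := (Real.hasSum_sinh x)
  have hc := (Real.hasSum_cosh x)
  have hs1 := (hasSum_nat_add_iff' 1).2 hs
  have hc1 := (hasSum_nat_add_iff' 1).2 hc
  have hc2 := (hasSum_nat_add_iff' 2).2 hc
  have hcc := (hc1.mul_left (1 / 2)).add (hc2.mul_left (2 / 3))
  have key := hasSum_le (fun k => ?_) hs1 hcc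
  · simp [Finset.sum_range_succ] at key
    linarith
  · -- weighted arithmetic-geometric mean inequality between consecutive even terms
    have e1 : (2 * (k + 1) + 1).factorial = (2 * k + 3) * (2 * (k + 1)).factorial := by
      rw [Nat.factorial_succ]; ring
    have e2 : (2 * (k + 2)).factorial = (2 * k + 4) * ((2 * k + 3) * (2 * (k + 1)).factorial) := by
      rw [← e1, show 2 * (k + 2) = (2 * (k + 1) + 1) + 1 by ring, Nat.factorial_succ]; ring
    rw [e1, e2]
    have hf : (0 : ℝ) < ((2 * (k + 1)).factorial : ℝ) := by positivity
    push_cast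
    set F : ℝ := ((2 * (k + 1)).factorial : ℝ)
    have hk : (0 : ℝ) ≤ k := by positivity
    have hX : 0 ≤ x ^ (2 * (k + 1)) / F := by positivity
    have l1 : x ^ (2 * (k + 1) + 1) / ((2 * (k : ℝ) + 3) * F)
        = x ^ (2 * (k + 1)) / F * (x / (2 * k + 3)) := by
      rw [pow_succ]; field_simp
    have l2 : x ^ (2 * (k + 2)) / ((2 * (k : ℝ) + 4) * ((2 * k + 3) * F))
        = x ^ (2 * (k + 1)) / F * (x ^ 2 / ((2 * k + 4) * (2 * k + 3))) := by
      rw [show 2 * (k + 2) = 2 * (k + 1) + 2 by ring, pow_add]; field_simp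
    rw [l1, l2]
    have : x / (2 * k + 3) ≤ 1 / 2 + 2 / 3 * (x ^ 2 / ((2 * (k : ℝ) + 4) * (2 * k + 3))) := by
      rw [← sub_nonneg]
      have : 1 / 2 + 2 / 3 * (x ^ 2 / ((2 * (k : ℝ) + 4) * (2 * k + 3))) - x / (2 * k + 3)
          = (3 * (2 * k + 4) * (2 * k + 3) + 4 * x ^ 2 - 6 * (2 * k + 4) * x) /
            (6 * (2 * k + 4) * (2 * k + 3)) := by field_simp; ring
      rw [this]
      apply div_nonneg _ (by positivity)
      nlinarith [sq_nonneg (2 * x - 3 / 2 * (2 * k + 4)), mul_nonneg hk hk]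
    nlinarith [mul_le_mul_of_nonneg_left this hX]

lemma cosh_sqrt_three_halves_ge {x : ℝ} :
    13 / 6 * (Real.cosh x - 1) - x ^ 2 / 3 + 1 ≤ Real.cosh (√(3 / 2) * x) := by
  have hr : √(3 / 2 : ℝ) ^ 2 = 3 / 2 := Real.sq_sqrt (by norm_num)
  set r := √(3 / 2 : ℝ)
  have hc := (Real.hasSum_cosh x)
  have hd := (Real.hasSum_cosh (r * x))
  have hc2 := (hasSum_nat_add_iff' 2).2 hc
  have hd2 := (hasSum_nat_add_iff' 2).2 hd
  have key := hasSum_le (fun k => ?_) (hc2.mul_left (13 / 6)) hd2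
  · simp [Finset.sum_range_succ, mul_pow, hr] at key
    linarith
  · rw [mul_pow, pow_mul r, hr, mul_div_assoc]
    have hX : 0 ≤ x ^ (2 * (k + 2)) / ((2 * (k + 2)).factorial : ℝ) := by
      rw [pow_mul]; positivity
    apply mul_le_mul_of_nonneg_right _ hX
    rw [pow_add]
    have : (1 : ℝ) ≤ (3 / 2) ^ k := one_le_pow₀ (by norm_num)
    nlinarith

/-- The inequality behind the factor `3/2` of the bias term: after the linear term is removed,
the exponential is dominated by an even function whose Gaussian average is `exp (3/4)`. -/
lemma exp_sub_self_le_cosh (x : ℝ) : Real.exp x - x ≤ Real.cosh (√(3 / 2) * x) := by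
  have pos : ∀ y : ℝ, 0 ≤ y → Real.exp y - y ≤ Real.cosh (√(3 / 2) * y) := by
    intro y hy
    have h1 := sinh_sub_self_le hy
    have h2 := cosh_sqrt_three_halves_ge (x := y)
    have := Real.cosh_add_sinh y
    linarith
  rcases le_total 0 x with h | h
  · exact pos x h
  · have h1 := pos (-x) (by linarith)
    have h2 := Real.self_le_sinh_iff.2 (show 0 ≤ -x by linarith)
    rw [Real.sinh_eq] at h2
    simp only [neg_neg, mul_neg, Real.cosh_neg] at h1 h2
    linarith

lemma exp_le_one_add_add_sq_mul_exp_abs (x : ℝ) :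
    Real.exp x ≤ 1 + x + x ^ 2 * Real.exp |x| := by
  have h := Complex.norm_exp_sub_sum_le_norm_mul_exp (x : ℂ) 2
  simp [Finset.sum_range_succ] at h
  have h2 : ‖Complex.exp (x : ℂ) - (1 + x)‖ = |Real.exp x - (1 + x)| := by
    rw [← Complex.ofReal_exp]
    rw [← Real.norm_eq_abs, ← Complex.norm_real]; push_cast; rfl
  rw [h2] at h
  linarith [le_abs_self (Real.exp x - (1 + x))]

/-- The bound `-log (1 - 2 b) / 2 ≤ b + b ^ 2 / (1 - 2 b)`, in exponential form. -/
lemma inv_sqrt_one_sub_le_exp {b : ℝ} (h0 : 0 ≤ b) (h1 : 2 * b < 1) :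
    (√(1 - 2 * b))⁻¹ ≤ Real.exp (b + b ^ 2 / (1 - 2 * b)) := by
  have hu : 0 < 1 - 2 * b := by linarith
  rw [← Real.sqrt_inv, Real.sqrt_le_left (Real.exp_pos _).le, ← Real.exp_nat_mul]
  set s := -Real.log (1 - 2 * b) with hs
  have hs0 : 0 ≤ s := by
    rw [hs]; have := Real.log_nonpos hu.le (by linarith); linarith
  have hsinh := Real.self_le_sinh_iff.2 hs0
  rw [Real.sinh_eq] at hsinh
  have e1 : Real.exp s = (1 - 2 * b)⁻¹ := by rw [hs, Real.exp_neg, Real.exp_log hu]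
  have e2 : Real.exp (-s) = 1 - 2 * b := by rw [hs, neg_neg, Real.exp_log hu]
  rw [e1, e2] at hsinh
  rw [← e1]
  apply Real.exp_le_exp.2
  refine hsinh.trans (le_of_eq ?_)
  push_cast
  field_simp
  ring

/-! ### Gaussian linearization of quadratic forms -/

lemma lintegral_exp_mul_gaussian (a : ℝ) :
    ∫⁻ x, ENNReal.ofReal (Real.exp (a * x)) ∂(gaussianReal 0 1)
      = ENNReal.ofReal (Real.exp (a ^ 2 / 2)) := by
  rw [← ofReal_integral_eq_lintegral_ofReal (integrable_exp_mul_gaussianReal a)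
    (ae_of_all _ fun x => (Real.exp_pos _).le)]
  have := congrFun (mgf_id_gaussianReal (μ := 0) (v := 1)) a
  simp only [mgf, id] at this
  rw [this]; simp

lemma lintegral_exp_sq_add_mul_gaussian {b : ℝ} (a : ℝ) (h1 : 2 * b < 1) :
    ∫⁻ x, ENNReal.ofReal (Real.exp (b * x ^ 2 + a * x)) ∂(gaussianReal 0 1)
      = ENNReal.ofReal ((√(1 - 2 * b))⁻¹ * Real.exp (a ^ 2 / (2 * (1 - 2 * b)))) := by
  have hu : 0 < 1 - 2 * b := by linarith
  set v : ℝ≥0 := ⟨(1 - 2 * b)⁻¹, by positivity⟩ with hv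
  have hv0 : v ≠ 0 := by
    intro h
    have h' : (1 - 2 * b)⁻¹ = 0 := congrArg NNReal.toReal h
    exact (inv_pos.2 hu).ne' h'
  rw [gaussianReal_of_var_ne_zero _ one_ne_zero,
    lintegral_withDensity_eq_lintegral_mul _ (measurable_gaussianPDF _ _) (by fun_prop)]
  set K := (√(1 - 2 * b))⁻¹ * Real.exp (a ^ 2 / (2 * (1 - 2 * b))) with hK
  have hK0 : 0 ≤ K := by positivity
  -- complete the square
  have : ∀ x, (gaussianPDF 0 1 * fun x => ENNReal.ofReal (Real.exp (b * x ^ 2 + a * x))) x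
      = ENNReal.ofReal K * gaussianPDF (a * v) v x := by
    intro x
    simp only [Pi.mul_apply, gaussianPDF]
    rw [← ENNReal.ofReal_mul (gaussianPDFReal_nonneg _ _ _), ← ENNReal.ofReal_mul hK0]
    congr 1
    simp only [gaussianPDFReal, hK]
    have hv' : (v : ℝ) = (1 - 2 * b)⁻¹ := rfl
    rw [hv', Real.sqrt_mul (by positivity) (1 - 2 * b)⁻¹, Real.sqrt_inv]
    have hsq : √(1 - 2 * b) ≠ 0 := by positivity
    have hpi : √(2 * Real.pi) ≠ 0 := by positivity
    rw [mul_assoc, ← Real.exp_add]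
    have : √(2 * Real.pi * ((1 : ℝ≥0) : ℝ)) = √(2 * Real.pi) := by simp
    rw [this]
    have e3 : (√(1 - 2 * b))⁻¹ * Real.exp (a ^ 2 / (2 * (1 - 2 * b))) *
        ((√(2 * Real.pi) * (√(1 - 2 * b))⁻¹)⁻¹ *
          Real.exp (-(x - a * (1 - 2 * b)⁻¹) ^ 2 / (2 * (1 - 2 * b)⁻¹)))
        = (√(2 * Real.pi))⁻¹ * (Real.exp (a ^ 2 / (2 * (1 - 2 * b))) *
          Real.exp (-(x - a * (1 - 2 * b)⁻¹) ^ 2 / (2 * (1 - 2 * b)⁻¹))) := by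
      field_simp
    rw [e3, ← Real.exp_add]
    congr 2
    simp only [NNReal.coe_one]
    field_simp
    ring
  rw [lintegral_congr this, lintegral_const_mul _ (measurable_gaussianPDF _ _),
    lintegral_gaussianPDF_eq_one _ hv0, mul_one]

lemma lintegral_prod_pi {ι : Type*} [Fintype ι] {α : ι → Type*} [∀ i, MeasurableSpace (α i)]
    (μ : ∀ i, Measure (α i)) [∀ i, IsProbabilityMeasure (μ i)]
    {f : ∀ i, α i → ENNReal} (hf : ∀ i, Measurable (f i)) :
    ∫⁻ x, ∏ i, f i (x i) ∂(Measure.pi μ) = ∏ i, ∫⁻ x, f i x ∂(μ i) := by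
  have h := lintegral_prod_eq_prod_lintegral_of_indepFun (μ := Measure.pi μ) Finset.univ
    (fun i (x : ∀ i, α i) => f i (x i))
    (iIndepFun_pi fun i => (hf i).aemeasurable) (fun i => (hf i).comp (measurable_pi_apply i))
  rw [h]
  refine Finset.prod_congr rfl fun i _ => ?_
  rw [← (measurePreserving_eval μ i).lintegral_comp (hf i)]

lemma lintegral_exp_sum_pi {ι : Type*} [Fintype ι] {α : ι → Type*} [∀ i, MeasurableSpace (α i)]
    (μ : ∀ i, Measure (α i)) [∀ i, IsProbabilityMeasure (μ i)]
    {f : ∀ i, α i → ℝ} (hf : ∀ i, Measurable (f i)) :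
    ∫⁻ x, ENNReal.ofReal (Real.exp (∑ i, f i (x i))) ∂(Measure.pi μ)
      = ∏ i, ∫⁻ x, ENNReal.ofReal (Real.exp (f i x)) ∂(μ i) := by
  rw [← lintegral_prod_pi μ fun i => (hf i).exp.ennreal_ofReal]
  refine lintegral_congr fun x => ?_
  rw [Real.exp_sum, ENNReal.ofReal_prod_of_nonneg fun i _ => (Real.exp_pos _).le]

/-- Gaussian linearization: the exponential of `η` times a sum of squares is a Gaussian average
of exponentials of linear forms. -/
lemma ofReal_exp_sum_sq_eq_lintegral {ι : Type*} [Fintype ι] (l : ι → ℝ) {η : ℝ} (hη : 0 ≤ η) :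
    ENNReal.ofReal (Real.exp (η * ∑ k, l k ^ 2)) =
      ∫⁻ g, ENNReal.ofReal (Real.exp (∑ k, √(2 * η) * g k * l k))
        ∂(Measure.pi fun _ : ι => gaussianReal 0 1) := by
  rw [lintegral_exp_sum_pi (fun _ : ι => gaussianReal 0 1)
    (f := fun k x => √(2 * η) * x * l k) (fun k => by fun_prop)]
  have : ∀ k, ∫⁻ x, ENNReal.ofReal (Real.exp (√(2 * η) * x * l k)) ∂(gaussianReal 0 1)
      = ENNReal.ofReal (Real.exp (η * l k ^ 2)) := by
    intro k
    have h := lintegral_exp_mul_gaussian (√(2 * η) * l k)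
    rw [mul_pow, Real.sq_sqrt (by positivity)] at h
    rw [show η * l k ^ 2 = 2 * η * l k ^ 2 / 2 by ring, ← h]
    refine lintegral_congr fun x => ?_
    ring_nf
  simp_rw [this]
  rw [← ENNReal.ofReal_prod_of_nonneg fun i _ => (Real.exp_pos _).le, ← Real.exp_sum,
    Finset.mul_sum]

/-- If the exponential moments of the random vector `L` are at most those of a Gaussian vector with
mean `h` and independent components of variance `lam k`, then so are those of its squared norm. -/
lemma lintegral_exp_sum_sq_le {Ω : Type*} [MeasurableSpace Ω] (P : Measure Ω)
    [IsProbabilityMeasure P] {ι : Type*} [Fintype ι] {L : Ω → ι → ℝ}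
    (hL : ∀ k, Measurable fun ω => L ω k)
    {lam h : ι → ℝ}
    (hmgf : ∀ g : ι → ℝ, ∫⁻ ω, ENNReal.ofReal (Real.exp (∑ k, g k * L ω k)) ∂P ≤
      ENNReal.ofReal (Real.exp (∑ k, (g k * h k + lam k * g k ^ 2 / 2))))
    {η : ℝ} (hη : 0 ≤ η) (hηlam : ∀ k, 2 * (η * lam k) < 1) :
    ∫⁻ ω, ENNReal.ofReal (Real.exp (η * ∑ k, L ω k ^ 2)) ∂P ≤
      ∏ k, ENNReal.ofReal ((√(1 - 2 * (η * lam k)))⁻¹ *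
        Real.exp (η * h k ^ 2 / (1 - 2 * (η * lam k)))) := by
  calc ∫⁻ ω, ENNReal.ofReal (Real.exp (η * ∑ k, L ω k ^ 2)) ∂P
      = ∫⁻ ω, ∫⁻ g, ENNReal.ofReal (Real.exp (∑ k, √(2 * η) * g k * L ω k))
        ∂(Measure.pi fun _ : ι => gaussianReal 0 1) ∂P :=
        lintegral_congr fun ω => ofReal_exp_sum_sq_eq_lintegral (L ω) hη
    _ = ∫⁻ g, ∫⁻ ω, ENNReal.ofReal (Real.exp (∑ k, √(2 * η) * g k * L ω k)) ∂P
        ∂(Measure.pi fun _ : ι => gaussianReal 0 1) := by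
        apply lintegral_lintegral_swap
        apply Measurable.aemeasurable
        refine Measurable.ennreal_ofReal (Measurable.exp ?_)
        refine Finset.measurable_sum _ fun k _ => ?_
        exact (measurable_const.mul ((measurable_pi_apply k).comp measurable_snd)).mul
          ((hL k).comp measurable_fst)
    _ ≤ ∫⁻ g, ENNReal.ofReal (Real.exp (∑ k, (η * lam k * g k ^ 2 + √(2 * η) * h k * g k)))
        ∂(Measure.pi fun _ : ι => gaussianReal 0 1) := by
        refine lintegral_mono fun g => ?_
        refine (hmgf fun k => √(2 * η) * g k).trans (le_of_eq ?_)
        congr 3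
        funext k
        rw [mul_pow, Real.sq_sqrt (by positivity)]
        ring
    _ = _ := by
        rw [lintegral_exp_sum_pi (fun _ : ι => gaussianReal 0 1)
          (f := fun k x => η * lam k * x ^ 2 + √(2 * η) * h k * x) (fun k => by fun_prop)]
        refine Finset.prod_congr rfl fun k _ => ?_
        rw [lintegral_exp_sq_add_mul_gaussian _ (hηlam k), mul_pow, Real.sq_sqrt (by positivity)]
        congr 3
        have := hηlam k
        have : 1 - 2 * (η * lam k) ≠ 0 := by linarith
        field_simp

/-- **Tail bound for quadratic forms of sub-Gaussian vectors** (Hsu, Kakade and Zhang), in a form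
where only upper bounds `T₁`, `T₂`, `S` for the trace, the squared Frobenius norm and the spectral
norm of the covariance proxy `diag lam` are needed. -/
theorem measure_sum_sq_gt_le {Ω : Type*} [MeasurableSpace Ω] (P : Measure Ω)
    [IsProbabilityMeasure P] {ι : Type*} [Fintype ι] {L : Ω → ι → ℝ}
    (hL : ∀ k, Measurable fun ω => L ω k)
    {lam h : ι → ℝ} (hlam : ∀ k, 0 ≤ lam k)
    (hmgf : ∀ g : ι → ℝ, ∫⁻ ω, ENNReal.ofReal (Real.exp (∑ k, g k * L ω k)) ∂P ≤
      ENNReal.ofReal (Real.exp (∑ k, (g k * h k + lam k * g k ^ 2 / 2))))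
    {T₁ T₂ S t : ℝ} (hT₁ : ∑ k, lam k ≤ T₁) (hT₂ : ∑ k, lam k ^ 2 ≤ T₂) (hT₂0 : 0 < T₂)
    (hS : ∀ k, lam k ≤ S) (hS0 : 0 < S) (ht : 0 ≤ t) :
    P {ω | T₁ + 2 * √(T₂ * t) + 2 * S * t + (∑ k, h k ^ 2) * (1 + 2 * (S * √t / √T₂)) <
      ∑ k, L ω k ^ 2} ≤ ENNReal.ofReal (Real.exp (-t)) := by
  rcases ht.eq_or_lt with rfl | ht
  · simpa using prob_le_one
  set x := S * √t / √T₂ with hx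
  have hsT : 0 < √T₂ := Real.sqrt_pos.2 hT₂0
  have hst : 0 < √t := Real.sqrt_pos.2 ht
  have hx0 : 0 < x := by positivity
  -- the optimal exponent; it makes `1 - 2 η S` equal to `(1 + 2 x)⁻¹`
  set η := x / (S * (1 + 2 * x)) with hη
  have hη0 : 0 < η := by positivity
  have hηS : 1 - 2 * (η * S) = (1 + 2 * x)⁻¹ := by rw [hη]; field_simp; ring
  have hle : ∀ k, (1 + 2 * x)⁻¹ ≤ 1 - 2 * (η * lam k) := by
    intro k
    rw [← hηS]
    have := mul_le_mul_of_nonneg_left (hS k) hη0.le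
    linarith
  have hpos : ∀ k, 0 < 1 - 2 * (η * lam k) := fun k => lt_of_lt_of_le (by positivity) (hle k)
  have hinv : ∀ k, (1 - 2 * (η * lam k))⁻¹ ≤ 1 + 2 * x := fun k =>
    inv_le_of_inv_le₀ (by positivity) (hle k)
  set H := ∑ k, h k ^ 2 with hH
  have hmom := lintegral_exp_sum_sq_le P hL hmgf hη0.le (fun k => by linarith [hpos k])
  have hmom2 : ∫⁻ ω, ENNReal.ofReal (Real.exp (η * ∑ k, L ω k ^ 2)) ∂P ≤
      ENNReal.ofReal (Real.exp (η * T₁ + η ^ 2 * T₂ * (1 + 2 * x) + η * H * (1 + 2 * x))) := by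
    refine hmom.trans ?_
    rw [← ENNReal.ofReal_prod_of_nonneg fun k _ => by positivity]
    apply ENNReal.ofReal_le_ofReal
    calc ∏ k, ((√(1 - 2 * (η * lam k)))⁻¹ * Real.exp (η * h k ^ 2 / (1 - 2 * (η * lam k))))
        ≤ ∏ k, Real.exp (η * lam k + η ^ 2 * lam k ^ 2 * (1 + 2 * x) +
            η * h k ^ 2 * (1 + 2 * x)) := by
          refine Finset.prod_le_prod (fun k _ => by positivity) fun k _ => ?_
          rw [Real.exp_add]
          refine mul_le_mul ?_ ?_ (Real.exp_pos _).le (Real.exp_pos _).le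
          · refine (inv_sqrt_one_sub_le_exp (mul_nonneg hη0.le (hlam k))
              (by linarith [hpos k])).trans (Real.exp_le_exp.2 ?_)
            rw [div_eq_mul_inv, mul_pow]
            gcongr
            exact hinv k
          · apply Real.exp_le_exp.2
            rw [div_eq_mul_inv]
            gcongr
            exact hinv k
      _ = Real.exp (η * ∑ k, lam k + η ^ 2 * (∑ k, lam k ^ 2) * (1 + 2 * x) +
            η * H * (1 + 2 * x)) := by
          rw [← Real.exp_sum]
          simp only [hH, Finset.sum_add_distrib, Finset.mul_sum, Finset.sum_mul]
      _ ≤ _ := by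
          apply Real.exp_le_exp.2
          gcongr
  set b := T₁ + 2 * √(T₂ * t) + 2 * S * t + H * (1 + 2 * x) with hb
  have hexp : η * T₁ + η ^ 2 * T₂ * (1 + 2 * x) + η * H * (1 + 2 * x) = η * b - t := by
    have hr : √(T₂ * t) = √T₂ * √t := Real.sqrt_mul hT₂0.le t
    have h1 : η * (1 + 2 * x) * S = x := by rw [hη]; field_simp
    have h2 : x * √T₂ = S * √t := by rw [hx]; field_simp
    have h3 : √T₂ * √T₂ = T₂ := Real.mul_self_sqrt hT₂0.le
    have h4 : √t * √t = t := Real.mul_self_sqrt ht.le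
    rw [hb, hr]
    have h5 : η * (1 + 2 * x) * T₂ = √T₂ * √t := by
      have : η * (1 + 2 * x) * S * T₂ = S * √T₂ * √t := by
        rw [h1]; nth_rewrite 1 [← h3]; rw [← mul_assoc, h2]; ring
      exact mul_left_cancel₀ hS0.ne' (by linarith)
    have h6 : η * (√T₂ * √t) + 2 * η * S * t = t := by
      have : η * (1 + 2 * x) * (√T₂ * √t) = t := by
        apply mul_left_cancel₀ hS0.ne'
        calc S * (η * (1 + 2 * x) * (√T₂ * √t)) = (η * (1 + 2 * x) * S) * √T₂ * √t := by ring
          _ = S * (√t * √t) := by rw [h1, h2]; ring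
          _ = S * t := by rw [h4]
      have e : η * (2 * x) * (√T₂ * √t) = 2 * η * S * t := by
        calc η * (2 * x) * (√T₂ * √t) = 2 * η * (x * √T₂) * √t := by ring
          _ = 2 * η * S * (√t * √t) := by rw [h2]; ring
          _ = _ := by rw [h4]
      linarith
    linear_combination η * h5 - h6
  calc P {ω | b < ∑ k, L ω k ^ 2}
      ≤ P {ω | ENNReal.ofReal (Real.exp (η * b)) ≤
          ENNReal.ofReal (Real.exp (η * ∑ k, L ω k ^ 2))} := by
        refine measure_mono fun ω hω => ?_
        apply ENNReal.ofReal_le_ofReal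
        apply Real.exp_le_exp.2
        exact mul_le_mul_of_nonneg_left (le_of_lt hω) hη0.le
    _ ≤ (∫⁻ ω, ENNReal.ofReal (Real.exp (η * ∑ k, L ω k ^ 2)) ∂P) /
          ENNReal.ofReal (Real.exp (η * b)) := by
        refine meas_ge_le_lintegral_div ?_ (by simp [Real.exp_pos]) ENNReal.ofReal_ne_top
        refine (Measurable.ennreal_ofReal (Measurable.exp ?_)).aemeasurable
        exact (Finset.measurable_sum _ fun k _ => (hL k).pow_const 2).const_mul _
    _ ≤ ENNReal.ofReal (Real.exp (-t)) := by
        refine ENNReal.div_le_of_le_mul ?_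
        rw [← ENNReal.ofReal_mul (Real.exp_pos _).le, ← Real.exp_add]
        refine hmom2.trans (le_of_eq ?_)
        rw [hexp]; ring_nf

/-! ### Extreme singular values -/

lemma sq_norm_apply_eq_sum_eigenvalues {n M : ℕ}
    (T : EuclideanSpace ℝ (Fin M) →ₗ[ℝ] EuclideanSpace ℝ (Fin n)) (x : EuclideanSpace ℝ (Fin M)) :
    ‖T x‖ ^ 2 = ∑ i : Fin M, T.singularValues i ^ 2 *
      ⟪T.isSymmetric_adjoint_comp_self.eigenvectorBasis (n := M) (by simp) i, x⟫_ℝ ^ 2 := by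
  set hs := T.isSymmetric_adjoint_comp_self
  set b := hs.eigenvectorBasis (n := M) (by simp)
  rw [← real_inner_self_eq_norm_sq, ← LinearMap.adjoint_inner_left,
    ← b.sum_inner_mul_inner]
  refine Finset.sum_congr rfl fun i _ => ?_
  have h1 : ⟪(LinearMap.adjoint T) (T x), b i⟫_ℝ = ⟪x, (LinearMap.adjoint T ∘ₗ T) (b i)⟫_ℝ :=
    hs x (b i)
  rw [h1, hs.apply_eigenvectorBasis, inner_smul_right, T.sq_singularValues_fin (n := M) (by simp),
    real_inner_comm]
  simp only [RCLike.ofReal_real_eq_id, id]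
  rw [real_inner_comm x (b i)]
  ring

lemma sum_sq_inner_basis {M : ℕ} (b : OrthonormalBasis (Fin M) ℝ (EuclideanSpace ℝ (Fin M)))
    (x : EuclideanSpace ℝ (Fin M)) : ∑ i, ⟪b i, x⟫_ℝ ^ 2 = ‖x‖ ^ 2 := by
  rw [← real_inner_self_eq_norm_sq, ← b.sum_inner_mul_inner]
  refine Finset.sum_congr rfl fun i _ => ?_
  rw [real_inner_comm x (b i)]; ring

lemma le_sigmaMin_iff {n M : ℕ} (hM : 0 < M) (Z : Matrix (Fin n) (Fin M) ℝ) (a : ℝ) :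
    a ≤ sigmaMin Z ↔ ∀ x, a * ‖x‖ ≤ ‖mulVecE Z x‖ := by
  set T := Matrix.toEuclideanLin Z with hT
  constructor
  · intro h x
    refine (mul_le_mul_of_nonneg_right h (norm_nonneg x)).trans ?_
    refine (pow_le_pow_iff_left₀ (mul_nonneg ?_ (norm_nonneg x)) (norm_nonneg _) two_ne_zero).1 ?_
    · exact T.singularValues_nonneg _
    rw [mul_pow, sq_norm_apply_eq_sum_eigenvalues,
      ← sum_sq_inner_basis (T.isSymmetric_adjoint_comp_self.eigenvectorBasis (n := M) (by simp)),
      Finset.mul_sum]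
    refine Finset.sum_le_sum fun i _ => ?_
    apply mul_le_mul_of_nonneg_right _ (sq_nonneg _)
    have : T.singularValues (M - 1) ≤ T.singularValues i :=
      T.singularValues_antitone (by omega)
    exact pow_le_pow_left₀ (T.singularValues_nonneg _) this 2
  · intro h
    obtain ⟨x, hx⟩ := (T.hasEigenvalue_adjoint_comp_self_sq_singularValues
      (n := M - 1) (by simp; omega)).exists_hasEigenvector
    have hx0 := hx.2
    have hx1 := hx.apply_eq_smul
    have h1 : ‖T x‖ ^ 2 = (T.singularValues (M - 1) * ‖x‖) ^ 2 := by
      rw [← real_inner_self_eq_norm_sq, ← LinearMap.adjoint_inner_left]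
      change ⟪(LinearMap.adjoint T ∘ₗ T) x, x⟫_ℝ = _
      rw [hx1, inner_smul_left, real_inner_self_eq_norm_sq]
      simp
      ring
    have h2 : ‖T x‖ = T.singularValues (M - 1) * ‖x‖ := by
      rwa [sq_eq_sq₀ (norm_nonneg _)
        (mul_nonneg (T.singularValues_nonneg _) (norm_nonneg _))] at h1
    have h3 := h x
    change a * ‖x‖ ≤ ‖T x‖ at h3
    rw [h2] at h3
    exact le_of_mul_le_mul_right h3 (norm_pos_iff.2 hx0)

lemma sigmaMax_le {n M : ℕ} (hM : 0 < M) {Z : Matrix (Fin n) (Fin M) ℝ} {b : ℝ}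
    (h : ∀ x, ‖mulVecE Z x‖ ≤ b * ‖x‖) : sigmaMax Z ≤ b := by
  set T := Matrix.toEuclideanLin Z with hT
  obtain ⟨x, hx⟩ := (T.hasEigenvalue_adjoint_comp_self_sq_singularValues
    (n := 0) (by simpa using hM)).exists_hasEigenvector
  have hx0 := hx.2
  have hx1 := hx.apply_eq_smul
  have h1 : ‖T x‖ ^ 2 = (T.singularValues 0 * ‖x‖) ^ 2 := by
    rw [← real_inner_self_eq_norm_sq, ← LinearMap.adjoint_inner_left]
    change ⟪(LinearMap.adjoint T ∘ₗ T) x, x⟫_ℝ = _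
    rw [hx1, inner_smul_left, real_inner_self_eq_norm_sq]
    simp
    ring
  have h2 : ‖T x‖ = T.singularValues 0 * ‖x‖ := by
    rwa [sq_eq_sq₀ (norm_nonneg _)
      (mul_nonneg (T.singularValues_nonneg _) (norm_nonneg _))] at h1
  have h3 := h x
  change ‖T x‖ ≤ b * ‖x‖ at h3
  rw [h2] at h3
  exact le_of_mul_le_mul_right h3 (norm_pos_iff.2 hx0)

lemma sq_norm_mulVecE_rowMatrix {n M : ℕ} (v : Fin n → EuclideanSpace ℝ (Fin M))
    (x : EuclideanSpace ℝ (Fin M)) :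
    ‖mulVecE (rowMatrix v) x‖ ^ 2 = ∑ i, ⟪x, v i⟫_ℝ ^ 2 := by
  rw [EuclideanSpace.norm_sq_eq]
  refine Finset.sum_congr rfl fun i _ => ?_
  rw [Real.norm_eq_abs, sq_abs]
  congr 1

/-! ### Nets on the sphere -/

/-- A `1 / 2`-net of the sphere of dimension-exponential size, from the volume bound for separated
points in a ball of radius `2`. -/
lemma exists_net_sphere (M : ℕ) : ∃ s : Finset (EuclideanSpace ℝ (Fin M)),
    (∀ y ∈ s, ‖y‖ = 1) ∧ s.card ≤ 5 ^ M ∧ ∀ x, ‖x‖ = 1 → ∃ y ∈ s, ‖x - y‖ < 1 / 2 := by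
  classical
  let p : ℕ → Prop := fun k => ∃ s : Finset (EuclideanSpace ℝ (Fin M)),
    (∀ y ∈ s, ‖y‖ = 1) ∧ (∀ y ∈ s, ∀ z ∈ s, y ≠ z → 1 / 2 ≤ ‖y - z‖) ∧ s.card = k
  have hb : ∀ k, p k → k ≤ 5 ^ M := by
    rintro k ⟨s, h1, h2, rfl⟩
    have hinj : Function.Injective fun y : EuclideanSpace ℝ (Fin M) => (2 : ℝ) • y :=
      smul_right_injective _ two_ne_zero
    rw [← Finset.card_image_of_injective s hinj]
    have := Besicovitch.card_le_of_separated (s.image fun y => (2 : ℝ) • y) ?_ ?_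
    · simpa using this
    · intro c hc
      obtain ⟨y, hy, rfl⟩ := Finset.mem_image.1 hc
      rw [norm_smul, h1 y hy]; norm_num
    · intro c hc d hd hcd
      obtain ⟨y, hy, rfl⟩ := Finset.mem_image.1 hc
      obtain ⟨z, hz, rfl⟩ := Finset.mem_image.1 hd
      have hyz : y ≠ z := fun h => hcd (by rw [h])
      rw [← smul_sub, norm_smul]
      have := h2 y hy z hz hyz
      norm_num
      linarith
  have p0 : p 0 := ⟨∅, by simp⟩
  -- a separated set of maximal cardinality is a net
  obtain ⟨s, h1, h2, h3⟩ : p (Nat.findGreatest p (5 ^ M)) :=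
    Nat.findGreatest_spec (P := p) (Nat.zero_le _) p0
  refine ⟨s, h1, h3 ▸ Nat.findGreatest_le _, fun x hx => ?_⟩
  by_contra! hcon
  have hxs : x ∉ s := fun h => by have := hcon x h; norm_num at this
  have hp : p (s.card + 1) := by
    refine ⟨insert x s, ?_, ?_, Finset.card_insert_of_notMem hxs⟩
    · intro y hy
      rcases Finset.mem_insert.1 hy with rfl | hy
      · exact hx
      · exact h1 y hy
    · intro y hy z hz hyz
      rcases Finset.mem_insert.1 hy with rfl | hy' <;> rcases Finset.mem_insert.1 hz with rfl | hz
      · exact absurd rfl hyz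
      · exact hcon z hz
      · rw [norm_sub_rev]; exact hcon y hy'
      · exact h2 y hy' z hz hyz
  have := Nat.le_findGreatest (hb _ hp) hp
  omega

/-- A quadratic form `∑ i, ⟪x, v i⟫ ^ 2 - n ‖x‖ ^ 2` that is small on a `1 / 2`-net of the sphere
is small on the whole sphere. -/
lemma abs_sum_sq_sub_le_of_net {n M : ℕ} (hM : 0 < M) (v : Fin n → EuclideanSpace ℝ (Fin M))
    {s : Finset (EuclideanSpace ℝ (Fin M))} (hs1 : ∀ y ∈ s, ‖y‖ = 1)
    (hs : ∀ x, ‖x‖ = 1 → ∃ y ∈ s, ‖x - y‖ < 1 / 2) {τ : ℝ}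
    (hτ : ∀ y ∈ s, |∑ i, ⟪y, v i⟫_ℝ ^ 2 - n| ≤ τ) (x : EuclideanSpace ℝ (Fin M)) :
    |∑ i, ⟪x, v i⟫_ℝ ^ 2 - n * ‖x‖ ^ 2| ≤ 32 * τ * ‖x‖ ^ 2 := by
  set A : EuclideanSpace ℝ (Fin M) → ℝ := fun x => ∑ i, ⟪x, v i⟫_ℝ ^ 2 - n * ‖x‖ ^ 2 with hA
  have hne : (Metric.sphere (0 : EuclideanSpace ℝ (Fin M)) 1).Nonempty := by
    have : Nonempty (Fin M) := ⟨⟨0, hM⟩⟩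
    exact NormedSpace.sphere_nonempty.2 zero_le_one
  have hcont : Continuous fun x => |A x| := by simp only [hA]; fun_prop
  obtain ⟨z, hz, hmax⟩ := (isCompact_sphere (0 : EuclideanSpace ℝ (Fin M)) 1).exists_isMaxOn hne
    hcont.continuousOn
  set S := |A z| with hS
  have hsmul : ∀ (c : ℝ) (x), A (c • x) = c ^ 2 * A x := by
    intro c x
    simp only [hA, inner_smul_left, norm_smul, mul_pow, Real.norm_eq_abs, sq_abs, mul_sub,
      Finset.mul_sum]
    simp
    ring
  have hbound : ∀ x, |A x| ≤ S * ‖x‖ ^ 2 := by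
    intro x
    by_cases hx : x = 0
    · simp [hx, hA]
    have hx' : ‖x‖ ≠ 0 := norm_ne_zero_iff.2 hx
    have h1 : ‖x‖⁻¹ • x ∈ Metric.sphere (0 : EuclideanSpace ℝ (Fin M)) 1 := by
      simp [norm_smul, hx']
    have h2 : |A (‖x‖⁻¹ • x)| ≤ S := hmax h1
    rw [hsmul, abs_mul, abs_of_nonneg (by positivity)] at h2
    calc |A x| = (‖x‖⁻¹ ^ 2 * |A x|) * ‖x‖ ^ 2 := by field_simp
      _ ≤ _ := by gcongr
  have hz1 : ‖z‖ = 1 := by simpa using hz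
  obtain ⟨y, hy, hzy⟩ := hs z hz1
  have hy1 := hs1 y hy
  have hAy : |A y| ≤ τ := by
    have := hτ y hy
    simpa [hA, hy1] using this
  -- polarization, with a weight that favours the small vector `z - y`
  have hpol : A z - A y = (A ((5 / 2 : ℝ) • z - (3 / 2 : ℝ) • y) -
      A ((3 / 2 : ℝ) • z - (5 / 2 : ℝ) • y)) / 4 := by
    have e : ∀ a b : ℝ, A (a • z - b • y) = a ^ 2 * A z + b ^ 2 * A y -
        2 * a * b * (∑ i, ⟪z, v i⟫_ℝ * ⟪y, v i⟫_ℝ - n * ⟪z, y⟫_ℝ) := by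
      intro a b
      simp only [hA, inner_sub_left, inner_smul_left, norm_sub_sq_real, norm_smul, mul_pow,
        Real.norm_eq_abs, sq_abs, inner_smul_right]
      simp only [conj_trivial]
      have : ∀ i, (a * ⟪z, v i⟫_ℝ - b * ⟪y, v i⟫_ℝ) ^ 2 = a ^ 2 * ⟪z, v i⟫_ℝ ^ 2 +
        b ^ 2 * ⟪y, v i⟫_ℝ ^ 2 - 2 * a * b * (⟪z, v i⟫_ℝ * ⟪y, v i⟫_ℝ) := fun i => by ring
      simp only [this, Finset.sum_add_distrib, Finset.sum_sub_distrib, ← Finset.mul_sum]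
      ring
    rw [e, e]; ring
  have hin : 7 / 8 ≤ ⟪z, y⟫_ℝ := by
    have h1 := norm_sub_sq_real z y
    have h2 : ‖z - y‖ ^ 2 ≤ (1 / 2) ^ 2 := pow_le_pow_left₀ (norm_nonneg _) hzy.le 2
    rw [hz1, hy1] at h1
    linarith
  have hn : ‖(5 / 2 : ℝ) • z - (3 / 2 : ℝ) • y‖ ^ 2 + ‖(3 / 2 : ℝ) • z - (5 / 2 : ℝ) • y‖ ^ 2
      ≤ 31 / 8 := by
    simp only [norm_sub_sq_real, norm_smul, inner_smul_left, inner_smul_right, hz1, hy1]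
    norm_num
    linarith
  have hS0 : 0 ≤ S := abs_nonneg _
  have hST : S ≤ 32 * τ := by
    have h1 := hbound ((5 / 2 : ℝ) • z - (3 / 2 : ℝ) • y)
    have h2 := hbound ((3 / 2 : ℝ) • z - (5 / 2 : ℝ) • y)
    have h3 : |A z - A y| ≤ S * (31 / 8) / 4 := by
      rw [hpol, abs_div, abs_of_pos (show (0 : ℝ) < 4 by norm_num)]
      gcongr
      refine (abs_sub _ _).trans ?_
      nlinarith
    have h4 := abs_sub_abs_le_abs_sub (A z) (A y)
    linarith
  exact (hbound x).trans (by gcongr)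

/-! ### Squares of sub-Gaussian random variables -/

section Squares

variable {Ω : Type*} [MeasurableSpace Ω] {P : Measure Ω} {W : Ω → ℝ} {v : ℝ}

lemma lintegral_exp_mul_sq_le [IsProbabilityMeasure P] (hW : Measurable W)
    (hmgf : ∀ s : ℝ, ∫⁻ ω, ENNReal.ofReal (Real.exp (s * W ω)) ∂P ≤
      ENNReal.ofReal (Real.exp (v * s ^ 2 / 2))) {q : ℝ} (hq : 0 ≤ q) (hqv : 2 * (q * v) < 1) :
    ∫⁻ ω, ENNReal.ofReal (Real.exp (q * W ω ^ 2)) ∂P ≤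
      ENNReal.ofReal ((√(1 - 2 * (q * v)))⁻¹) := by
  have := lintegral_exp_sum_sq_le P (ι := Unit) (L := fun ω _ => W ω) (lam := fun _ => v)
    (h := fun _ => 0) (fun _ => hW) (fun g => by simpa using hmgf (g ())) hq (fun _ => hqv)
  simpa using this

lemma integrable_of_lintegral_ofReal_le {f : Ω → ℝ} (hf : Measurable f) (hf0 : ∀ ω, 0 ≤ f ω)
    {K : ℝ} (h : ∫⁻ ω, ENNReal.ofReal (f ω) ∂P ≤ ENNReal.ofReal K) : Integrable f P := by
  refine ⟨hf.aestronglyMeasurable, ?_⟩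
  rw [hasFiniteIntegral_iff_ofReal (ae_of_all _ hf0)]
  exact h.trans_lt ENNReal.ofReal_lt_top

lemma integral_le_of_lintegral_ofReal_le {f : Ω → ℝ} (hf : Measurable f) (hf0 : ∀ ω, 0 ≤ f ω)
    {K : ℝ} (hK : 0 ≤ K) (h : ∫⁻ ω, ENNReal.ofReal (f ω) ∂P ≤ ENNReal.ofReal K) :
    ∫ ω, f ω ∂P ≤ K := by
  rw [integral_eq_lintegral_of_nonneg_ae (ae_of_all _ hf0) hf.aestronglyMeasurable]
  exact ENNReal.toReal_le_of_le_ofReal hK h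

/-- A variance proxy of a variable with unit second moment is at least one. -/
lemma one_le_of_integral_sq_eq_one [IsProbabilityMeasure P] (hW : Measurable W) (hv : 0 ≤ v)
    (hmgf : ∀ s : ℝ, ∫⁻ ω, ENNReal.ofReal (Real.exp (s * W ω)) ∂P ≤
      ENNReal.ofReal (Real.exp (v * s ^ 2 / 2)))
    (hint : Integrable (fun ω => W ω ^ 2) P) (hvar : ∫ ω, W ω ^ 2 ∂P = 1) : 1 ≤ v := by
  by_contra! hv1
  -- as `q → 0`, `1 + q ≤ E exp (q W ^ 2) ≤ (1 - 2 q v) ^ (-1/2)` fails to first order if `v < 1`;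
  -- a multiple of the gap `1 - v` is small enough
  set q := (1 - v) / 5 with hq
  have hq0 : 0 < q := by rw [hq]; linarith
  have hqv : 2 * (q * v) < 1 := by rw [hq]; nlinarith
  have h1 := lintegral_exp_mul_sq_le hW hmgf hq0.le hqv
  have hm : Measurable fun ω => Real.exp (q * W ω ^ 2) := by fun_prop
  have h2 := integrable_of_lintegral_ofReal_le hm (fun ω => (Real.exp_pos _).le) h1
  have h3 := integral_le_of_lintegral_ofReal_le hm (fun ω => (Real.exp_pos _).le)
    (by positivity) h1
  have h4 : 1 + q ≤ ∫ ω, Real.exp (q * W ω ^ 2) ∂P := by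
    calc 1 + q = ∫ ω, (1 + q * W ω ^ 2) ∂P := by
          rw [integral_add (integrable_const _) (hint.const_mul q), integral_const_mul, hvar]; simp
      _ ≤ _ := integral_mono ((integrable_const _).add (hint.const_mul q)) h2 fun ω => by
          have := Real.add_one_le_exp (q * W ω ^ 2)
          simp only; linarith
  have h5 := h4.trans h3
  have hpos : 0 < 1 - 2 * (q * v) := by linarith
  have hsq : 0 < √(1 - 2 * (q * v)) := Real.sqrt_pos.2 hpos
  have h6 : (1 + q) * √(1 - 2 * (q * v)) ≤ 1 := by
    calc _ ≤ (√(1 - 2 * (q * v)))⁻¹ * √(1 - 2 * (q * v)) := by gcongr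
      _ = 1 := inv_mul_cancel₀ hsq.ne'
  have h7 : (1 + q) ^ 2 * (1 - 2 * (q * v)) ≤ 1 := by
    rw [← Real.sq_sqrt hpos.le, ← mul_pow]
    exact pow_le_one₀ (by positivity) h6
  have hvq : v = 1 - 5 * q := by rw [hq]; ring
  rw [hvq] at h7 hv
  have : q ≤ 1 / 5 := by linarith
  nlinarith [mul_pos hq0 hq0, mul_pos (mul_pos hq0 hq0) hq0]

/-- The centred square of a sub-Gaussian variable of unit variance is sub-exponential. -/
lemma lintegral_exp_mul_sq_sub_one_le [IsProbabilityMeasure P] (hW : Measurable W) (hv : 0 ≤ v)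
    (hmgf : ∀ s : ℝ, ∫⁻ ω, ENNReal.ofReal (Real.exp (s * W ω)) ∂P ≤
      ENNReal.ofReal (Real.exp (v * s ^ 2 / 2)))
    (hint : Integrable (fun ω => W ω ^ 2) P) (hvar : ∫ ω, W ω ^ 2 ∂P = 1)
    {l : ℝ} (hl : |l| ≤ 1 / (8 * v)) :
    ∫⁻ ω, ENNReal.ofReal (Real.exp (l * (W ω ^ 2 - 1))) ∂P ≤
      ENNReal.ofReal (Real.exp (256 * v ^ 2 * l ^ 2)) := by
  have hv1 := one_le_of_integral_sq_eq_one hW hv hmgf hint hvar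
  set q := 1 / (4 * v) with hq
  have hq0 : 0 < q := by positivity
  have hq4 : q ≤ 1 / 4 := by
    rw [hq]; apply one_div_le_one_div_of_le <;> linarith
  have hqv : q * v = 1 / 4 := by rw [hq]; field_simp
  have hm : Measurable fun ω => Real.exp (q * W ω ^ 2) := by fun_prop
  have h1 := lintegral_exp_mul_sq_le hW hmgf hq0.le (by rw [hqv]; norm_num)
  have h2 := integrable_of_lintegral_ofReal_le hm (fun ω => (Real.exp_pos _).le) h1
  have h3 := integral_le_of_lintegral_ofReal_le hm (fun ω => (Real.exp_pos _).le)
    (by positivity) h1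
  have hexpq : Real.exp q * (√(1 - 2 * (q * v)))⁻¹ ≤ 2 := by
    have e1 : Real.exp q ≤ √2 := by
      apply Real.le_sqrt_of_sq_le
      rw [← Real.exp_nat_mul]
      calc Real.exp (((2 : ℕ) : ℝ) * q) ≤ Real.exp (1 / 2) :=
            Real.exp_le_exp.2 (by push_cast; linarith)
        _ ≤ 2 := by
          have : Real.exp (1 / 2) ^ 2 ≤ 2 ^ 2 := by
            rw [← Real.exp_nat_mul]; norm_num
            linarith [Real.exp_one_lt_d9]
          exact le_of_sq_le_sq this (by norm_num)
    have e2 : (√(1 - 2 * (q * v)))⁻¹ = √2 := by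
      rw [← Real.sqrt_inv, hqv]; norm_num
    rw [e2]
    calc Real.exp q * √2 ≤ √2 * √2 := by gcongr
      _ = 2 := Real.mul_self_sqrt (by norm_num)
  -- pointwise second order expansion, with the remainder absorbed in `exp (q W ^ 2)`
  have hpt : ∀ ω, Real.exp (l * (W ω ^ 2 - 1)) ≤ 1 + l * (W ω ^ 2 - 1) +
      l ^ 2 * (8 / q ^ 2) * Real.exp q * Real.exp (q * W ω ^ 2) := by
    intro ω
    set U := W ω ^ 2 - 1
    refine (exp_le_one_add_add_sq_mul_exp_abs (l * U)).trans ?_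
    have hlq : |l| ≤ q / 2 := by rw [hq]; refine hl.trans (le_of_eq ?_); field_simp; norm_num
    have hU : |U| ≤ W ω ^ 2 + 1 := by
      rw [abs_le]; constructor <;> simp only [U] <;> nlinarith [sq_nonneg (W ω)]
    have a1 : U ^ 2 ≤ 8 / q ^ 2 * Real.exp (q / 2 * |U|) := by
      have := Real.pow_div_factorial_le_exp (q / 2 * |U|) (by positivity) 2
      norm_num [Nat.factorial] at this
      rw [mul_pow, sq_abs] at this
      calc U ^ 2 = 8 / q ^ 2 * ((q / 2) ^ 2 * U ^ 2 / 2) := by field_simp; norm_num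
        _ ≤ _ := by gcongr
    have a2 : Real.exp |l * U| ≤ Real.exp (q / 2 * |U|) := by
      rw [abs_mul]; gcongr
    have a3 : Real.exp (q / 2 * |U|) * Real.exp (q / 2 * |U|) ≤
        Real.exp q * Real.exp (q * W ω ^ 2) := by
      rw [← Real.exp_add, ← Real.exp_add]
      apply Real.exp_le_exp.2
      nlinarith
    have : (l * U) ^ 2 * Real.exp |l * U| ≤
        l ^ 2 * (8 / q ^ 2) * Real.exp q * Real.exp (q * W ω ^ 2) := by
      calc (l * U) ^ 2 * Real.exp |l * U|
          = l ^ 2 * (U ^ 2 * Real.exp |l * U|) := by ring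
        _ ≤ l ^ 2 * (8 / q ^ 2 * Real.exp (q / 2 * |U|) * Real.exp (q / 2 * |U|)) := by
            gcongr
        _ = l ^ 2 * (8 / q ^ 2) * (Real.exp (q / 2 * |U|) * Real.exp (q / 2 * |U|)) := by ring
        _ ≤ l ^ 2 * (8 / q ^ 2) * (Real.exp q * Real.exp (q * W ω ^ 2)) := by gcongr
        _ = _ := by ring
    linarith
  have hi0 : Integrable (fun ω => l * (W ω ^ 2 - 1)) P :=
    (hint.sub (integrable_const _)).const_mul l
  have hi1 : Integrable (fun ω => 1 + l * (W ω ^ 2 - 1)) P :=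
    (integrable_const _).add hi0
  have hi2 : Integrable (fun ω => l ^ 2 * (8 / q ^ 2) * Real.exp q * Real.exp (q * W ω ^ 2)) P :=
    h2.const_mul _
  have hme : Measurable fun ω => Real.exp (l * (W ω ^ 2 - 1)) := by fun_prop
  have hie : Integrable (fun ω => Real.exp (l * (W ω ^ 2 - 1))) P := by
    refine Integrable.mono' (hi1.add hi2) hme.aestronglyMeasurable (ae_of_all _ fun ω => ?_)
    rw [Real.norm_eq_abs, abs_of_pos (Real.exp_pos _)]
    exact hpt ω
  rw [← ofReal_integral_eq_lintegral_ofReal hie (ae_of_all _ fun ω => (Real.exp_pos _).le)]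
  apply ENNReal.ofReal_le_ofReal
  calc ∫ ω, Real.exp (l * (W ω ^ 2 - 1)) ∂P
      ≤ ∫ ω, (1 + l * (W ω ^ 2 - 1) +
          l ^ 2 * (8 / q ^ 2) * Real.exp q * Real.exp (q * W ω ^ 2)) ∂P :=
        integral_mono hie (hi1.add hi2) hpt
    _ = 1 + l ^ 2 * (8 / q ^ 2) * Real.exp q * ∫ ω, Real.exp (q * W ω ^ 2) ∂P := by
        have e : ∫ ω, (W ω ^ 2 - 1) ∂P = 0 := by
          rw [integral_sub hint (integrable_const _), hvar]; simp
        have e' : ∫ ω, l * (W ω ^ 2 - 1) ∂P = 0 := by rw [integral_const_mul, e, mul_zero]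
        rw [integral_add hi1 hi2, integral_const_mul,
          integral_add (integrable_const 1) hi0, e']
        simp
    _ ≤ 1 + l ^ 2 * (8 / q ^ 2) * (Real.exp q * (√(1 - 2 * (q * v)))⁻¹) := by
        rw [mul_assoc _ (Real.exp q)]; gcongr
    _ ≤ 1 + l ^ 2 * (8 / q ^ 2) * 2 := by gcongr
    _ = 1 + 256 * v ^ 2 * l ^ 2 := by rw [hq]; field_simp; ring
    _ ≤ _ := by linarith [Real.add_one_le_exp (256 * v ^ 2 * l ^ 2)]

end Squares

/-! ### Moments of linear forms of random vectors -/

section LinearForms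

variable {Ω : Type*} [MeasurableSpace Ω] {P : Measure Ω} {k : ℕ} {V : Ω → EuclideanSpace ℝ (Fin k)}

lemma integral_apply_eq_zero (hV : Integrable V P) (h0 : ∫ ω, V ω ∂P = 0) (i : Fin k) :
    ∫ ω, V ω i ∂P = 0 := by
  have h := (EuclideanSpace.proj (𝕜 := ℝ) i :
    EuclideanSpace ℝ (Fin k) →L[ℝ] ℝ).integral_comp_comm hV
  rw [h0] at h
  simpa using h

lemma covMat_apply_of_integral_eq_zero (hV : Integrable V P) (h0 : ∫ ω, V ω ∂P = 0)
    (i j : Fin k) : covMat V P i j = ∫ ω, V ω i * V ω j ∂P := by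
  simp [covMat, covariance, integral_apply_eq_zero hV h0]

lemma MemLp.euclidean_apply {p : ENNReal} (hV : MemLp V p P) (i : Fin k) :
    MemLp (fun ω => V ω i) p P :=
  (EuclideanSpace.proj (𝕜 := ℝ) i : EuclideanSpace ℝ (Fin k) →L[ℝ] ℝ).comp_memLp' hV

lemma integral_inner_mul_inner [IsFiniteMeasure P] (hV : MemLp V 2 P) (h0 : ∫ ω, V ω ∂P = 0)
    (a b : EuclideanSpace ℝ (Fin k)) :
    ∫ ω, ⟪a, V ω⟫_ℝ * ⟪b, V ω⟫_ℝ ∂P = ⟪a, mulVecE (covMat V P) b⟫_ℝ := by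
  have hVi : Integrable V P := hV.integrable one_le_two
  have hint : ∀ i j, Integrable (fun ω => V ω i * V ω j) P := fun i j =>
    (MemLp.euclidean_apply hV i).integrable_mul (MemLp.euclidean_apply hV j)
  have e : ∀ ω, ⟪a, V ω⟫_ℝ * ⟪b, V ω⟫_ℝ = ∑ i, ∑ j, a i * b j * (V ω i * V ω j) := by
    intro ω
    simp only [PiLp.inner_apply, RCLike.inner_apply, conj_trivial, Finset.sum_mul_sum]
    refine Finset.sum_congr rfl fun i _ => Finset.sum_congr rfl fun j _ => by ring
  simp_rw [e]
  rw [integral_finsetSum _ fun i _ => integrable_finsetSum _ fun j _ => (hint i j).const_mul _]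
  simp only [PiLp.inner_apply, RCLike.inner_apply, conj_trivial]
  refine Finset.sum_congr rfl fun i _ => ?_
  rw [integral_finsetSum _ fun j _ => (hint i j).const_mul _]
  simp only [integral_const_mul, Matrix.toLpLin_apply, Matrix.mulVec, dotProduct,
    covMat_apply_of_integral_eq_zero hVi h0, Finset.sum_mul]
  refine Finset.sum_congr rfl fun j _ => by ring

lemma lintegral_exp_le_of_hasSubgaussianMGF {W : Ω → ℝ} {c : ℝ≥0}
    (h : HasSubgaussianMGF W c P) (s : ℝ) :
    ∫⁻ ω, ENNReal.ofReal (Real.exp (s * W ω)) ∂P ≤ ENNReal.ofReal (Real.exp (c * s ^ 2 / 2)) := by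
  rw [← ofReal_integral_eq_lintegral_ofReal (h.integrable_exp_mul s)
    (ae_of_all _ fun ω => (Real.exp_pos _).le)]
  exact ENNReal.ofReal_le_ofReal (h.mgf_le s)

lemma integral_inner_eq_zero (hV : Integrable V P) (h0 : ∫ ω, V ω ∂P = 0)
    (a : EuclideanSpace ℝ (Fin k)) : ∫ ω, ⟪a, V ω⟫_ℝ ∂P = 0 := by
  rw [integral_inner hV, h0, inner_zero_right]

/-- Exponential moments of the linear forms of a centred sub-Gaussian random vector. -/
lemma IsSubGaussianVector.lintegral_exp_le {ρ : ℝ≥0} (h : IsSubGaussianVector V ρ P)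
    (hV : Integrable V P) (h0 : ∫ ω, V ω ∂P = 0) {a : EuclideanSpace ℝ (Fin k)} (ha : ‖a‖ = 1)
    (s : ℝ) :
    ∫⁻ ω, ENNReal.ofReal (Real.exp (s * ⟪a, V ω⟫_ℝ)) ∂P ≤
      ENNReal.ofReal (Real.exp ((ρ : ℝ) ^ 2 * s ^ 2 / 2)) := by
  have h1 := h a ha
  unfold IsSubGaussian at h1
  simp only [integral_inner_eq_zero hV h0 a, sub_zero] at h1
  simpa using lintegral_exp_le_of_hasSubgaussianMGF h1 s

end LinearForms

/-! ### Existence of a singular value constant -/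

section Existence

variable {n M : ℕ} {μ : Fin n → Measure (EuclideanSpace ℝ (Fin M))}
  [∀ i, IsProbabilityMeasure (μ i)] {v : ℝ}

/-- A one-sided Bernstein inequality for `∑ i, ⟪y, x i⟫ ^ 2`; the sign `ε` selects the side. -/
lemma measure_sum_sq_inner_deviation_le (hv : 1 ≤ v) {y : EuclideanSpace ℝ (Fin M)}
    (hmgf : ∀ i, ∀ s : ℝ, ∫⁻ x, ENNReal.ofReal (Real.exp (s * ⟪y, x⟫_ℝ)) ∂(μ i) ≤
      ENNReal.ofReal (Real.exp (v * s ^ 2 / 2)))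
    (hint : ∀ i, Integrable (fun x => ⟪y, x⟫_ℝ ^ 2) (μ i))
    (hvar : ∀ i, ∫ x, ⟪y, x⟫_ℝ ^ 2 ∂(μ i) = 1) {u : ℝ} (hu : 0 < u) {ε : ℝ} (hε : |ε| = 1) :
    Measure.pi μ {x | 2064 * v * (√n * u + u ^ 2) ≤ ε * (∑ i, ⟪y, x i⟫_ℝ ^ 2 - n)} ≤
      ENNReal.ofReal (Real.exp (-(2 * u ^ 2))) := by
  set τ := 2064 * v * (√n * u + u ^ 2) with hτ
  have hv0 : 0 < v := by linarith
  have hn0 : 0 ≤ √(n : ℝ) := Real.sqrt_nonneg _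
  have hnn : √(n : ℝ) * √n = n := Real.mul_self_sqrt (Nat.cast_nonneg n)
  -- the exponent is `u / (v √n)`, truncated at the end `1 / (8 v)` of the sub-exponential range
  obtain ⟨l, hl0, hl1, hl2⟩ : ∃ l : ℝ, 0 ≤ l ∧ l ≤ 1 / (8 * v) ∧
      256 * v ^ 2 * l ^ 2 * n - l * τ ≤ -(2 * u ^ 2) := by
    by_cases h : u ≤ √n / 8
    · have hn : 0 < √(n : ℝ) := by linarith
      refine ⟨u / (v * √n), by positivity, ?_, ?_⟩
      · rw [div_le_div_iff₀ (by positivity) (by positivity)]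
        nlinarith
      · have e1 : 256 * v ^ 2 * (u / (v * √n)) ^ 2 * n = 256 * u ^ 2 := by
          field_simp
          rw [Real.sq_sqrt (Nat.cast_nonneg n)]
        have e2 : u / (v * √n) * τ = 2064 * u ^ 2 + 2064 * (u ^ 3 / √n) := by
          rw [hτ]; field_simp
        rw [e1, e2]
        have : 0 ≤ u ^ 3 / √n := by positivity
        nlinarith [sq_nonneg u]
    · push Not at h
      -- here `n ≤ 64 u ^ 2`, and `4 * 64 + 2 = 258` determines the constant `2064 = 8 * 258`
      refine ⟨1 / (8 * v), by positivity, le_rfl, ?_⟩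
      have e1 : 256 * v ^ 2 * (1 / (8 * v)) ^ 2 * n = 4 * n := by field_simp; ring
      have e2 : 1 / (8 * v) * τ = 258 * (√n * u + u ^ 2) := by rw [hτ]; field_simp; norm_num
      have e3 : (n : ℝ) ≤ (8 * u) * (8 * u) := by
        calc (n : ℝ) = √n * √n := hnn.symm
          _ ≤ _ := mul_self_le_mul_self hn0 (by linarith)
      rw [e1, e2]
      nlinarith [mul_nonneg hn0 hu.le]
  have hmom : ∫⁻ x, ENNReal.ofReal (Real.exp (l * (ε * (∑ i, ⟪y, x i⟫_ℝ ^ 2 - n)))) ∂(Measure.pi μ)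
      ≤ ENNReal.ofReal (Real.exp (256 * v ^ 2 * l ^ 2 * n)) := by
    have e : ∀ x : Fin n → EuclideanSpace ℝ (Fin M), l * (ε * (∑ i, ⟪y, x i⟫_ℝ ^ 2 - n)) =
        ∑ i, (l * ε) * (⟪y, x i⟫_ℝ ^ 2 - 1) := by
      intro x
      rw [← Finset.mul_sum, Finset.sum_sub_distrib]
      simp
      ring
    simp_rw [e]
    rw [lintegral_exp_sum_pi μ (f := fun _ x => (l * ε) * (⟪y, x⟫_ℝ ^ 2 - 1))
      (fun i => by fun_prop)]
    have hle : ∀ i, ∫⁻ x, ENNReal.ofReal (Real.exp ((l * ε) * (⟪y, x⟫_ℝ ^ 2 - 1))) ∂(μ i) ≤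
        ENNReal.ofReal (Real.exp (256 * v ^ 2 * l ^ 2)) := by
      intro i
      have h1 := lintegral_exp_mul_sq_sub_one_le (P := μ i) (W := fun x => ⟪y, x⟫_ℝ)
        (by fun_prop) hv0.le (hmgf i) (hint i) (hvar i) (l := l * ε)
        (by rw [abs_mul, hε, mul_one, abs_of_nonneg hl0]; exact hl1)
      have h2 : (l * ε) ^ 2 = l ^ 2 := by rw [mul_pow, ← sq_abs ε, hε]; ring
      rwa [h2] at h1
    refine (Finset.prod_le_prod' fun i _ => hle i).trans (le_of_eq ?_)
    rw [Finset.prod_const, Finset.card_univ, Fintype.card_fin,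
      ← ENNReal.ofReal_pow (Real.exp_pos _).le, ← Real.exp_nat_mul]
    ring_nf
  calc Measure.pi μ {x | τ ≤ ε * (∑ i, ⟪y, x i⟫_ℝ ^ 2 - n)}
      ≤ Measure.pi μ {x | ENNReal.ofReal (Real.exp (l * τ)) ≤
          ENNReal.ofReal (Real.exp (l * (ε * (∑ i, ⟪y, x i⟫_ℝ ^ 2 - n))))} := by
        refine measure_mono fun x hx => ENNReal.ofReal_le_ofReal (Real.exp_le_exp.2 ?_)
        exact mul_le_mul_of_nonneg_left hx hl0
    _ ≤ (∫⁻ x, ENNReal.ofReal (Real.exp (l * (ε * (∑ i, ⟪y, x i⟫_ℝ ^ 2 - n)))) ∂(Measure.pi μ)) /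
          ENNReal.ofReal (Real.exp (l * τ)) := by
        refine meas_ge_le_lintegral_div ?_ (by simp [Real.exp_pos]) ENNReal.ofReal_ne_top
        refine (Measurable.ennreal_ofReal (Measurable.exp ?_)).aemeasurable
        fun_prop
    _ ≤ ENNReal.ofReal (Real.exp (-(2 * u ^ 2))) := by
        refine ENNReal.div_le_of_le_mul ?_
        rw [← ENNReal.ofReal_mul (Real.exp_pos _).le, ← Real.exp_add]
        refine hmom.trans (ENNReal.ofReal_le_ofReal (Real.exp_le_exp.2 ?_))
        linarith

lemma five_pow_le_exp (M : ℕ) : (5 : ℝ) ^ M ≤ Real.exp (2 * M) := by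
  have h : (5 : ℝ) ≤ Real.exp 2 := by
    have : Real.exp 2 = Real.exp 1 ^ 2 := by rw [← Real.exp_nat_mul]; norm_num
    rw [this]
    nlinarith [Real.exp_one_gt_d9]
  calc (5 : ℝ) ^ M ≤ Real.exp 2 ^ M := by gcongr
    _ = _ := by rw [← Real.exp_nat_mul]; ring_nf

/-- Bernstein's inequality and a union bound over a net `s`. -/
lemma measureReal_net_deviation_le (hv : 1 ≤ v) (hM : 0 < M)
    {s : Finset (EuclideanSpace ℝ (Fin M))} (hs : s.card ≤ 5 ^ M)
    (hmgf : ∀ y ∈ s, ∀ i, ∀ r : ℝ, ∫⁻ x, ENNReal.ofReal (Real.exp (r * ⟪y, x⟫_ℝ)) ∂(μ i) ≤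
      ENNReal.ofReal (Real.exp (v * r ^ 2 / 2)))
    (hint : ∀ y ∈ s, ∀ i, Integrable (fun x => ⟪y, x⟫_ℝ ^ 2) (μ i))
    (hvar : ∀ y ∈ s, ∀ i, ∫ x, ⟪y, x⟫_ℝ ^ 2 ∂(μ i) = 1) {t : ℝ} (ht : 0 ≤ t) :
    (Measure.pi μ).real {x | ∃ y ∈ s, 2064 * v * (√n * (√M + √t) + (√M + √t) ^ 2) <
      |∑ i, ⟪y, x i⟫_ℝ ^ 2 - n|} ≤ 2 * Real.exp (-t) := by
  set u := √(M : ℝ) + √t with hu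
  have hM' : (0 : ℝ) < M := by exact_mod_cast hM
  have hu0 : 0 < u := by positivity
  set τ := 2064 * v * (√n * u + u ^ 2) with hτ
  set B : ℝ → EuclideanSpace ℝ (Fin M) → Set (Fin n → EuclideanSpace ℝ (Fin M)) := fun ε y =>
    {x | τ ≤ ε * (∑ i, ⟪y, x i⟫_ℝ ^ 2 - n)} with hB
  have hBle : ∀ ε, |ε| = 1 → ∀ y ∈ s, (Measure.pi μ).real (B ε y) ≤ Real.exp (-(2 * u ^ 2)) := by
    intro ε hε y hy
    exact ENNReal.toReal_le_of_le_ofReal (Real.exp_pos _).le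
      (measure_sum_sq_inner_deviation_le hv (hmgf y hy) (hint y hy) (hvar y hy) hu0 hε)
  have hsub : {x : Fin n → EuclideanSpace ℝ (Fin M) |
      ∃ y ∈ s, τ < |∑ i, ⟪y, x i⟫_ℝ ^ 2 - n|} ⊆ ⋃ y ∈ s, (B 1 y ∪ B (-1) y) := by
    rintro x ⟨y, hy, hx⟩
    simp only [Set.mem_iUnion]
    refine ⟨y, hy, ?_⟩
    rcases lt_abs.1 hx with h | h
    · left; simp only [hB, Set.mem_ofPred_eq, one_mul]; exact h.le
    · right; simp only [hB, Set.mem_ofPred_eq, neg_mul, one_mul]; exact h.le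
  calc (Measure.pi μ).real {x | ∃ y ∈ s, τ < |∑ i, ⟪y, x i⟫_ℝ ^ 2 - n|}
      ≤ (Measure.pi μ).real (⋃ y ∈ s, (B 1 y ∪ B (-1) y)) :=
        measureReal_mono hsub (measure_ne_top _ _)
    _ ≤ ∑ y ∈ s, (Measure.pi μ).real (B 1 y ∪ B (-1) y) := measureReal_biUnion_finset_le _ _
    _ ≤ ∑ y ∈ s, 2 * Real.exp (-(2 * u ^ 2)) := by
        refine Finset.sum_le_sum fun y hy => ?_
        refine (measureReal_union_le _ _).trans ?_
        linarith [hBle 1 (by simp) y hy, hBle (-1) (by simp) y hy]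
    _ = s.card * (2 * Real.exp (-(2 * u ^ 2))) := by simp
    _ ≤ Real.exp (2 * M) * (2 * Real.exp (-(2 * u ^ 2))) := by
        gcongr
        refine le_trans ?_ (five_pow_le_exp M)
        exact_mod_cast hs
    _ = 2 * Real.exp (2 * M - 2 * u ^ 2) := by rw [Real.exp_sub, Real.exp_neg]; ring
    _ ≤ 2 * Real.exp (-t) := by
        gcongr
        have h1 : √(M : ℝ) ^ 2 = M := Real.sq_sqrt hM'.le
        have h2 : √t ^ 2 = t := Real.sq_sqrt ht
        have h3 : 0 ≤ √(M : ℝ) * √t := by positivity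
        rw [hu]
        nlinarith

end Existence

/-- Near-isotropy of the Gram matrix on a net, in terms of the extreme singular values. The constant
is `132096 = 2 * 32 * 2064`: the factor `32` is lost between net and sphere, and the factor `2`
absorbs the square of the deviation. -/
lemma sigma_bounds_of_net {n M : ℕ} (hM : 0 < M) (x : Fin n → EuclideanSpace ℝ (Fin M))
    {s : Finset (EuclideanSpace ℝ (Fin M))} (hs1 : ∀ y ∈ s, ‖y‖ = 1)
    (hs : ∀ x, ‖x‖ = 1 → ∃ y ∈ s, ‖x - y‖ < 1 / 2) {v u : ℝ} (hv : 1 ≤ v) (hu : 0 ≤ u)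
    (hx : ∀ y ∈ s, |∑ i, ⟪y, x i⟫_ℝ ^ 2 - n| ≤ 2064 * v * (√n * u + u ^ 2)) :
    √n - 132096 * v * u ≤ sigmaMin (rowMatrix x) ∧
      sigmaMax (rowMatrix x) ≤ √n + 132096 * v * u := by
  have key := abs_sum_sq_sub_le_of_net hM x hs1 hs hx
  have hn0 : 0 ≤ √(n : ℝ) := Real.sqrt_nonneg _
  have hnn : √(n : ℝ) ^ 2 = n := Real.sq_sqrt (Nat.cast_nonneg n)
  have hvu : u ≤ v * u := by nlinarith
  have hvu0 : 0 ≤ v * u := hu.trans hvu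
  constructor
  · rw [le_sigmaMin_iff hM]
    intro z
    rcases le_or_gt (√n - 132096 * v * u) 0 with h | h
    · exact (mul_nonpos_of_nonpos_of_nonneg h (norm_nonneg _)).trans (norm_nonneg _)
    apply le_of_sq_le_sq _ (norm_nonneg _)
    rw [sq_norm_mulVecE_rowMatrix, mul_pow]
    have h1 := (abs_le.1 (key z)).1
    have h2 : (√n - 132096 * v * u) ^ 2 ≤ n - 32 * (2064 * v * (√n * u + u ^ 2)) := by
      have e1 : u ^ 2 ≤ √n * u := by nlinarith
      have e2 : (v * u) * u ≤ (v * u) * √n := mul_le_mul_of_nonneg_left (by nlinarith) hvu0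
      nlinarith [mul_nonneg hvu0 hn0]
    nlinarith [mul_le_mul_of_nonneg_right h2 (sq_nonneg ‖z‖)]
  · refine sigmaMax_le hM fun z => ?_
    apply le_of_sq_le_sq _ (by positivity)
    rw [sq_norm_mulVecE_rowMatrix, mul_pow]
    have h1 := (abs_le.1 (key z)).2
    have h2 : n + 32 * (2064 * v * (√n * u + u ^ 2)) ≤ (√n + 132096 * v * u) ^ 2 := by
      have e1 : (v * u) * u ≤ (v * u) * (v * u) := mul_le_mul_of_nonneg_left hvu hvu0
      nlinarith [mul_nonneg hvu0 hn0]
    nlinarith [mul_le_mul_of_nonneg_right h2 (sq_nonneg ‖z‖)]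

/-- Bernstein's inequality on a net of the sphere, applied to the product of the laws of the
rows. -/
theorem isSingularValueConstant_absolute : IsSingularValueConstant 132096 := by
  intro n M hM ρ Ω _ P _ V hL hind hmean hcov hsub t ht
  rcases Nat.eq_zero_or_pos n with rfl | hn
  · -- without rows all singular values vanish
    have huniv : {ω | √((0 : ℕ) : ℝ) - 132096 * (ρ : ℝ) ^ 2 * (√M + √t) ≤
        sigmaMin (rowMatrix fun i => V i ω) ∧ sigmaMax (rowMatrix fun i => V i ω) ≤
          √((0 : ℕ) : ℝ) + 132096 * (ρ : ℝ) ^ 2 * (√M + √t)} = Set.univ := by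
      refine Set.eq_univ_of_forall fun ω => ⟨?_, sigmaMax_le hM fun x => ?_⟩
      · refine le_trans ?_ (LinearMap.singularValues_nonneg _ _)
        simp only [Nat.cast_zero, Real.sqrt_zero, zero_sub]
        exact neg_nonpos.2 (by positivity)
      · rw [Subsingleton.elim (mulVecE (rowMatrix fun i => V i ω) x) 0, norm_zero]
        positivity
    rw [huniv, probReal_univ]
    linarith [Real.exp_pos (-t)]
  obtain ⟨s, hs1, hs2, hs3⟩ := exists_net_sphere M
  have hVm : ∀ i, AEMeasurable (V i) P := fun i => (hL i).aestronglyMeasurable.aemeasurable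
  set μ : Fin n → Measure (EuclideanSpace ℝ (Fin M)) := fun i => P.map (V i) with hμ
  have hprob : ∀ i, IsProbabilityMeasure (μ i) := fun i => Measure.isProbabilityMeasure_map (hVm i)
  have hmgf : ∀ y ∈ s, ∀ i, ∀ r : ℝ, ∫⁻ x, ENNReal.ofReal (Real.exp (r * ⟪y, x⟫_ℝ)) ∂(μ i) ≤
      ENNReal.ofReal (Real.exp ((ρ : ℝ) ^ 2 * r ^ 2 / 2)) := by
    intro y hy i r
    rw [hμ, lintegral_map' (by fun_prop) (hVm i)]
    exact (hsub i).lintegral_exp_le ((hL i).integrable one_le_two) (hmean i) (hs1 y hy) r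
  have hint : ∀ y ∈ s, ∀ i, Integrable (fun x => ⟪y, x⟫_ℝ ^ 2) (μ i) := by
    intro y _ i
    rw [hμ, integrable_map_measure (by fun_prop) (hVm i)]
    exact ((hL i).const_inner y).integrable_sq
  have hvar : ∀ y ∈ s, ∀ i, ∫ x, ⟪y, x⟫_ℝ ^ 2 ∂(μ i) = 1 := by
    intro y hy i
    rw [hμ, integral_map (hVm i) (by fun_prop)]
    have := integral_inner_mul_inner (hL i) (hmean i) y y
    rw [hcov i] at this
    simp only [sq, this]
    simp [mulVecE, hs1 y hy]
  have hρ : 1 ≤ (ρ : ℝ) ^ 2 := by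
    obtain ⟨y, hy⟩ : s.Nonempty := by
      have : Nonempty (Fin M) := ⟨⟨0, hM⟩⟩
      obtain ⟨x, hx⟩ := NormedSpace.sphere_nonempty (x := (0 : EuclideanSpace ℝ (Fin M))).2
        zero_le_one
      obtain ⟨y, hy, _⟩ := hs3 x (by simpa using hx)
      exact ⟨y, hy⟩
    exact one_le_of_integral_sq_eq_one (P := μ ⟨0, hn⟩) (W := fun x => ⟪y, x⟫_ℝ) (by fun_prop)
      (by positivity) (hmgf y hy _) (hint y hy _) (hvar y hy _)
  have hbad := measureReal_net_deviation_le hρ hM hs2 hmgf hint hvar ht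
  set B := {x : Fin n → EuclideanSpace ℝ (Fin M) | ∃ y ∈ s,
    2064 * (ρ : ℝ) ^ 2 * (√n * (√M + √t) + (√M + √t) ^ 2) < |∑ i, ⟪y, x i⟫_ℝ ^ 2 - n|} with hB
  have hBm : MeasurableSet B := by
    have : B = ⋃ y ∈ s, {x | 2064 * (ρ : ℝ) ^ 2 * (√n * (√M + √t) + (√M + √t) ^ 2) <
        |∑ i, ⟪y, x i⟫_ℝ ^ 2 - n|} := by
      ext x; simp [hB]
    rw [this]
    refine Finset.measurableSet_biUnion _ fun y _ => ?_
    exact measurableSet_lt measurable_const (by fun_prop)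
  have hVpi : AEMeasurable (fun ω i => V i ω) P := aemeasurable_pi_iff.2 hVm
  have hlaw : P.map (fun ω i => V i ω) = Measure.pi μ := hind.map_fun_eq_pi_map hVm
  have hPB : P.real ((fun ω i => V i ω) ⁻¹' B) ≤ 2 * Real.exp (-t) := by
    rw [← hlaw] at hbad
    rwa [measureReal_def, Measure.map_apply_of_aemeasurable hVpi hBm] at hbad
  have hnull : NullMeasurableSet ((fun ω i => V i ω) ⁻¹' B) P := hVpi.nullMeasurableSet_preimage hBm
  have hcompl : 1 - 2 * Real.exp (-t) ≤ P.real ((fun ω i => V i ω) ⁻¹' B)ᶜ := by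
    rw [probReal_compl_eq_one_sub₀ hnull]; linarith
  refine hcompl.trans (measureReal_mono fun ω hω => ?_)
  have hω' : ∀ y ∈ s, |∑ i, ⟪y, V i ω⟫_ℝ ^ 2 - n| ≤
      2064 * (ρ : ℝ) ^ 2 * (√n * (√M + √t) + (√M + √t) ^ 2) := by
    intro y hy
    by_contra! h
    exact hω ⟨y, hy, h⟩
  exact sigma_bounds_of_net hM (fun i => V i ω) hs1 hs3 hρ (by positivity) hω'

/-! ### Conditionally independent samples -/

section PiKernel

variable {α β : Type*} [MeasurableSpace α] [MeasurableSpace β]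

/-- The conditional law of `n` conditionally independent observations: given `y`, the `i`-th
observation has law `κ (y i)`. -/
def piKernel (n : ℕ) (κ : Kernel α β) [IsMarkovKernel κ] : Kernel (Fin n → α) (Fin n → β) where
  toFun y := Measure.pi fun i => κ (y i)
  measurable' := by
    refine Measurable.measure_of_isPiSystem_of_isProbabilityMeasure
      (generateFrom_pi (α := fun _ : Fin n => β)).symm isPiSystem_pi ?_
    rintro _ ⟨s, hs, rfl⟩
    simp_rw [Measure.pi_pi]
    refine Finset.measurable_prod _ fun i _ => ?_
    exact (κ.measurable_coe (hs i (Set.mem_univ i))).comp (measurable_pi_apply i)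

variable {n : ℕ} {κ : Kernel α β} [IsMarkovKernel κ]

lemma piKernel_apply (y : Fin n → α) : piKernel n κ y = Measure.pi fun i => κ (y i) := rfl

instance : IsMarkovKernel (piKernel n κ) :=
  ⟨fun y => by rw [piKernel_apply]; infer_instance⟩

/-- Independent pairs with law `μ ⊗ₘ κ`: the first components are independent with law `μ` and,
given these, the second components are independent with laws `κ (y i)`. -/
lemma map_pi_compProd_eq (μ : Measure α) [IsProbabilityMeasure μ] :
    (Measure.pi fun _ : Fin n => μ ⊗ₘ κ).map (fun z => (fun i => (z i).1, fun i => (z i).2)) =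
      (Measure.pi fun _ : Fin n => μ) ⊗ₘ piKernel n κ := by
  have hm : Measurable fun (p : (Fin n → α) × (Fin n → β)) (i : Fin n) => (p.1 i, p.2 i) := by
    fun_prop
  have h : (Measure.pi fun _ : Fin n => μ ⊗ₘ κ) =
      ((Measure.pi fun _ : Fin n => μ) ⊗ₘ piKernel n κ).map fun p i => (p.1 i, p.2 i) := by
    refine Measure.pi_eq fun s hs => ?_
    rw [Measure.map_apply hm (MeasurableSet.univ_pi hs),
      Measure.compProd_apply (hm (MeasurableSet.univ_pi hs))]
    have e : ∀ y : Fin n → α, piKernel n κ y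
        (Prod.mk y ⁻¹' ((fun (p : (Fin n → α) × (Fin n → β)) (i : Fin n) => (p.1 i, p.2 i)) ⁻¹'
          Set.univ.pi s)) = ∏ i, κ (y i) (Prod.mk (y i) ⁻¹' s i) := by
      intro y
      rw [piKernel_apply, ← Measure.pi_pi]
      rfl
    simp_rw [e]
    rw [lintegral_prod_pi (fun _ : Fin n => μ)
      (f := fun i y => κ y (Prod.mk y ⁻¹' s i))
      (fun i => Kernel.measurable_kernel_prodMk_left (hs i))]
    exact Finset.prod_congr rfl fun i _ => (Measure.compProd_apply (hs i)).symm
  rw [h, Measure.map_map (by fun_prop) hm]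
  exact Measure.map_id

end PiKernel

/-! ### Exponential moments of the noise and of the bias -/

/-- The product of a sub-Gaussian variable with a bounded one, if centred, is sub-Gaussian with
variance proxy enlarged by the factor `3/2`. -/
lemma lintegral_exp_mul_bounded_le {α : Type*} [MeasurableSpace α] {P : Measure α}
    [IsProbabilityMeasure P] {U m : α → ℝ} (hU : Measurable U) (hm : Measurable m) {b v : ℝ}
    (hb : ∀ᵐ y ∂P, |m y| ≤ b)
    (hmgf : ∀ s : ℝ, ∫⁻ y, ENNReal.ofReal (Real.exp (s * U y)) ∂P ≤
      ENNReal.ofReal (Real.exp (v * s ^ 2 / 2)))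
    (hint : Integrable (fun y => U y * m y) P) (hmean : ∫ y, U y * m y ∂P = 0) :
    ∫⁻ y, ENNReal.ofReal (Real.exp (U y * m y)) ∂P ≤
      ENNReal.ofReal (Real.exp (3 / 2 * v * b ^ 2 / 2)) := by
  set r := √(3 / 2 : ℝ) with hr
  have hr0 : 0 ≤ r := Real.sqrt_nonneg _
  have hr2 : r ^ 2 = 3 / 2 := Real.sq_sqrt (by norm_num)
  have hexp : ∀ s : ℝ, Integrable (fun y => Real.exp (s * U y)) P := fun s =>
    integrable_of_lintegral_ofReal_le (by fun_prop) (fun _ => (Real.exp_pos _).le) (hmgf s)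
  have hexp2 : ∀ s : ℝ, ∫ y, Real.exp (s * U y) ∂P ≤ Real.exp (v * s ^ 2 / 2) := fun s =>
    integral_le_of_lintegral_ofReal_le (by fun_prop) (fun _ => (Real.exp_pos _).le)
      (Real.exp_pos _).le (hmgf s)
  have hcosh : Integrable (fun y => Real.cosh (r * b * U y)) P := by
    have := ((hexp (r * b)).add (hexp (-(r * b)))).div_const 2
    refine this.congr (ae_of_all _ fun y => ?_)
    simp [Real.cosh_eq]
  have hcosh2 : ∫ y, Real.cosh (r * b * U y) ∂P ≤ Real.exp (3 / 2 * v * b ^ 2 / 2) := by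
    have e : ∀ y, Real.cosh (r * b * U y) =
        (Real.exp (r * b * U y) + Real.exp (-(r * b) * U y)) / 2 := by
      intro y; simp [Real.cosh_eq]
    simp_rw [e]
    rw [integral_div, integral_add (hexp _) (hexp _)]
    have h1 := hexp2 (r * b)
    have h2 := hexp2 (-(r * b))
    have e1 : v * (r * b) ^ 2 / 2 = 3 / 2 * v * b ^ 2 / 2 := by rw [mul_pow, hr2]; ring
    have e2 : v * (-(r * b)) ^ 2 / 2 = 3 / 2 * v * b ^ 2 / 2 := by rw [neg_sq, e1]
    rw [e1] at h1
    rw [e2] at h2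
    linarith
  have hpt : ∀ᵐ y ∂P, Real.exp (U y * m y) ≤ U y * m y + Real.cosh (r * b * U y) := by
    filter_upwards [hb] with y hy
    have h1 := exp_sub_self_le_cosh (U y * m y)
    have h2 : Real.cosh (r * (U y * m y)) ≤ Real.cosh (r * b * U y) := by
      rw [Real.cosh_le_cosh, abs_mul, abs_mul, abs_mul, abs_mul]
      have : |m y| ≤ |b| := hy.trans (le_abs_self b)
      calc |r| * (|U y| * |m y|) ≤ |r| * (|U y| * |b|) := by gcongr
        _ = _ := by ring
    linarith
  have hi : Integrable (fun y => Real.exp (U y * m y)) P := by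
    refine Integrable.mono' (hint.add hcosh) (by fun_prop) ?_
    filter_upwards [hpt] with y hy
    rw [Real.norm_eq_abs, abs_of_pos (Real.exp_pos _)]
    exact hy
  rw [← ofReal_integral_eq_lintegral_ofReal hi (ae_of_all _ fun ω => (Real.exp_pos _).le)]
  apply ENNReal.ofReal_le_ofReal
  calc ∫ y, Real.exp (U y * m y) ∂P ≤ ∫ y, (U y * m y + Real.cosh (r * b * U y)) ∂P :=
        integral_mono_ae hi (hint.add hcosh) hpt
    _ = ∫ y, Real.cosh (r * b * U y) ∂P := by rw [integral_add hint hcosh, hmean, zero_add]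
    _ ≤ _ := hcosh2

section InvSqrt

variable {k : ℕ} {C : Matrix (Fin k) (Fin k) ℝ}

open scoped MatrixOrder in
lemma posSemidef_invSqrt (C : Matrix (Fin k) (Fin k) ℝ) : (invSqrt C).PosSemidef :=
  Matrix.nonneg_iff_posSemidef.1 (CFC.sqrt_nonneg _)

lemma transpose_invSqrt (C : Matrix (Fin k) (Fin k) ℝ) : (invSqrt C)ᵀ = invSqrt C :=
  (Matrix.conjTranspose_eq_transpose_of_trivial _).symm.trans (posSemidef_invSqrt C).isHermitian.eq

open scoped MatrixOrder in
lemma invSqrt_mul_invSqrt (hC : C.PosDef) : invSqrt C * invSqrt C = C⁻¹ :=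
  CFC.sqrt_mul_sqrt_self _ (Matrix.nonneg_iff_posSemidef.2 hC.inv.posSemidef)

lemma invSqrt_mul_mul_invSqrt (hC : C.PosDef) : invSqrt C * (C * invSqrt C) = 1 := by
  have hdet : IsUnit C.det := (Matrix.isUnit_iff_isUnit_det _).1 hC.isUnit
  have h : C * invSqrt C * invSqrt C = 1 := by
    rw [Matrix.mul_assoc, invSqrt_mul_invSqrt hC, Matrix.mul_nonsing_inv _ hdet]
  exact mul_eq_one_comm.1 h

lemma invSqrt_mul_comm (hC : C.PosDef) : invSqrt C * C = C * invSqrt C := by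
  have h := invSqrt_mul_mul_invSqrt hC
  calc invSqrt C * C = invSqrt C * C * (invSqrt C * (C * invSqrt C)) := by rw [h, Matrix.mul_one]
    _ = (invSqrt C * (C * invSqrt C)) * (C * invSqrt C) := by simp only [Matrix.mul_assoc]
    _ = _ := by rw [h, Matrix.one_mul]

end InvSqrt

lemma mulVecE_mul {a b c : ℕ} (A : Matrix (Fin a) (Fin b) ℝ) (B : Matrix (Fin b) (Fin c) ℝ)
    (x : EuclideanSpace ℝ (Fin c)) : mulVecE (A * B) x = mulVecE A (mulVecE B x) := by
  simp [mulVecE, Matrix.toLpLin_apply, Matrix.mulVec_mulVec]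

lemma mulVecE_one {a : ℕ} (x : EuclideanSpace ℝ (Fin a)) :
    mulVecE (1 : Matrix (Fin a) (Fin a) ℝ) x = x := by
  simp [mulVecE]

lemma inner_mulVecE_right {a b : ℕ} (A : Matrix (Fin a) (Fin b) ℝ) (x : EuclideanSpace ℝ (Fin a))
    (y : EuclideanSpace ℝ (Fin b)) : ⟪x, mulVecE A y⟫_ℝ = ⟪mulVecE Aᵀ x, y⟫_ℝ := by
  simp only [mulVecE, Matrix.toLpLin_apply, EuclideanSpace.inner_eq_star_dotProduct, star_trivial]
  rw [Matrix.mulVec_transpose, dotProduct_comm, Matrix.dotProduct_mulVec, dotProduct_comm]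

/-- Exponential moments of a law with companion matrix `C`; the vector `α = C^{1/2} β` is written as
`(C C^{-1/2}) β`. -/
lemma HasCompanionMatrix.lintegral_exp_le {N : ℕ} {ν : Measure (EuclideanSpace ℝ (Fin N))}
    {C : Matrix (Fin N) (Fin N) ℝ} (hν : HasCompanionMatrix ν C) (hC : C.PosDef)
    (β : EuclideanSpace ℝ (Fin N)) :
    ∫⁻ e, ENNReal.ofReal (Real.exp ⟪β, e⟫_ℝ) ∂ν ≤
      ENNReal.ofReal (Real.exp (⟪β, ∫ e, e ∂ν⟫_ℝ + ⟪β, mulVecE C β⟫_ℝ / 2)) := by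
  set R := invSqrt C with hR
  set m := ∫ e, e ∂ν with hm
  obtain ⟨h1, h2⟩ := hν (mulVecE (C * R) β)
  have e1 : ∀ z, ⟪mulVecE (C * R) β, mulVecE R z⟫_ℝ = ⟪β, z⟫_ℝ := by
    intro z
    rw [inner_mulVecE_right, ← mulVecE_mul, transpose_invSqrt, invSqrt_mul_mul_invSqrt hC,
      mulVecE_one]
  have hCt : Cᵀ = C :=
    (Matrix.conjTranspose_eq_transpose_of_trivial _).symm.trans hC.isHermitian.eq
  have e2 : ‖mulVecE (C * R) β‖ ^ 2 = ⟪β, mulVecE C β⟫_ℝ := by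
    rw [← real_inner_self_eq_norm_sq, inner_mulVecE_right, ← mulVecE_mul, Matrix.transpose_mul,
      transpose_invSqrt, hCt, real_inner_comm]
    congr 2
    have hdet : IsUnit C.det := (Matrix.isUnit_iff_isUnit_det _).1 hC.isUnit
    calc R * C * (C * R) = C * (R * R) * C := by
          rw [invSqrt_mul_comm hC, Matrix.mul_assoc C R, ← invSqrt_mul_comm hC]
          simp only [Matrix.mul_assoc]; rfl
      _ = C := by rw [invSqrt_mul_invSqrt hC, Matrix.mul_nonsing_inv _ hdet, Matrix.one_mul]
  simp only [← hm, ← hR, e1, e2] at h1 h2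
  have e3 : ∀ e, Real.exp ⟪β, e⟫_ℝ = Real.exp ⟪β, m⟫_ℝ * Real.exp ⟪β, e - m⟫_ℝ := by
    intro e
    rw [← Real.exp_add, inner_sub_right]; congr 1; ring
  rw [lintegral_congr fun e => congrArg ENNReal.ofReal (e3 e),
    ← ofReal_integral_eq_lintegral_ofReal (h1.const_mul _)
    (ae_of_all _ fun ω => by positivity), integral_const_mul, Real.exp_add]
  apply ENNReal.ofReal_le_ofReal
  gcongr

/-! ### The Gram matrix and the pseudoinverse -/

section Pseudoinverse

/-- The left inverse `(Wᵀ W)⁻¹ Wᵀ` of a matrix `W` of full column rank. -/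
def pinv {n M : ℕ} (W : Matrix (Fin n) (Fin M) ℝ) : Matrix (Fin M) (Fin n) ℝ := (Wᵀ * W)⁻¹ * Wᵀ

variable {n M N : ℕ} {W : Matrix (Fin n) (Fin M) ℝ} {σ : ℝ}

lemma dotProduct_self_eq_sq_norm {k : ℕ} (x : Fin k → ℝ) : x ⬝ᵥ x = ‖WithLp.toLp 2 x‖ ^ 2 := by
  rw [EuclideanSpace.norm_sq_eq]
  exact Finset.sum_congr rfl fun i _ => by simp [sq]

lemma mul_dotProduct_le_of_le_sigmaMin (hM : 0 < M) (hσ : 0 ≤ σ) (h : σ ≤ sigmaMin W)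
    (x : Fin M → ℝ) : σ ^ 2 * (x ⬝ᵥ x) ≤ (W *ᵥ x) ⬝ᵥ (W *ᵥ x) := by
  have h1 := (le_sigmaMin_iff hM W σ).1 h (WithLp.toLp 2 x)
  rw [dotProduct_self_eq_sq_norm, dotProduct_self_eq_sq_norm, ← mul_pow]
  exact pow_le_pow_left₀ (by positivity) h1 2

lemma isUnit_det_gram (hσ : 0 < σ)
    (hW : ∀ x : Fin M → ℝ, σ ^ 2 * (x ⬝ᵥ x) ≤ (W *ᵥ x) ⬝ᵥ (W *ᵥ x)) :
    IsUnit (Wᵀ * W).det := by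
  rw [← Matrix.isUnit_iff_isUnit_det, ← Matrix.mulVec_injective_iff_isUnit]
  rw [← Matrix.coe_mulVecLin, injective_iff_map_eq_zero]
  intro x hx
  rw [Matrix.mulVecLin_apply] at hx
  have h1 : (W *ᵥ x) ⬝ᵥ (W *ᵥ x) = 0 := by
    rw [Matrix.dotProduct_mulVec, ← Matrix.mulVec_transpose, Matrix.mulVec_mulVec, hx,
      zero_dotProduct]
  have h2 := hW x
  rw [h1] at h2
  have h3 : x ⬝ᵥ x ≤ 0 := by
    by_contra! h
    have : 0 < σ ^ 2 * (x ⬝ᵥ x) := by positivity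
    linarith
  exact dotProduct_self_eq_zero.1 (le_antisymm h3 (dotProduct_self_eq_sq_norm x ▸ sq_nonneg _))

/-- With `a = (Wᵀ W)⁻¹ u`, expanding `0 ≤ ‖u - σ² a‖²` gives `‖W a‖ ≤ σ⁻¹ ‖u‖`. -/
lemma pinv_transpose_mulVec_le (hσ : 0 < σ)
    (hW : ∀ x : Fin M → ℝ, σ ^ 2 * (x ⬝ᵥ x) ≤ (W *ᵥ x) ⬝ᵥ (W *ᵥ x))
    (u : Fin M → ℝ) : σ ^ 2 * (((pinv W)ᵀ *ᵥ u) ⬝ᵥ ((pinv W)ᵀ *ᵥ u)) ≤ u ⬝ᵥ u := by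
  have hdet := isUnit_det_gram hσ hW
  have ht : (pinv W)ᵀ = W * (Wᵀ * W)⁻¹ := by
    rw [pinv, Matrix.transpose_mul, Matrix.transpose_transpose, Matrix.transpose_nonsing_inv,
      Matrix.transpose_mul, Matrix.transpose_transpose]
  set a := (Wᵀ * W)⁻¹ *ᵥ u with ha
  have hu : (Wᵀ * W) *ᵥ a = u := by
    rw [ha, Matrix.mulVec_mulVec, Matrix.mul_nonsing_inv _ hdet, Matrix.one_mulVec]
  rw [ht, ← Matrix.mulVec_mulVec, ← ha]
  have h1 : (W *ᵥ a) ⬝ᵥ (W *ᵥ a) = u ⬝ᵥ a := by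
    rw [Matrix.dotProduct_mulVec, ← Matrix.mulVec_transpose, Matrix.mulVec_mulVec, hu]
  have h2 := hW a
  have h3 : 0 ≤ (u - σ ^ 2 • a) ⬝ᵥ (u - σ ^ 2 • a) := dotProduct_self_eq_sq_norm _ ▸ sq_nonneg _
  have h4 : (u - σ ^ 2 • a) ⬝ᵥ (u - σ ^ 2 • a) =
      u ⬝ᵥ u - 2 * σ ^ 2 * (u ⬝ᵥ a) + σ ^ 2 * (σ ^ 2 * (a ⬝ᵥ a)) := by
    simp only [sub_dotProduct, dotProduct_sub, smul_dotProduct, dotProduct_smul, smul_eq_mul,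
      dotProduct_comm a u]
    ring
  rw [h1] at h2 ⊢
  have h5 := mul_le_mul_of_nonneg_left h2 (sq_nonneg σ)
  linarith

lemma inv_gram_mulVec_le (hσ : 0 < σ)
    (hW : ∀ x : Fin M → ℝ, σ ^ 2 * (x ⬝ᵥ x) ≤ (W *ᵥ x) ⬝ᵥ (W *ᵥ x))
    (u : Fin M → ℝ) :
    σ ^ 4 * (((Wᵀ * W)⁻¹ *ᵥ u) ⬝ᵥ ((Wᵀ * W)⁻¹ *ᵥ u)) ≤ u ⬝ᵥ u := by
  have h1 := pinv_transpose_mulVec_le hσ hW u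
  have ht : (pinv W)ᵀ = W * (Wᵀ * W)⁻¹ := by
    rw [pinv, Matrix.transpose_mul, Matrix.transpose_transpose, Matrix.transpose_nonsing_inv,
      Matrix.transpose_mul, Matrix.transpose_transpose]
  rw [ht, ← Matrix.mulVec_mulVec] at h1
  have h2 := mul_le_mul_of_nonneg_left (hW ((Wᵀ * W)⁻¹ *ᵥ u)) (sq_nonneg σ)
  calc _ = σ ^ 2 * (σ ^ 2 * (((Wᵀ * W)⁻¹ *ᵥ u) ⬝ᵥ ((Wᵀ * W)⁻¹ *ᵥ u))) := by ring
    _ ≤ _ := h2.trans h1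

lemma trace_transpose_mul_eq_sum {a b : ℕ} (A B : Matrix (Fin a) (Fin b) ℝ) :
    (Aᵀ * B).trace = ∑ i, ∑ j, A i j * B i j := by
  simp only [Matrix.trace, Matrix.diag, Matrix.mul_apply, Matrix.transpose_apply]
  rw [Finset.sum_comm]

lemma sum_sq_mul_inv_gram_le (hσ : 0 < σ)
    (hW : ∀ x : Fin M → ℝ, σ ^ 2 * (x ⬝ᵥ x) ≤ (W *ᵥ x) ⬝ᵥ (W *ᵥ x))
    (S : Matrix (Fin M) (Fin N) ℝ) :
    σ ^ 4 * ∑ k, ∑ j, ((Wᵀ * W)⁻¹ * S) k j ^ 2 ≤ ∑ k, ∑ j, S k j ^ 2 := by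
  rw [Finset.sum_comm, Finset.sum_comm (f := fun k j => S k j ^ 2), Finset.mul_sum]
  refine Finset.sum_le_sum fun j _ => ?_
  have := inv_gram_mulVec_le hσ hW (fun k => S k j)
  simpa [dotProduct, Matrix.mulVec, Matrix.mul_apply, sq] using this

/-! ### The least squares estimator -/

lemma trace_self_transpose_pos {a b : ℕ} {A : Matrix (Fin a) (Fin b) ℝ} (hA : A ≠ 0) :
    0 < (Aᵀ * A).trace := by
  have h0 : 0 ≤ (Aᵀ * A).trace := by
    rw [trace_transpose_mul_eq_sum]
    exact Finset.sum_nonneg fun i _ => Finset.sum_nonneg fun j _ => mul_self_nonneg _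
  refine lt_of_le_of_ne h0 fun h => hA ?_
  rw [← Matrix.conjTranspose_eq_transpose_of_trivial] at h
  exact Matrix.trace_conjTranspose_mul_self_eq_zero_iff.1 h.symm

/-- Pythagoras: the residual at `pinv W * E` is orthogonal to the range of `W`. -/
lemma trace_residual_lt (hdet : IsUnit (Wᵀ * W).det) (E : Matrix (Fin n) (Fin N) ℝ)
    {Ψ : Matrix (Fin M) (Fin N) ℝ} (hΨ : Ψ ≠ pinv W * E) :
    ((W * (pinv W * E) - E)ᵀ * (W * (pinv W * E) - E)).trace <
      ((W * Ψ - E)ᵀ * (W * Ψ - E)).trace := by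
  set Φ := pinv W * E with hΦ
  have horth : Wᵀ * (W * Φ - E) = 0 := by
    rw [Matrix.mul_sub, hΦ, pinv, Matrix.mul_assoc, ← Matrix.mul_assoc Wᵀ W,
      ← Matrix.mul_assoc (Wᵀ * W), Matrix.mul_nonsing_inv _ hdet, Matrix.one_mul, sub_self]
  have horth' : (W * Φ - E)ᵀ * W = 0 := by
    rw [← Matrix.transpose_transpose W, ← Matrix.transpose_mul]
    rw [Matrix.transpose_transpose, horth, Matrix.transpose_zero]
  have hdec : W * Ψ - E = W * (Ψ - Φ) + (W * Φ - E) := by rw [Matrix.mul_sub]; abel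
  have hne : W * (Ψ - Φ) ≠ 0 := by
    intro h
    apply hΨ
    have h1 : Wᵀ * W * (Ψ - Φ) = 0 := by rw [Matrix.mul_assoc, h, Matrix.mul_zero]
    have h2 : (Wᵀ * W)⁻¹ * (Wᵀ * W * (Ψ - Φ)) = Ψ - Φ := by
      rw [← Matrix.mul_assoc, Matrix.nonsing_inv_mul _ hdet, Matrix.one_mul]
    rw [h1, Matrix.mul_zero] at h2
    exact sub_eq_zero.1 h2.symm
  have hpos := trace_self_transpose_pos hne
  have e : (W * Ψ - E)ᵀ * (W * Ψ - E) =
      (W * (Ψ - Φ))ᵀ * (W * (Ψ - Φ)) + (W * Φ - E)ᵀ * (W * Φ - E) := by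
    rw [hdec, Matrix.transpose_add, Matrix.add_mul, Matrix.mul_add, Matrix.mul_add,
      ← Matrix.mul_assoc (W * Φ - E)ᵀ W, horth', Matrix.zero_mul, zero_add]
    have : (W * (Ψ - Φ))ᵀ * (W * Φ - E) = 0 := by
      rw [Matrix.transpose_mul, Matrix.mul_assoc, horth, Matrix.mul_zero]
    rw [this, add_zero]
  rw [e, Matrix.trace_add]
  linarith

end Pseudoinverse

section LeastSquares

variable {n M N : ℕ}

/-- The empirical risk in whitened coordinates `Θ = Θs + R Ψ`. -/
lemma empMSE_whitened (x : Fin n → EuclideanSpace ℝ (Fin N)) (y : Fin n → EuclideanSpace ℝ (Fin M))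
    (Θs Ψ : Matrix (Fin M) (Fin N) ℝ) {R : Matrix (Fin M) (Fin M) ℝ} (hR : Rᵀ = R) :
    empMSE x y (Θs + R * Ψ) = (1 / n) *
      ((rowMatrix (fun i => mulVecE R (y i)) * Ψ - rowMatrix (fun i => x i - mulVecE Θsᵀ (y i)))ᵀ *
        (rowMatrix (fun i => mulVecE R (y i)) * Ψ -
          rowMatrix (fun i => x i - mulVecE Θsᵀ (y i)))).trace := by
  rw [empMSE, trace_transpose_mul_eq_sum]
  congr 1
  refine Finset.sum_congr rfl fun i _ => ?_
  rw [EuclideanSpace.norm_sq_eq]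
  refine Finset.sum_congr rfl fun j _ => ?_
  rw [Real.norm_eq_abs, sq_abs, sq]
  have e : (mulVecE (Θs + R * Ψ)ᵀ (y i) - x i) j =
      (rowMatrix (fun i => mulVecE R (y i)) * Ψ -
        rowMatrix (fun i => x i - mulVecE Θsᵀ (y i))) i j := by
    have h1 : mulVecE (Θs + R * Ψ)ᵀ (y i) = mulVecE Θsᵀ (y i) + mulVecE Ψᵀ (mulVecE R (y i)) := by
      rw [Matrix.transpose_add, Matrix.transpose_mul, hR, ← mulVecE_mul]
      simp [mulVecE]
    rw [h1]
    have h2 : (rowMatrix (fun i => mulVecE R (y i)) * Ψ) i j = mulVecE Ψᵀ (mulVecE R (y i)) j := by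
      simp only [rowMatrix, Matrix.mul_apply, Matrix.of_apply, mulVecE, Matrix.toLpLin_apply,
        Matrix.mulVec, dotProduct, Matrix.transpose_apply]
      exact Finset.sum_congr rfl fun k _ => mul_comm _ _
    rw [Matrix.sub_apply, h2]
    simp [rowMatrix]
    ring
  rw [e]

lemma isLeastSquaresEstimator_whitened (hn : 0 < n) (x : Fin n → EuclideanSpace ℝ (Fin N))
    (y : Fin n → EuclideanSpace ℝ (Fin M)) (Θs : Matrix (Fin M) (Fin N) ℝ)
    {R : Matrix (Fin M) (Fin M) ℝ} (hR : Rᵀ = R) (hRu : IsUnit R.det)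
    (hdet : IsUnit ((rowMatrix (fun i => mulVecE R (y i)))ᵀ *
      rowMatrix (fun i => mulVecE R (y i))).det) :
    IsLeastSquaresEstimator x y (Θs + R * (pinv (rowMatrix (fun i => mulVecE R (y i))) *
      rowMatrix (fun i => x i - mulVecE Θsᵀ (y i)))) := by
  intro Θ' hΘ'
  have hΘ : Θ' = Θs + R * (R⁻¹ * (Θ' - Θs)) := by
    rw [← Matrix.mul_assoc, Matrix.mul_nonsing_inv _ hRu, Matrix.one_mul]; abel
  rw [hΘ, empMSE_whitened x y Θs _ hR, empMSE_whitened x y Θs _ hR]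
  have hn' : (0 : ℝ) < 1 / n := by positivity
  refine mul_lt_mul_of_pos_left (trace_residual_lt hdet _ ?_) hn'
  intro h
  exact hΘ' (by rw [hΘ, h])

end LeastSquares

/-! ### Second moments in the linear model -/

section Covariance

variable {Ω : Type*} [MeasurableSpace Ω] {P : Measure Ω} {k l : ℕ}
  {V : Ω → EuclideanSpace ℝ (Fin k)}

lemma integrable_inner_mul_inner {W : Ω → EuclideanSpace ℝ (Fin l)} (hV : MemLp V 2 P)
    (hW : MemLp W 2 P) (a : EuclideanSpace ℝ (Fin k)) (b : EuclideanSpace ℝ (Fin l)) :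
    Integrable (fun ω => ⟪a, V ω⟫_ℝ * ⟪b, W ω⟫_ℝ) P :=
  (hV.const_inner (𝕜 := ℝ) a).integrable_mul (hW.const_inner (𝕜 := ℝ) b)

lemma covMat_eq_of_inner [IsProbabilityMeasure P] (hV : MemLp V 2 P) (h0 : ∫ ω, V ω ∂P = 0)
    {K : Matrix (Fin k) (Fin k) ℝ}
    (h : ∀ a b, ∫ ω, ⟪a, V ω⟫_ℝ * ⟪b, V ω⟫_ℝ ∂P = ⟪a, mulVecE K b⟫_ℝ) : covMat V P = K := by
  apply Matrix.toEuclideanLin.injective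
  ext1 b
  refine ext_inner_left ℝ fun a => ?_
  exact (integral_inner_mul_inner hV h0 a b).symm.trans (h a b)

lemma covMat_posSemidef [IsProbabilityMeasure P]
    (hV : MemLp V 2 P) (h0 : ∫ ω, V ω ∂P = 0) : (covMat V P).PosSemidef := by
  refine Matrix.PosSemidef.of_dotProduct_mulVec_nonneg ?_ fun x => ?_
  · ext i j
    simp [covMat, covariance_comm]
  · have h := integral_inner_mul_inner hV h0 (WithLp.toLp 2 x) (WithLp.toLp 2 x)
    have h1 : 0 ≤ ∫ ω, ⟪WithLp.toLp 2 x, V ω⟫_ℝ * ⟪WithLp.toLp 2 x, V ω⟫_ℝ ∂P :=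
      integral_nonneg fun ω => mul_self_nonneg _
    rw [h] at h1
    simpa [EuclideanSpace.inner_eq_star_dotProduct, mulVecE, Matrix.toLpLin_apply,
      dotProduct_comm] using h1

lemma covMat_posDef [IsProbabilityMeasure P]
    (hV : MemLp V 2 P) (h0 : ∫ ω, V ω ∂P = 0) (hu : IsUnit (covMat V P)) :
    (covMat V P).PosDef :=
  (covMat_posSemidef hV h0).posDef_iff_isUnit.2 hu

lemma MemLp.mulVecE (hV : MemLp V 2 P) (B : Matrix (Fin l) (Fin k) ℝ) :
    MemLp (fun ω => LMMSE.mulVecE B (V ω)) 2 P :=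
  (LinearMap.toContinuousLinearMap (Matrix.toEuclideanLin B)).comp_memLp' hV

lemma integral_mulVecE (hV : Integrable V P) (h0 : ∫ ω, V ω ∂P = 0)
    (B : Matrix (Fin l) (Fin k) ℝ) : ∫ ω, mulVecE B (V ω) ∂P = 0 := by
  have h := (LinearMap.toContinuousLinearMap (Matrix.toEuclideanLin B)).integral_comp_comm hV
  rw [h0, map_zero] at h
  exact h

/-- Whitening: `C^{-1/2} V` has identity covariance matrix. -/
lemma covMat_whitened [IsProbabilityMeasure P]
    (hV : MemLp V 2 P) (h0 : ∫ ω, V ω ∂P = 0) (hC : (covMat V P).PosDef) :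
    covMat (fun ω => mulVecE (invSqrt (covMat V P)) (V ω)) P = 1 := by
  refine covMat_eq_of_inner (MemLp.mulVecE hV _) (integral_mulVecE (hV.integrable one_le_two) h0 _)
    fun a b => ?_
  simp_rw [inner_mulVecE_right]
  rw [integral_inner_mul_inner hV h0, ← inner_mulVecE_right, ← mulVecE_mul, ← mulVecE_mul,
    transpose_invSqrt, Matrix.mul_assoc, invSqrt_mul_mul_invSqrt hC]
  exact inner_mulVecE_right 1 a b

end Covariance

section Model

variable {Ω : Type*} [MeasurableSpace Ω] {P : Measure Ω} {N M : ℕ}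
  {A : Matrix (Fin M) (Fin N) ℝ} {X : Ω → EuclideanSpace ℝ (Fin N)}
  {Z : Ω → EuclideanSpace ℝ (Fin M)}

lemma memLp_obs (hX : MemLp X 2 P) (hZ : MemLp Z 2 P) : MemLp (obs A X Z) 2 P :=
  (MemLp.mulVecE hX A).add hZ

lemma integral_obs [IsProbabilityMeasure P]
    (hX : MemLp X 2 P) (hZ : MemLp Z 2 P) (hX0 : ∫ ω, X ω ∂P = 0)
    (hZ0 : ∫ ω, Z ω ∂P = 0) : ∫ ω, obs A X Z ω ∂P = 0 := by
  simp only [obs]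
  rw [integral_add ((MemLp.mulVecE hX A).integrable one_le_two) (hZ.integrable one_le_two),
    integral_mulVecE (hX.integrable one_le_two) hX0, hZ0, add_zero]

lemma integral_inner_mul_inner_of_indepFun [IsProbabilityMeasure P]
    (hX : MemLp X 2 P) (hZ : MemLp Z 2 P)
    (hXZ : IndepFun X Z P) (hX0 : ∫ ω, X ω ∂P = 0) (b : EuclideanSpace ℝ (Fin N))
    (a : EuclideanSpace ℝ (Fin M)) : ∫ ω, ⟪b, X ω⟫_ℝ * ⟪a, Z ω⟫_ℝ ∂P = 0 := by
  have hind : IndepFun (fun ω => ⟪b, X ω⟫_ℝ) (fun ω => ⟪a, Z ω⟫_ℝ) P :=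
    hXZ.comp (φ := fun x => ⟪b, x⟫_ℝ) (ψ := fun z => ⟪a, z⟫_ℝ) (by fun_prop) (by fun_prop)
  rw [hind.integral_fun_mul_eq_mul_integral (hX.const_inner b).aestronglyMeasurable
    (hZ.const_inner a).aestronglyMeasurable,
    integral_inner_eq_zero (hX.integrable one_le_two) hX0, zero_mul]

lemma integral_inner_obs_mul_inner [IsProbabilityMeasure P] (hX : MemLp X 2 P) (hZ : MemLp Z 2 P)
    (hXZ : IndepFun X Z P) (hX0 : ∫ ω, X ω ∂P = 0) (a : EuclideanSpace ℝ (Fin M))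
    (b : EuclideanSpace ℝ (Fin N)) :
    ∫ ω, ⟪a, obs A X Z ω⟫_ℝ * ⟪b, X ω⟫_ℝ ∂P = ⟪a, mulVecE (A * covMat X P) b⟫_ℝ := by
  have e : ∀ ω, ⟪a, obs A X Z ω⟫_ℝ * ⟪b, X ω⟫_ℝ =
      ⟪mulVecE Aᵀ a, X ω⟫_ℝ * ⟪b, X ω⟫_ℝ + ⟪b, X ω⟫_ℝ * ⟪a, Z ω⟫_ℝ := by
    intro ω
    rw [obs, inner_add_right, inner_mulVecE_right]; ring
  simp_rw [e]
  rw [integral_add (integrable_inner_mul_inner hX hX _ _) (integrable_inner_mul_inner hX hZ _ _),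
    integral_inner_mul_inner_of_indepFun hX hZ hXZ hX0, integral_inner_mul_inner hX hX0,
    add_zero, mulVecE_mul, inner_mulVecE_right A]

lemma covMat_obs [IsProbabilityMeasure P] (hX : MemLp X 2 P) (hZ : MemLp Z 2 P)
    (hXZ : IndepFun X Z P) (hX0 : ∫ ω, X ω ∂P = 0) (hZ0 : ∫ ω, Z ω ∂P = 0) :
    covMat (obs A X Z) P = A * covMat X P * Aᵀ + covMat Z P := by
  refine covMat_eq_of_inner (memLp_obs hX hZ) (integral_obs hX hZ hX0 hZ0) fun a b => ?_
  have e : ∀ ω, ⟪a, obs A X Z ω⟫_ℝ * ⟪b, obs A X Z ω⟫_ℝ =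
      ⟪a, obs A X Z ω⟫_ℝ * ⟪mulVecE Aᵀ b, X ω⟫_ℝ +
        (⟪mulVecE Aᵀ a, X ω⟫_ℝ * ⟪b, Z ω⟫_ℝ + ⟪a, Z ω⟫_ℝ * ⟪b, Z ω⟫_ℝ) := by
    intro ω
    simp only [obs, inner_add_right, inner_mulVecE_right]; ring
  simp_rw [e]
  have h1 := integrable_inner_mul_inner (memLp_obs (A := A) hX hZ) hX a (mulVecE Aᵀ b)
  have h2 := integrable_inner_mul_inner hX hZ (mulVecE Aᵀ a) b
  have h3 := integrable_inner_mul_inner hZ hZ a b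
  have h23 : Integrable (fun ω => ⟪mulVecE Aᵀ a, X ω⟫_ℝ * ⟪b, Z ω⟫_ℝ + ⟪a, Z ω⟫_ℝ * ⟪b, Z ω⟫_ℝ) P :=
    h2.add h3
  rw [integral_add h1 h23, integral_add h2 h3,
    integral_inner_obs_mul_inner hX hZ hXZ hX0, integral_inner_mul_inner_of_indepFun hX hZ hXZ hX0,
    integral_inner_mul_inner hZ hZ0, zero_add, ← mulVecE_mul, ← inner_add_right]
  simp [mulVecE]

lemma covMat_obs_posDef [IsProbabilityMeasure P] (hX : MemLp X 2 P) (hZ : MemLp Z 2 P)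
    (hXZ : IndepFun X Z P) (hX0 : ∫ ω, X ω ∂P = 0) (hZ0 : ∫ ω, Z ω ∂P = 0)
    (hZu : IsUnit (covMat Z P)) : (covMat (obs A X Z) P).PosDef := by
  rw [covMat_obs hX hZ hXZ hX0 hZ0]
  refine Matrix.PosDef.posSemidef_add ?_ (covMat_posDef hZ hZ0 hZu)
  have := (covMat_posSemidef hX hX0).mul_mul_conjTranspose_same A
  rwa [Matrix.conjTranspose_eq_transpose_of_trivial] at this

/-- The normal equations of the LMMSE estimator, a form of the Woodbury identity. -/
lemma mul_lmmseMatrix {CXX : Matrix (Fin N) (Fin N) ℝ} {CZZ : Matrix (Fin M) (Fin M) ℝ}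
    (hX : CXX.PosDef) (hZ : CZZ.PosDef) :
    (A * CXX * Aᵀ + CZZ) * lmmseMatrix A CXX CZZ = A * CXX := by
  have hXt : CXXᵀ = CXX :=
    (Matrix.conjTranspose_eq_transpose_of_trivial _).symm.trans hX.isHermitian.eq
  have hZt : CZZᵀ = CZZ :=
    (Matrix.conjTranspose_eq_transpose_of_trivial _).symm.trans hZ.isHermitian.eq
  have hXd : IsUnit CXX.det := (Matrix.isUnit_iff_isUnit_det _).1 hX.isUnit
  have hZd : IsUnit CZZ.det := (Matrix.isUnit_iff_isUnit_det _).1 hZ.isUnit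
  set B := Aᵀ * CZZ⁻¹ * A + CXX⁻¹ with hB
  have hBpd : B.PosDef := by
    refine Matrix.PosDef.posSemidef_add ?_ hX.inv
    have := hZ.inv.posSemidef.conjTranspose_mul_mul_same A
    rwa [Matrix.conjTranspose_eq_transpose_of_trivial] at this
  have hBd : IsUnit B.det := (Matrix.isUnit_iff_isUnit_det _).1 hBpd.isUnit
  have h1 : Aᵀ * CZZ⁻¹ * (A * CXX * Aᵀ + CZZ) = B * (CXX * Aᵀ) := by
    rw [hB, Matrix.mul_add, Matrix.add_mul, Matrix.mul_assoc (Aᵀ) (CZZ⁻¹) CZZ,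
      Matrix.nonsing_inv_mul _ hZd, Matrix.mul_one, ← Matrix.mul_assoc CXX⁻¹,
      Matrix.nonsing_inv_mul _ hXd, Matrix.one_mul]
    simp only [Matrix.mul_assoc]
  have h2 : B⁻¹ * Aᵀ * CZZ⁻¹ * (A * CXX * Aᵀ + CZZ) = CXX * Aᵀ := by
    rw [Matrix.mul_assoc B⁻¹, Matrix.mul_assoc B⁻¹, h1, ← Matrix.mul_assoc,
      Matrix.nonsing_inv_mul _ hBd, Matrix.one_mul]
  have h3 := congrArg Matrix.transpose h2
  rw [Matrix.transpose_mul, Matrix.transpose_mul CXX, Matrix.transpose_transpose, hXt] at h3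
  have h4 : (A * CXX * Aᵀ + CZZ)ᵀ = A * CXX * Aᵀ + CZZ := by
    rw [Matrix.transpose_add, Matrix.transpose_mul, Matrix.transpose_mul,
      Matrix.transpose_transpose, hXt, hZt, Matrix.mul_assoc]
  rwa [h4] at h3

lemma memLp_estError {Y : Ω → EuclideanSpace ℝ (Fin M)} (hX : MemLp X 2 P) (hY : MemLp Y 2 P)
    (Θ : Matrix (Fin M) (Fin N) ℝ) : MemLp (estError Θ X Y) 2 P :=
  hX.sub (MemLp.mulVecE hY Θᵀ)

/-- The orthogonality principle: the estimation error of the LMMSE estimator is uncorrelated with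
the data. -/
lemma integral_inner_obs_mul_inner_estError [IsProbabilityMeasure P]
    (hX : MemLp X 2 P) (hZ : MemLp Z 2 P)
    (hXZ : IndepFun X Z P) (hX0 : ∫ ω, X ω ∂P = 0) (hZ0 : ∫ ω, Z ω ∂P = 0)
    (hXu : IsUnit (covMat X P)) (hZu : IsUnit (covMat Z P)) (a : EuclideanSpace ℝ (Fin M))
    (b : EuclideanSpace ℝ (Fin N)) :
    ∫ ω, ⟪a, obs A X Z ω⟫_ℝ *
      ⟪b, estError (lmmseMatrix A (covMat X P) (covMat Z P)) X (obs A X Z) ω⟫_ℝ ∂P = 0 := by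
  set Θ := lmmseMatrix A (covMat X P) (covMat Z P) with hΘ
  have hY := memLp_obs (A := A) hX hZ
  have hY0 := integral_obs (A := A) hX hZ hX0 hZ0
  have e : ∀ ω, ⟪a, obs A X Z ω⟫_ℝ * ⟪b, estError Θ X (obs A X Z) ω⟫_ℝ =
      ⟪a, obs A X Z ω⟫_ℝ * ⟪b, X ω⟫_ℝ -
        ⟪a, obs A X Z ω⟫_ℝ * ⟪mulVecE Θ b, obs A X Z ω⟫_ℝ := by
    intro ω
    rw [estError, inner_sub_right, inner_mulVecE_right, Matrix.transpose_transpose]; ring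
  simp_rw [e]
  have h1 := integrable_inner_mul_inner hY hX a b
  have h2 := integrable_inner_mul_inner hY hY a (mulVecE Θ b)
  rw [integral_sub h1 h2, integral_inner_obs_mul_inner hX hZ hXZ hX0,
    integral_inner_mul_inner hY hY0, covMat_obs hX hZ hXZ hX0 hZ0, ← mulVecE_mul, hΘ,
    mul_lmmseMatrix (covMat_posDef hX hX0 hXu) (covMat_posDef hZ hZ0 hZu), sub_self]

/-- In whitened coordinates the approximation error is a squared Frobenius norm. -/
lemma approxError_whitened [IsProbabilityMeasure P] {Y : Ω → EuclideanSpace ℝ (Fin M)}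
    {R : Matrix (Fin M) (Fin M) ℝ}
    (hR : Rᵀ = R) (hY : MemLp Y 2 P) (hY0 : ∫ ω, Y ω ∂P = 0)
    (hcov : covMat (fun ω => mulVecE R (Y ω)) P = 1) (Θs Φ : Matrix (Fin M) (Fin N) ℝ) :
    approxError P Y (Θs + R * Φ) Θs = ∑ k, ∑ j, Φ k j ^ 2 := by
  have hw := MemLp.mulVecE hY R
  have hw0 := integral_mulVecE (hY.integrable one_le_two) hY0 R
  have e : ∀ ω, ‖mulVecE (Θs + R * Φ)ᵀ (Y ω) - mulVecE Θsᵀ (Y ω)‖ ^ 2 =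
      ∑ j, ⟪WithLp.toLp 2 fun k => Φ k j, mulVecE R (Y ω)⟫_ℝ *
        ⟪WithLp.toLp 2 fun k => Φ k j, mulVecE R (Y ω)⟫_ℝ := by
    intro ω
    have h1 : mulVecE (Θs + R * Φ)ᵀ (Y ω) - mulVecE Θsᵀ (Y ω) = mulVecE Φᵀ (mulVecE R (Y ω)) := by
      rw [Matrix.transpose_add, Matrix.transpose_mul, hR, ← mulVecE_mul]
      simp [mulVecE]
    rw [h1, EuclideanSpace.norm_sq_eq]
    refine Finset.sum_congr rfl fun j _ => ?_
    rw [Real.norm_eq_abs, sq_abs, sq]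
    have h2 : mulVecE Φᵀ (mulVecE R (Y ω)) j =
        ⟪WithLp.toLp 2 fun k => Φ k j, mulVecE R (Y ω)⟫_ℝ := by
      generalize mulVecE R (Y ω) = w
      simp [mulVecE, Matrix.toLpLin_apply, Matrix.mulVec, dotProduct, PiLp.inner_apply, mul_comm]
    rw [h2]
  rw [approxError]
  simp_rw [e]
  rw [integral_finsetSum _ fun j _ => integrable_inner_mul_inner hw hw _ _,
    Finset.sum_comm]
  refine Finset.sum_congr rfl fun j _ => ?_
  rw [integral_inner_mul_inner hw hw0, hcov, mulVecE_one, real_inner_self_eq_norm_sq,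
    EuclideanSpace.norm_sq_eq]
  simp

end Model

/-! ### The contribution of the noise -/

section Spectral

variable {N : ℕ} {C : Matrix (Fin N) (Fin N) ℝ}

/-- An orthogonal diagonalization, with the spectral data that enter the error term. -/
lemma exists_diagonalization (hC : C.PosDef) :
    ∃ (U : Matrix (Fin N) (Fin N) ℝ) (l : Fin N → ℝ), Uᵀ * U = 1 ∧ U * Uᵀ = 1 ∧
      C = U * Matrix.diagonal l * Uᵀ ∧ (∀ j, 0 < l j) ∧ (∀ j, l j ≤ spectralNorm C) := by
  set H := hC.isHermitian
  refine ⟨H.eigenvectorUnitary, H.eigenvalues, ?_, ?_, ?_, hC.eigenvalues_pos, fun j => ?_⟩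
  · have := Unitary.coe_star_mul_self H.eigenvectorUnitary
    rwa [Matrix.star_eq_conjTranspose, Matrix.conjTranspose_eq_transpose_of_trivial] at this
  · have := Unitary.coe_star_mul_self H.eigenvectorUnitary
    rw [mul_eq_one_comm] at this
    rwa [Matrix.star_eq_conjTranspose, Matrix.conjTranspose_eq_transpose_of_trivial] at this
  · have := H.spectral_theorem
    rw [Unitary.conjStarAlgAut_apply, Matrix.star_eq_conjTranspose,
      Matrix.conjTranspose_eq_transpose_of_trivial] at this
    exact this
  · have h1 := (Matrix.toEuclideanCLM (𝕜 := ℝ) C).le_opNorm (H.eigenvectorBasis j)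
    have h2 : Matrix.toEuclideanCLM (𝕜 := ℝ) C (H.eigenvectorBasis j) =
        H.eigenvalues j • H.eigenvectorBasis j := by
      have := H.mulVec_eigenvectorBasis j
      ext i
      exact congrFun this i
    rw [h2, norm_smul, (H.eigenvectorBasis).norm_eq_one, mul_one, mul_one] at h1
    exact (le_abs_self _).trans h1

lemma trace_conj_diagonal {U : Matrix (Fin N) (Fin N) ℝ} {l : Fin N → ℝ} (hU : Uᵀ * U = 1) :
    (U * Matrix.diagonal l * Uᵀ).trace = ∑ j, l j := by
  rw [Matrix.mul_assoc, Matrix.trace_mul_comm, Matrix.mul_assoc, hU, Matrix.mul_one,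
    Matrix.trace_diagonal]

lemma trace_sq_conj_diagonal {U : Matrix (Fin N) (Fin N) ℝ} {l : Fin N → ℝ} (hU : Uᵀ * U = 1) :
    ((U * Matrix.diagonal l * Uᵀ) ^ 2).trace = ∑ j, l j ^ 2 := by
  have : (U * Matrix.diagonal l * Uᵀ) ^ 2 = U * Matrix.diagonal (fun j => l j ^ 2) * Uᵀ := by
    calc _ = U * Matrix.diagonal l * (Uᵀ * U) * Matrix.diagonal l * Uᵀ := by
          rw [sq]; simp only [Matrix.mul_assoc]
      _ = _ := by
          rw [hU, Matrix.mul_one, Matrix.mul_assoc U, Matrix.diagonal_mul_diagonal]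
          simp only [sq]
  rw [this, trace_conj_diagonal hU]

lemma sum_sq_mul_orthogonal {M : ℕ} {U : Matrix (Fin N) (Fin N) ℝ} (hU : U * Uᵀ = 1)
    (B : Matrix (Fin M) (Fin N) ℝ) : ∑ k, ∑ j, (B * U) k j ^ 2 = ∑ k, ∑ j, B k j ^ 2 := by
  simp only [sq]
  rw [← trace_transpose_mul_eq_sum, ← trace_transpose_mul_eq_sum, Matrix.transpose_mul,
    Matrix.mul_assoc, Matrix.trace_mul_comm, Matrix.mul_assoc, Matrix.mul_assoc, hU, Matrix.mul_one]

end Spectral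

section Noise

variable {n M N : ℕ} {C : Matrix (Fin N) (Fin N) ℝ}
  {ν : Fin n → Measure (EuclideanSpace ℝ (Fin N))} [∀ i, IsProbabilityMeasure (ν i)]

/-- Exponential moments of independent vectors with companion matrix `C`, collected as the rows of a
matrix and tested against the matrix `β`. -/
lemma lintegral_exp_trace_le (hC : C.PosDef) (hν : ∀ i, HasCompanionMatrix (ν i) C)
    (β : Matrix (Fin n) (Fin N) ℝ) :
    ∫⁻ e, ENNReal.ofReal (Real.exp (βᵀ * rowMatrix e).trace) ∂(Measure.pi ν) ≤
      ENNReal.ofReal (Real.exp ((βᵀ * rowMatrix fun i => ∫ e, e ∂(ν i)).trace +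
        (βᵀ * (β * C)).trace / 2)) := by
  have hCt : Cᵀ = C :=
    (Matrix.conjTranspose_eq_transpose_of_trivial _).symm.trans hC.isHermitian.eq
  have e1 : ∀ e : Fin n → EuclideanSpace ℝ (Fin N), (βᵀ * rowMatrix e).trace =
      ∑ i, ⟪(WithLp.toLp 2 (β i) : EuclideanSpace ℝ (Fin N)), e i⟫_ℝ := by
    intro e
    rw [trace_transpose_mul_eq_sum]
    refine Finset.sum_congr rfl fun i _ => ?_
    simp [rowMatrix, PiLp.inner_apply, mul_comm]
  have e2 : (βᵀ * (β * C)).trace = ∑ i, ⟪(WithLp.toLp 2 (β i) : EuclideanSpace ℝ (Fin N)),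
      mulVecE C (WithLp.toLp 2 (β i))⟫_ℝ := by
    rw [trace_transpose_mul_eq_sum]
    refine Finset.sum_congr rfl fun i _ => ?_
    rw [PiLp.inner_apply]
    refine Finset.sum_congr rfl fun j _ => ?_
    have : (β * C) i j = (mulVecE C (WithLp.toLp 2 (β i))) j := by
      conv_lhs => rw [← hCt]
      simp only [Matrix.mul_apply, Matrix.transpose_apply, mulVecE, Matrix.toLpLin_apply,
        Matrix.mulVec, dotProduct]
      exact Finset.sum_congr rfl fun l _ => mul_comm _ _
    rw [this]
    simp [mul_comm]
  simp_rw [e1]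
  rw [lintegral_exp_sum_pi ν
    (f := fun i e => ⟪(WithLp.toLp 2 (β i) : EuclideanSpace ℝ (Fin N)), e⟫_ℝ)
    (fun i => by fun_prop)]
  refine (Finset.prod_le_prod' fun i _ => (hν i).lintegral_exp_le hC (WithLp.toLp 2 (β i))).trans ?_
  rw [← ENNReal.ofReal_prod_of_nonneg fun i _ => (Real.exp_pos _).le, ← Real.exp_sum,
    Finset.sum_add_distrib, e2, Finset.sum_div]

/-- The tail of `‖D E‖²` for a matrix `E` with independent rows that have companion matrix `C`, and
a matrix `D` whose transpose has norm at most `σ⁻¹`. -/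
lemma measure_noise_gt_le (hM : 0 < M) (hN : 0 < N) (hC : C.PosDef)
    (hν : ∀ i, HasCompanionMatrix (ν i) C) {D : Matrix (Fin M) (Fin n) ℝ} {σ : ℝ} (hσ : 0 < σ)
    (hD : ∀ u : Fin M → ℝ, σ ^ 2 * ((Dᵀ *ᵥ u) ⬝ᵥ (Dᵀ *ᵥ u)) ≤ u ⬝ᵥ u) {t : ℝ} (ht : 0 ≤ t) :
    Measure.pi ν {e |
      (C.trace * M + 2 * √(M * (C ^ 2).trace * t) + 2 * spectralNorm C * t) / σ ^ 2 +
      (∑ k, ∑ j, (D * rowMatrix fun i => ∫ e, e ∂(ν i)) k j ^ 2) *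
        (1 + 2 * √t * spectralNorm C / √(M * (C ^ 2).trace)) <
      ∑ k, ∑ j, (D * rowMatrix e) k j ^ 2} ≤ ENNReal.ofReal (Real.exp (-t)) := by
  obtain ⟨U, l, hU1, hU2, hCU, hl, hlS⟩ := exists_diagonalization hC
  have htr : C.trace = ∑ j, l j := by rw [hCU, trace_conj_diagonal hU1]
  have htr2 : (C ^ 2).trace = ∑ j, l j ^ 2 := by rw [hCU, trace_sq_conj_diagonal hU1]
  set m : Fin n → EuclideanSpace ℝ (Fin N) := fun i => ∫ e, e ∂(ν i) with hm
  have hS0 : 0 < spectralNorm C := (hl ⟨0, hN⟩).trans_le (hlS _)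
  have hM' : (0 : ℝ) < M := by exact_mod_cast hM
  have htr2pos : 0 < (C ^ 2).trace := by
    rw [htr2]
    have : Nonempty (Fin N) := ⟨⟨0, hN⟩⟩
    exact Finset.sum_pos (fun j _ => pow_pos (hl j) 2) Finset.univ_nonempty
  have key := measure_sum_sq_gt_le (Measure.pi ν) (ι := Fin M × Fin N)
    (L := fun e p => (D * rowMatrix e * U) p.1 p.2) (lam := fun p => l p.2 / σ ^ 2)
    (h := fun p => (D * rowMatrix m * U) p.1 p.2)
    (T₁ := C.trace * M / σ ^ 2) (T₂ := M * (C ^ 2).trace / (σ ^ 2) ^ 2)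
    (S := spectralNorm C / σ ^ 2) (t := t) ?_ ?_ ?_ ?_ ?_ ?_ ?_ ?_ ht
  · refine le_trans (le_of_eq ?_) key
    congr 1
    ext e
    simp only [Set.mem_ofPred_eq, Fintype.sum_prod_type, sum_sq_mul_orthogonal hU2]
    have e1 : √(M * (C ^ 2).trace / (σ ^ 2) ^ 2 * t) = √(M * (C ^ 2).trace * t) / σ ^ 2 := by
      rw [div_mul_eq_mul_div, Real.sqrt_div' _ (by positivity), Real.sqrt_sq (by positivity)]
    have e2 : √(M * (C ^ 2).trace / (σ ^ 2) ^ 2) = √(M * (C ^ 2).trace) / σ ^ 2 := by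
      rw [Real.sqrt_div' _ (by positivity), Real.sqrt_sq (by positivity)]
    rw [e1, e2]
    have e3 : spectralNorm C / σ ^ 2 * √t / (√(M * (C ^ 2).trace) / σ ^ 2) =
        √t * spectralNorm C / √(M * (C ^ 2).trace) := by
      have : √(M * (C ^ 2).trace) ≠ 0 := (Real.sqrt_pos.2 (by positivity)).ne'
      field_simp
    rw [e3]
    have e4 : (C.trace * M + 2 * √(M * (C ^ 2).trace * t) + 2 * spectralNorm C * t) / σ ^ 2 =
        C.trace * M / σ ^ 2 + 2 * (√(M * (C ^ 2).trace * t) / σ ^ 2) +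
          2 * (spectralNorm C / σ ^ 2) * t := by ring
    have e5 : 2 * √t * spectralNorm C / √(M * (C ^ 2).trace) =
        2 * (√t * spectralNorm C / √(M * (C ^ 2).trace)) := by ring
    rw [e4, e5]
  · intro p
    simp only [Matrix.mul_apply, rowMatrix, Matrix.of_apply]
    fun_prop
  · exact fun p => (div_pos (hl _) (by positivity)).le
  · intro g
    set G : Matrix (Fin M) (Fin N) ℝ := Matrix.of fun k j => g (k, j) with hG
    set β : Matrix (Fin n) (Fin N) ℝ := Dᵀ * G * Uᵀ with hβ
    have e1 : ∀ E : Matrix (Fin n) (Fin N) ℝ,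
        ∑ p : Fin M × Fin N, g p * (D * E * U) p.1 p.2 = (βᵀ * E).trace := by
      intro E
      rw [Fintype.sum_prod_type]
      have := trace_transpose_mul_eq_sum G (D * E * U)
      simp only [hG, Matrix.of_apply] at this
      rw [← this]
      calc (Gᵀ * (D * E * U)).trace = ((Gᵀ * D * E) * U).trace := by simp only [Matrix.mul_assoc]
        _ = (U * (Gᵀ * D * E)).trace := Matrix.trace_mul_comm _ _
        _ = _ := by
          rw [hβ, Matrix.transpose_mul, Matrix.transpose_mul, Matrix.transpose_transpose,
            Matrix.transpose_transpose]
          simp only [Matrix.mul_assoc]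
    simp_rw [e1]
    refine (lintegral_exp_trace_le hC hν β).trans ?_
    apply ENNReal.ofReal_le_ofReal
    apply Real.exp_le_exp.2
    rw [Finset.sum_add_distrib, e1]
    gcongr
    have e2 : (βᵀ * (β * C)).trace = ∑ i, ∑ j, (Dᵀ * G) i j ^ 2 * l j := by
      have : βᵀ * (β * C) = U * (((Dᵀ * G)ᵀ * (Dᵀ * G * Matrix.diagonal l)) * Uᵀ) := by
        have h1 : β * C = Dᵀ * G * Matrix.diagonal l * Uᵀ := by
          calc β * C = Dᵀ * G * (Uᵀ * U) * Matrix.diagonal l * Uᵀ := by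
                rw [hβ, hCU]; simp only [Matrix.mul_assoc]
            _ = _ := by rw [hU1, Matrix.mul_one]
        rw [h1, hβ, Matrix.transpose_mul (Dᵀ * G), Matrix.transpose_transpose]
        simp only [Matrix.mul_assoc]
      rw [this, Matrix.trace_mul_comm, Matrix.mul_assoc, hU1, Matrix.mul_one,
        trace_transpose_mul_eq_sum]
      simp only [Matrix.mul_diagonal]
      refine Finset.sum_congr rfl fun i _ => Finset.sum_congr rfl fun j _ => by ring
    rw [e2, Finset.sum_comm, Fintype.sum_prod_type, Finset.sum_comm (f := fun k j => _ / 2),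
      Finset.sum_div]
    refine Finset.sum_le_sum fun j _ => ?_
    have h1 := hD fun k => g (k, j)
    have h2 : ∑ i, (Dᵀ * G) i j ^ 2 = (Dᵀ *ᵥ fun k => g (k, j)) ⬝ᵥ (Dᵀ *ᵥ fun k => g (k, j)) := by
      simp [dotProduct, Matrix.mulVec, Matrix.mul_apply, sq, hG]
    rw [← h2] at h1
    have h3 : ∑ i, (Dᵀ * G) i j ^ 2 ≤ (∑ k, g (k, j) ^ 2) / σ ^ 2 := by
      rw [le_div_iff₀ (by positivity), mul_comm]
      simpa [dotProduct, sq] using h1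
    calc (∑ i, (Dᵀ * G) i j ^ 2 * l j) / 2 = (∑ i, (Dᵀ * G) i j ^ 2) * l j / 2 := by
          rw [Finset.sum_mul]
      _ ≤ (∑ k, g (k, j) ^ 2) / σ ^ 2 * l j / 2 := by
          have := (hl j).le
          gcongr
      _ = _ := by
          rw [Finset.sum_div, Finset.sum_mul, Finset.sum_div]
          exact Finset.sum_congr rfl fun k _ => by ring
  · rw [Fintype.sum_prod_type]
    simp only [← Finset.sum_div, ← htr, Finset.sum_const, Finset.card_univ, Fintype.card_fin,
      nsmul_eq_mul]
    exact le_of_eq (by ring)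
  · rw [Fintype.sum_prod_type]
    simp only [div_pow, ← Finset.sum_div, ← htr2, Finset.sum_const, Finset.card_univ,
      Fintype.card_fin, nsmul_eq_mul]
    exact le_of_eq (by ring)
  · positivity
  · exact fun p => div_le_div_of_nonneg_right (hlS _) (by positivity)
  · positivity

end Noise

/-! ### The contribution of the conditional bias -/

section Bias

variable {α : Type*} [MeasurableSpace α] {P : Measure α} [IsProbabilityMeasure P] {n M : ℕ}
  {w : α → EuclideanSpace ℝ (Fin M)} {v : ℝ}

lemma lintegral_exp_inner_le_of_unit (hmgf : ∀ a : EuclideanSpace ℝ (Fin M), ‖a‖ = 1 → ∀ s : ℝ,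
      ∫⁻ y, ENNReal.ofReal (Real.exp (s * ⟪a, w y⟫_ℝ)) ∂P ≤
        ENNReal.ofReal (Real.exp (v * s ^ 2 / 2))) (a : EuclideanSpace ℝ (Fin M)) (s : ℝ) :
    ∫⁻ y, ENNReal.ofReal (Real.exp (s * ⟪a, w y⟫_ℝ)) ∂P ≤
      ENNReal.ofReal (Real.exp (v * ‖a‖ ^ 2 * s ^ 2 / 2)) := by
  by_cases ha : a = 0
  · simp [ha]
  have ha' : ‖a‖ ≠ 0 := norm_ne_zero_iff.2 ha
  have h := hmgf (‖a‖⁻¹ • a) (by simp [norm_smul, ha']) (‖a‖ * s)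
  have e : ∀ y, ‖a‖ * s * ⟪‖a‖⁻¹ • a, w y⟫_ℝ = s * ⟪a, w y⟫_ℝ := by
    intro y
    rw [inner_smul_left]
    simp only [conj_trivial]
    field_simp
  simp_rw [e] at h
  refine h.trans (le_of_eq ?_)
  ring_nf

/-- The tail of `‖∑ i, m (y i) w (y i)‖²`, where `w` is sub-Gaussian, `m` is bounded and `m w` is
centred. -/
lemma measure_bias_gt_le (hn : 0 < n) (hM : 0 < M) (hw : Measurable w) (hv : 0 < v)
    (hmgf : ∀ a : EuclideanSpace ℝ (Fin M), ‖a‖ = 1 → ∀ s : ℝ,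
      ∫⁻ y, ENNReal.ofReal (Real.exp (s * ⟪a, w y⟫_ℝ)) ∂P ≤
        ENNReal.ofReal (Real.exp (v * s ^ 2 / 2)))
    {m : α → ℝ} (hm : Measurable m) {b : ℝ} (hb : ∀ᵐ y ∂P, |m y| ≤ b)
    (hint : ∀ a, Integrable (fun y => ⟪a, w y⟫_ℝ * m y) P)
    (hmean : ∀ a, ∫ y, ⟪a, w y⟫_ℝ * m y ∂P = 0) {s : ℝ} (hs : 0 ≤ s) :
    (Measure.pi fun _ : Fin n => P) {y | 3 / 2 * v * b ^ 2 * n * (M + 2 * √(M * s) + 2 * s) <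
      ∑ k, (∑ i, w (y i) k * m (y i)) ^ 2} ≤ ENNReal.ofReal (Real.exp (-s)) := by
  have hM' : (0 : ℝ) < M := by exact_mod_cast hM
  have hn' : (0 : ℝ) < n := by exact_mod_cast hn
  have hb0 : 0 ≤ b := by
    obtain ⟨y, hy⟩ := hb.exists
    exact (abs_nonneg _).trans hy
  rcases hb0.eq_or_lt with rfl | hb0
  · -- here `m` vanishes almost surely
    have hae : ∀ᵐ y ∂(Measure.pi fun _ : Fin n => P), ∀ i, m (y i) = 0 := by
      rw [ae_all_iff]
      intro i
      have := (Measure.tendsto_eval_ae_ae (μ := fun _ : Fin n => P) (i := i)).eventually hb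
      filter_upwards [this] with y hy
      exact abs_nonpos_iff.1 hy
    refine le_trans (le_of_eq ?_) zero_le
    have hnot : ∀ᵐ y ∂(Measure.pi fun _ : Fin n => P),
        ¬ (3 / 2 * v * (0 : ℝ) ^ 2 * n * (M + 2 * √(M * s) + 2 * s) <
          ∑ k, (∑ i, w (y i) k * m (y i)) ^ 2) := by
      filter_upwards [hae] with y hy
      simp [hy]
    simpa [ae_iff] using hnot
  set K := 3 / 2 * v * b ^ 2 * n with hK
  have hK0 : 0 < K := by positivity
  have key := measure_sum_sq_gt_le (Measure.pi fun _ : Fin n => P) (ι := Fin M)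
    (L := fun y k => ∑ i, w (y i) k * m (y i)) (lam := fun _ => K) (h := fun _ => 0)
    (T₁ := K * M) (T₂ := K ^ 2 * M) (S := K) (t := s) ?_ (fun _ => hK0.le) ?_ ?_ ?_ ?_
    (fun _ => le_rfl) hK0 hs
  · refine le_trans (le_of_eq ?_) key
    congr 1
    ext y
    simp only [Set.mem_ofPred_eq]
    have e1 : √(K ^ 2 * M * s) = K * √(M * s) := by
      rw [mul_assoc, Real.sqrt_mul (by positivity), Real.sqrt_sq hK0.le]
    rw [e1]
    have e2 : K * (M + 2 * √(M * s) + 2 * s) = K * M + 2 * (K * √(M * s)) + 2 * K * s +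
        (∑ k : Fin M, (0 : ℝ) ^ 2) * (1 + 2 * (K * √s / √(K ^ 2 * M))) := by
      simp; ring
    rw [e2]
  · intro k
    fun_prop
  · intro g
    have e1 : ∀ y : Fin n → α, ∑ k, g k * ∑ i, w (y i) k * m (y i) =
        ∑ i, ⟪(WithLp.toLp 2 g : EuclideanSpace ℝ (Fin M)), w (y i)⟫_ℝ * m (y i) := by
      intro y
      simp only [PiLp.inner_apply, RCLike.inner_apply, conj_trivial, Finset.mul_sum, Finset.sum_mul]
      rw [Finset.sum_comm]
      exact Finset.sum_congr rfl fun i _ => Finset.sum_congr rfl fun k _ => by ring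
    simp_rw [e1]
    rw [lintegral_exp_sum_pi (fun _ : Fin n => P)
      (f := fun _ y => ⟪(WithLp.toLp 2 g : EuclideanSpace ℝ (Fin M)), w y⟫_ℝ * m y)
      (fun i => by fun_prop)]
    have h1 := lintegral_exp_mul_bounded_le (U := fun y =>
      ⟪(WithLp.toLp 2 g : EuclideanSpace ℝ (Fin M)), w y⟫_ℝ) (by fun_prop) hm hb
      (lintegral_exp_inner_le_of_unit hmgf (WithLp.toLp 2 g)) (hint _) (hmean _)
    refine (Finset.prod_le_prod' fun i _ => h1).trans (le_of_eq ?_)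
    rw [Finset.prod_const, Finset.card_univ, Fintype.card_fin,
      ← ENNReal.ofReal_pow (Real.exp_pos _).le, ← Real.exp_nat_mul]
    congr 2
    rw [EuclideanSpace.norm_sq_eq]
    simp only [mul_zero, zero_add, Real.norm_eq_abs, sq_abs, ← Finset.sum_div, ← Finset.mul_sum, hK]
    ring
  · simp [mul_comm]
  · simp [mul_comm]
  · positivity

end Bias

/-! ### Measurability -/

section Measurability

variable {β : Type*} [MeasurableSpace β]

lemma measurable_det {k : ℕ} {A : β → Matrix (Fin k) (Fin k) ℝ}
    (hA : ∀ i j, Measurable fun y => A y i j) : Measurable fun y => (A y).det := by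
  simp only [Matrix.det_apply']
  fun_prop

lemma measurable_nonsing_inv_apply {k : ℕ} {A : β → Matrix (Fin k) (Fin k) ℝ}
    (hA : ∀ i j, Measurable fun y => A y i j) (i j : Fin k) : Measurable fun y => (A y)⁻¹ i j := by
  simp only [Matrix.inv_def, Matrix.smul_apply, Matrix.adjugate_apply, Ring.inverse_eq_inv',
    smul_eq_mul]
  refine (measurable_det hA).inv.mul (measurable_det fun a b => ?_)
  simp only [Matrix.updateRow_apply]
  split_ifs
  · exact measurable_const
  · exact hA a b

lemma measurable_pinv_apply {n M : ℕ} {W : β → Matrix (Fin n) (Fin M) ℝ}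
    (hW : ∀ i j, Measurable fun y => W y i j) (k : Fin M) (i : Fin n) :
    Measurable fun y => pinv (W y) k i := by
  simp only [pinv, Matrix.mul_apply, Matrix.transpose_apply]
  refine Finset.measurable_sum _ fun j _ => Measurable.mul ?_ (hW i j)
  refine measurable_nonsing_inv_apply (fun a b => ?_) k j
  simp only [Matrix.mul_apply, Matrix.transpose_apply]
  fun_prop

lemma measurable_sum_sq_pinv_mul {n M N : ℕ} {W : β → Matrix (Fin n) (Fin M) ℝ}
    (hW : ∀ i j, Measurable fun y => W y i j) {E : β → Matrix (Fin n) (Fin N) ℝ}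
    (hE : ∀ i j, Measurable fun y => E y i j) :
    Measurable fun y => ∑ k, ∑ j, (pinv (W y) * E y) k j ^ 2 := by
  have := measurable_pinv_apply hW
  simp only [Matrix.mul_apply]
  fun_prop

lemma measurableSet_le_sigmaMin {n M : ℕ} (hM : 0 < M) (σ : ℝ) :
    MeasurableSet {v : Fin n → EuclideanSpace ℝ (Fin M) | σ ≤ sigmaMin (rowMatrix v)} := by
  apply IsClosed.measurableSet
  have : {v : Fin n → EuclideanSpace ℝ (Fin M) | σ ≤ sigmaMin (rowMatrix v)} =
      ⋂ x : EuclideanSpace ℝ (Fin M), {v | σ * ‖x‖ ≤ √(∑ i, ⟪x, v i⟫_ℝ ^ 2)} := by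
    ext v
    simp only [Set.mem_ofPred_eq, le_sigmaMin_iff hM, Set.mem_iInter]
    refine forall_congr' fun x => ?_
    rw [← sq_norm_mulVecE_rowMatrix, Real.sqrt_sq (norm_nonneg _)]
  rw [this]
  exact isClosed_iInter fun x => isClosed_le continuous_const (by fun_prop)

end Measurability

/-! ### Dependence on the law only -/

section IdentDistrib

variable {Ω Ω' : Type*} [MeasurableSpace Ω] [MeasurableSpace Ω'] {P : Measure Ω} {P' : Measure Ω'}
  {k : ℕ} {V : Ω → EuclideanSpace ℝ (Fin k)} {V' : Ω' → EuclideanSpace ℝ (Fin k)}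

lemma covMat_congr_identDistrib (h : IdentDistrib V V' P P') : covMat V P = covMat V' P' := by
  have hm : ∀ i, ∫ ω, V ω i ∂P = ∫ ω, V' ω i ∂P' := fun i =>
    (h.comp (u := fun x : EuclideanSpace ℝ (Fin k) => x i) (by fun_prop)).integral_eq
  ext i j
  simp only [covMat, covariance, Matrix.of_apply, hm]
  exact (h.comp (u := fun x : EuclideanSpace ℝ (Fin k) =>
    (x i - ∫ ω, V' ω i ∂P') * (x j - ∫ ω, V' ω j ∂P')) (by fun_prop)).integral_eq

lemma IsSubGaussianVector.congr_identDistrib {ρ : ℝ≥0} (hV : IsSubGaussianVector V ρ P)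
    (h : IdentDistrib V V' P P') : IsSubGaussianVector V' ρ P' := by
  intro a ha
  have h1 := hV a ha
  unfold IsSubGaussian at h1 ⊢
  have hm : ∫ ω, ⟪a, V ω⟫_ℝ ∂P = ∫ ω, ⟪a, V' ω⟫_ℝ ∂P' :=
    (h.comp (u := fun x : EuclideanSpace ℝ (Fin k) => ⟪a, x⟫_ℝ) (by fun_prop)).integral_eq
  rw [hm] at h1
  exact h1.congr_identDistrib (h.comp (u := fun x : EuclideanSpace ℝ (Fin k) =>
    ⟪a, x⟫_ℝ - ∫ ω, ⟪a, V' ω⟫_ℝ ∂P') (by fun_prop))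

end IdentDistrib

lemma measure_lt_le_of_le_measureReal {α : Type*} [MeasurableSpace α] {μ : Measure α}
    [IsProbabilityMeasure μ] {f : α → ℝ} {σ p : ℝ} (hm : MeasurableSet {y | σ ≤ f y})
    (h : 1 - p ≤ μ.real {y | σ ≤ f y}) : μ {y | f y < σ} ≤ ENNReal.ofReal p := by
  have hcompl : {y | f y < σ} = {y | σ ≤ f y}ᶜ := by
    ext y
    simp
  have h3 := probReal_compl_eq_one_sub (μ := μ) hm
  rw [hcompl, ← ofReal_measureReal]
  apply ENNReal.ofReal_le_ofReal
  rw [h3]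
  linarith

/-- The singular value bound for independent copies of a whitened vector, on their product space. -/
lemma IsSingularValueConstant.measure_sigmaMin_lt_le {c : ℝ} (hc : IsSingularValueConstant c)
    {Ω : Type*} [MeasurableSpace Ω] {P : Measure Ω} [IsProbabilityMeasure P] {n M : ℕ} (hM : 0 < M)
    {Y : Ω → EuclideanSpace ℝ (Fin M)} (hY : AEMeasurable Y P)
    {w : EuclideanSpace ℝ (Fin M) → EuclideanSpace ℝ (Fin M)} (hw : Measurable w) {ρ : ℝ≥0}
    (h2 : MemLp (fun ω => w (Y ω)) 2 P) (h0 : ∫ ω, w (Y ω) ∂P = 0)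
    (hcov : covMat (fun ω => w (Y ω)) P = 1) (hsub : IsSubGaussianVector (fun ω => w (Y ω)) ρ P)
    {t : ℝ} (ht : 0 ≤ t) :
    (Measure.pi fun _ : Fin n => P.map Y) {y | sigmaMin (rowMatrix fun i => w (y i)) <
      √n - c * ρ ^ 2 * (√M + √t)} ≤ ENNReal.ofReal (2 * Real.exp (-t)) := by
  have : IsProbabilityMeasure (P.map Y) := Measure.isProbabilityMeasure_map hY
  set Q := Measure.pi fun _ : Fin n => P.map Y with hQ
  have hid : ∀ i : Fin n, IdentDistrib (fun ω => w (Y ω))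
      (fun y : Fin n → EuclideanSpace ℝ (Fin M) => w (y i)) P Q := by
    intro i
    refine ⟨hw.comp_aemeasurable hY, (hw.comp (measurable_pi_apply i)).aemeasurable, ?_⟩
    have e1 : Q.map (fun y => w (y i)) = (Q.map (fun y => y i)).map w :=
      (Measure.map_map hw (measurable_pi_apply i)).symm
    have e2 : P.map (fun ω => w (Y ω)) = (P.map Y).map w :=
      (AEMeasurable.map_map_of_aemeasurable hw.aemeasurable hY).symm
    rw [e1, e2, (measurePreserving_eval (fun _ : Fin n => P.map Y) i).map_eq]
  have hind : iIndepFun (fun i (y : Fin n → EuclideanSpace ℝ (Fin M)) => w (y i)) Q :=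
    iIndepFun_pi (μ := fun _ : Fin n => P.map Y) (X := fun _ => w) fun i => hw.aemeasurable
  have h := hc n M hM ρ _ Q (fun i y => w (y i)) (fun i => (hid i).memLp_iff.1 h2) hind
    (fun i => (hid i).integral_eq.symm.trans h0)
    (fun i => (covMat_congr_identDistrib (hid i)).symm.trans hcov)
    (fun i => hsub.congr_identDistrib (hid i)) t ht
  have hwm : Measurable fun (y : Fin n → EuclideanSpace ℝ (Fin M)) i => w (y i) :=
    measurable_pi_lambda _ fun i => hw.comp (measurable_pi_apply i)
  exact measure_lt_le_of_le_measureReal (hwm (measurableSet_le_sigmaMin hM _))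
    (h.trans (measureReal_mono fun y hy => hy.1))

/-! ### The two terms of the bound -/

lemma epsErr_nonneg (n M : ℕ) {N : ℕ} (c ρ : ℝ) {t : ℝ} (ht : 0 ≤ t) {C : Matrix (Fin N) (Fin N) ℝ}
    (hC : C.PosDef) : 0 ≤ epsErr n M c ρ t C := by
  have h1 : 0 ≤ C.trace := hC.posSemidef.trace_nonneg
  have h2 : 0 ≤ spectralNorm C := norm_nonneg _
  rw [epsErr]
  positivity

lemma epsBias_nonneg (n M : ℕ) {N : ℕ} (c ρ : ℝ) (t : ℝ) {s : ℝ} (hs : 0 ≤ s)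
    (C : Matrix (Fin N) (Fin N) ℝ) (μ : EuclideanSpace ℝ (Fin N)) :
    0 ≤ epsBias n M c ρ t s C μ := by
  have h2 : 0 ≤ spectralNorm C := norm_nonneg _
  have h3 : 0 ≤ (√n - c * ρ ^ 2 * (√M + √t)) ^ 4 := Even.pow_nonneg (by decide) _
  rw [epsBias]
  positivity

/-- The deterministic part of the bias bound: `D m = (Wᵀ W)⁻¹ (Wᵀ m)` is controlled by the columns
of `Wᵀ m` and the smallest singular value of `W`. -/
lemma sum_sq_pinv_mul_le {n M N : ℕ} {W : Matrix (Fin n) (Fin M) ℝ} {σ : ℝ} (hσ : 0 < σ)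
    (hW : ∀ x : Fin M → ℝ, σ ^ 2 * (x ⬝ᵥ x) ≤ (W *ᵥ x) ⬝ᵥ (W *ᵥ x))
    (m : Matrix (Fin n) (Fin N) ℝ) {K : Fin N → ℝ}
    (hK : ∀ j, ∑ k, (∑ i, W i k * m i j) ^ 2 ≤ K j) :
    ∑ k, ∑ j, (pinv W * m) k j ^ 2 ≤ (∑ j, K j) / σ ^ 4 := by
  rw [le_div_iff₀ (by positivity), mul_comm]
  have h := sum_sq_mul_inv_gram_le hσ hW (Wᵀ * m)
  rw [← Matrix.mul_assoc] at h
  refine h.trans ?_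
  rw [Finset.sum_comm]
  refine Finset.sum_le_sum fun j _ => ?_
  simpa [Matrix.mul_apply] using hK j

/-! ### Failure probabilities under the joint law -/

section Tail

variable {n N M : ℕ} {PY : Measure (EuclideanSpace ℝ (Fin M))} [IsProbabilityMeasure PY]
  {κ : Kernel (EuclideanSpace ℝ (Fin M)) (EuclideanSpace ℝ (Fin N))} [IsMarkovKernel κ]

/-- The noise bound, integrated over the data `y` that make the design matrix well conditioned. -/
lemma measure_compProd_noise_le (hM : 0 < M) (hN : 0 < N) {C : Matrix (Fin N) (Fin N) ℝ}
    (hC : C.PosDef) (hκ : ∀ᵐ y ∂PY, HasCompanionMatrix (κ y) C)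
    {w : EuclideanSpace ℝ (Fin M) → EuclideanSpace ℝ (Fin M)} {σ t : ℝ} (hσ : 0 < σ) (ht : 0 ≤ t)
    {B : Set ((Fin n → EuclideanSpace ℝ (Fin M)) × (Fin n → EuclideanSpace ℝ (Fin N)))}
    (hBm : MeasurableSet B)
    (hB : ∀ p ∈ B, σ ≤ sigmaMin (rowMatrix fun i => w (p.1 i)) ∧
      (C.trace * M + 2 * √(M * (C ^ 2).trace * t) + 2 * spectralNorm C * t) / σ ^ 2 +
      (∑ k, ∑ j, (pinv (rowMatrix fun i => w (p.1 i)) *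
        rowMatrix fun i => ∫ e, e ∂(κ (p.1 i))) k j ^ 2) *
        (1 + 2 * √t * spectralNorm C / √(M * (C ^ 2).trace)) <
      ∑ k, ∑ j, (pinv (rowMatrix fun i => w (p.1 i)) * rowMatrix p.2) k j ^ 2) :
    ((Measure.pi fun _ : Fin n => PY) ⊗ₘ piKernel n κ) B ≤ ENNReal.ofReal (Real.exp (-t)) := by
  rw [Measure.compProd_apply hBm]
  have hae : ∀ᵐ y ∂(Measure.pi fun _ : Fin n => PY), ∀ i, HasCompanionMatrix (κ (y i)) C := by
    rw [ae_all_iff]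
    exact fun i => (Measure.tendsto_eval_ae_ae (μ := fun _ : Fin n => PY) (i := i)).eventually hκ
  calc ∫⁻ y, piKernel n κ y (Prod.mk y ⁻¹' B) ∂(Measure.pi fun _ : Fin n => PY)
      ≤ ∫⁻ _, ENNReal.ofReal (Real.exp (-t)) ∂(Measure.pi fun _ : Fin n => PY) := by
        refine lintegral_mono_ae ?_
        filter_upwards [hae] with y hy
        by_cases hσy : σ ≤ sigmaMin (rowMatrix fun i => w (y i))
        · have hD := pinv_transpose_mulVec_le hσ (mul_dotProduct_le_of_le_sigmaMin hM hσ.le hσy)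
          rw [piKernel_apply]
          refine le_trans (measure_mono fun e he => ?_) (measure_noise_gt_le hM hN hC hy hσ hD ht)
          exact (hB _ he).2
        · have : Prod.mk y ⁻¹' B = ∅ := by
            ext e
            simp only [Set.mem_preimage, Set.mem_empty_iff_false, iff_false]
            exact fun he => hσy (hB _ he).1
          rw [this, measure_empty]
          exact zero_le
    _ = ENNReal.ofReal (Real.exp (-t)) := by simp

lemma measure_compProd_fst_preimage {α β : Type*} [MeasurableSpace α] [MeasurableSpace β]
    (μ : Measure α) [SFinite μ] (η : Kernel α β) [IsMarkovKernel η] {S : Set α}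
    (hS : MeasurableSet S) : (μ ⊗ₘ η) (Prod.fst ⁻¹' S) = μ S := by
  rw [← Measure.fst_apply hS, Measure.fst_compProd]

end Tail

/-! ### From the tail bounds to the approximation error -/

lemma le_epsErr_add_epsBias {n M N : ℕ} {c ρ t s x h : ℝ} {C : Matrix (Fin N) (Fin N) ℝ}
    {μ : EuclideanSpace ℝ (Fin N)} (hc : 0 ≤ c) (hs : 0 ≤ s)
    (hσ : 0 < √n - c * ρ ^ 2 * (√M + √t))
    (hx : x ≤ (C.trace * M + 2 * √(M * (C ^ 2).trace * t) + 2 * spectralNorm C * t) /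
      (√n - c * ρ ^ 2 * (√M + √t)) ^ 2 +
      h * (1 + 2 * √t * spectralNorm C / √(M * (C ^ 2).trace)))
    (hh : h ≤ (∑ j, 3 / 2 * ρ ^ 2 * μ j ^ 2 * n * (M + 2 * √(M * s) + 2 * s)) /
      (√n - c * ρ ^ 2 * (√M + √t)) ^ 4) :
    x ≤ epsErr n M c ρ t C + epsBias n M c ρ t s C μ := by
  refine hx.trans ?_
  rw [epsErr, epsBias]
  refine add_le_add le_rfl ?_
  have hS : 0 ≤ spectralNorm C := norm_nonneg _
  have hδ : 0 ≤ c * ρ ^ 2 * (√M + √t) := by positivity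
  have hsum : ∑ j, 3 / 2 * ρ ^ 2 * μ j ^ 2 * n * (M + 2 * √(M * s) + 2 * s) =
      3 / 2 * ρ ^ 2 * ‖μ‖ ^ 2 * n * (M + 2 * √(M * s) + 2 * s) := by
    rw [EuclideanSpace.real_norm_sq_eq, ← Finset.sum_mul, ← Finset.sum_mul, ← Finset.mul_sum]
  rw [hsum] at hh
  set a := 2 * √t * spectralNorm C / √(M * (C ^ 2).trace) with ha
  have ha0 : 0 ≤ a := by positivity
  have hr : 1 ≤ (√n + c * ρ ^ 2 * (√M + √t)) / (√n - c * ρ ^ 2 * (√M + √t)) := by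
    rw [one_le_div hσ]
    linarith
  have hr2 := one_le_pow₀ hr (n := 2)
  have hfac : 1 + a ≤
      1 + a * ((√n + c * ρ ^ 2 * (√M + √t)) / (√n - c * ρ ^ 2 * (√M + √t))) ^ 2 := by
    nlinarith
  have hσ4 := pow_pos hσ 4
  refine mul_le_mul hh hfac (by positivity) (by positivity)

/-- Deterministic part of the theorem: a well conditioned whitened design matrix makes the least
squares problem uniquely solvable, and the noise and bias bounds pass to its solution. -/
lemma exists_leastSquares_approxError_le {Ω : Type*} [MeasurableSpace Ω] {P : Measure Ω}
    [IsProbabilityMeasure P] {n N M : ℕ} {Y : Ω → EuclideanSpace ℝ (Fin M)} (hn : 0 < n)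
    (hM : 0 < M) (hY : MemLp Y 2 P) (hY0 : ∫ ω, Y ω ∂P = 0) (hcov : (covMat Y P).PosDef)
    (Θs : Matrix (Fin M) (Fin N) ℝ) {c ρ t s : ℝ} {C : Matrix (Fin N) (Fin N) ℝ}
    {μ : EuclideanSpace ℝ (Fin N)} (hc : 0 ≤ c) (hs : 0 ≤ s)
    (hσ : 0 < √n - c * ρ ^ 2 * (√M + √t))
    (x : Fin n → EuclideanSpace ℝ (Fin N)) (y : Fin n → EuclideanSpace ℝ (Fin M))
    {W : Matrix (Fin n) (Fin M) ℝ}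
    (hW : W = rowMatrix fun i => mulVecE (invSqrt (covMat Y P)) (y i))
    (h1 : √n - c * ρ ^ 2 * (√M + √t) ≤ sigmaMin W) {m : Fin n → EuclideanSpace ℝ (Fin N)}
    (h2 : ∀ j, ∑ k, (∑ i, W i k * m i j) ^ 2 ≤
      3 / 2 * ρ ^ 2 * μ j ^ 2 * n * (M + 2 * √(M * s) + 2 * s))
    (h3 : ∑ k, ∑ j, (pinv W * rowMatrix fun i => x i - mulVecE Θsᵀ (y i)) k j ^ 2 ≤
      (C.trace * M + 2 * √(M * (C ^ 2).trace * t) + 2 * spectralNorm C * t) /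
        (√n - c * ρ ^ 2 * (√M + √t)) ^ 2 +
      (∑ k, ∑ j, (pinv W * rowMatrix m) k j ^ 2) *
        (1 + 2 * √t * spectralNorm C / √(M * (C ^ 2).trace))) :
    ∃ Θhat, IsLeastSquaresEstimator x y Θhat ∧
      approxError P Y Θhat Θs ≤ epsErr n M c ρ t C + epsBias n M c ρ t s C μ := by
  have hq := mul_dotProduct_le_of_le_sigmaMin hM hσ.le h1
  have hR := transpose_invSqrt (covMat Y P)
  have hRu : IsUnit (invSqrt (covMat Y P)).det := by
    refine Matrix.isUnit_det_of_right_inverse (invSqrt_mul_mul_invSqrt hcov)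
  subst hW
  refine ⟨_, isLeastSquaresEstimator_whitened hn x y Θs hR hRu (isUnit_det_gram hσ hq), ?_⟩
  rw [approxError_whitened hR hY hY0 (covMat_whitened hY hY0 hcov)]
  exact le_epsErr_add_epsBias hc hs hσ h3 (sum_sq_pinv_mul_le hσ hq _ h2)

/-! ### The law of the samples -/

section Law

variable {Ω : Type*} [MeasurableSpace Ω] {P : Measure Ω} [IsProbabilityMeasure P] {n N M : ℕ}
  {X : Ω → EuclideanSpace ℝ (Fin N)} {Y : Ω → EuclideanSpace ℝ (Fin M)}

/-- The joint law of the data and the estimation errors of the samples: the data are independent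
with the law of `Y`, and given the data the errors are independent with the conditional laws of the
estimation error. -/
lemma map_sample_eq {Xs : Fin n → Ω → EuclideanSpace ℝ (Fin N)}
    {Ys : Fin n → Ω → EuclideanSpace ℝ (Fin M)} (hX : AEMeasurable X P) (hY : AEMeasurable Y P)
    (hind : iIndepFun (fun i ω => (Xs i ω, Ys i ω)) P)
    (hid : ∀ i, IdentDistrib (fun ω => (Xs i ω, Ys i ω)) (fun ω => (X ω, Y ω)) P P)
    (Θ : Matrix (Fin M) (Fin N) ℝ) :
    AEMeasurable (fun ω => (fun i => Ys i ω, fun i => Xs i ω - mulVecE Θᵀ (Ys i ω))) P ∧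
    P.map (fun ω => (fun i => Ys i ω, fun i => Xs i ω - mulVecE Θᵀ (Ys i ω))) =
      (Measure.pi fun _ : Fin n => P.map Y) ⊗ₘ
        piKernel n (condDistrib (estError Θ X Y) Y P) := by
  have : IsProbabilityMeasure (P.map Y) := Measure.isProbabilityMeasure_map hY
  have hL : Measurable (mulVecE Θᵀ) :=
    (Matrix.toEuclideanLin Θᵀ).continuous_of_finiteDimensional.measurable
  let g : EuclideanSpace ℝ (Fin N) × EuclideanSpace ℝ (Fin M) →
      EuclideanSpace ℝ (Fin M) × EuclideanSpace ℝ (Fin N) := fun p => (p.2, p.1 - mulVecE Θᵀ p.2)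
  have hg : Measurable g :=
    measurable_snd.prodMk (measurable_fst.sub (hL.comp measurable_snd))
  have hE : AEMeasurable (estError Θ X Y) P := hX.sub (hL.comp_aemeasurable hY)
  have hm : ∀ i, AEMeasurable (fun ω => g (Xs i ω, Ys i ω)) P := fun i =>
    hg.comp_aemeasurable (hid i).aemeasurable_fst
  have h1 : P.map (fun ω i => g (Xs i ω, Ys i ω)) =
      Measure.pi fun i => P.map fun ω => g (Xs i ω, Ys i ω) :=
    (hind.comp (fun _ => g) fun _ => hg).map_fun_eq_pi_map hm
  have h2 : ∀ i, P.map (fun ω => g (Xs i ω, Ys i ω)) =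
      P.map Y ⊗ₘ condDistrib (estError Θ X Y) Y P := fun i => by
    rw [compProd_map_condDistrib hE]
    exact ((hid i).comp hg).map_eq
  simp_rw [h2] at h1
  have hu : Measurable fun z : Fin n → EuclideanSpace ℝ (Fin M) × EuclideanSpace ℝ (Fin N) =>
      (fun i => (z i).1, fun i => (z i).2) := by fun_prop
  refine ⟨hu.comp_aemeasurable (aemeasurable_pi_lambda _ hm), ?_⟩
  rw [← map_pi_compProd_eq, ← h1,
    AEMeasurable.map_map_of_aemeasurable hu.aemeasurable (aemeasurable_pi_lambda _ hm)]
  rfl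

/-- If `f Y` is uncorrelated with the `j`-th component of `E`, then `f` is uncorrelated with the
`j`-th component of the conditional mean of `E` given `Y`. -/
lemma integral_mul_condMean {E : Ω → EuclideanSpace ℝ (Fin N)} (hY : AEMeasurable Y P)
    (hE : Integrable E P) {f : EuclideanSpace ℝ (Fin M) → ℝ} (hf : Measurable f) (j : Fin N)
    (hint : Integrable (fun ω => f (Y ω) * E ω j) P) :
    Integrable (fun y => f y * (∫ e, e ∂(condDistrib E Y P y)) j) (P.map Y) ∧
    ∫ y, f y * (∫ e, e ∂(condDistrib E Y P y)) j ∂(P.map Y) = ∫ ω, f (Y ω) * E ω j ∂P := by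
  have : IsProbabilityMeasure (P.map Y) := Measure.isProbabilityMeasure_map hY
  have hEm := hE.1.aemeasurable
  have hYE : AEMeasurable (fun ω => (Y ω, E ω)) P := hY.prodMk hEm
  have hF : Measurable fun p : EuclideanSpace ℝ (Fin M) × EuclideanSpace ℝ (Fin N) =>
    f p.1 * p.2 j := (hf.comp measurable_fst).mul (by fun_prop)
  have hE1 : ∀ᵐ y ∂(P.map Y), Integrable (fun e => e) (condDistrib E Y P y) := by
    refine Integrable.condDistrib_ae_map (f := fun p => p.2) hEm ?_
    rw [integrable_map_measure measurable_snd.aestronglyMeasurable hYE]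
    exact hE
  have hF1 : Integrable (fun p : EuclideanSpace ℝ (Fin M) × EuclideanSpace ℝ (Fin N) =>
      f p.1 * p.2 j) (P.map fun ω => (Y ω, E ω)) := by
    rw [integrable_map_measure hF.aestronglyMeasurable hYE]
    exact hint
  have hae : (fun y => f y * (∫ e, e ∂(condDistrib E Y P y)) j) =ᵐ[P.map Y]
      fun y => ∫ e, f y * e j ∂(condDistrib E Y P y) := by
    filter_upwards [hE1] with y hy
    rw [integral_const_mul]
    congr 1
    exact ((EuclideanSpace.proj (𝕜 := ℝ) j).integral_comp_comm hy).symm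
  refine ⟨(integrable_congr hae).2 (hF1.integral_condDistrib_map hEm), ?_⟩
  rw [integral_congr_ae hae]
  rw [← compProd_map_condDistrib hEm] at hF1
  rw [← Measure.integral_compProd hF1, compProd_map_condDistrib hEm,
    integral_map hYE hF.aestronglyMeasurable]

end Law

/-! ### The event on which the bound holds -/

/-- The three tail bounds (design matrix, bias, noise) hold simultaneously with the stated
probability, by a union bound. -/
lemma exists_measurableSet_good {n N M : ℕ} (hn : 0 < n) (hM : 0 < M) (hN : 0 < N)
    {PY : Measure (EuclideanSpace ℝ (Fin M))} [IsProbabilityMeasure PY]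
    {κ : Kernel (EuclideanSpace ℝ (Fin M)) (EuclideanSpace ℝ (Fin N))} [IsMarkovKernel κ]
    {C : Matrix (Fin N) (Fin N) ℝ} (hC : C.PosDef) (hκ : ∀ᵐ y ∂PY, HasCompanionMatrix (κ y) C)
    {w : EuclideanSpace ℝ (Fin M) → EuclideanSpace ℝ (Fin M)} (hw : Measurable w)
    {v σ t s : ℝ} (hv : 0 < v) (hσ : 0 < σ) (ht : 0 ≤ t) (hs : 0 ≤ s)
    (hmgf : ∀ a : EuclideanSpace ℝ (Fin M), ‖a‖ = 1 → ∀ s : ℝ,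
      ∫⁻ y, ENNReal.ofReal (Real.exp (s * ⟪a, w y⟫_ℝ)) ∂PY ≤
        ENNReal.ofReal (Real.exp (v * s ^ 2 / 2)))
    {μ : EuclideanSpace ℝ (Fin N)} (hμ : ∀ᵐ y ∂PY, ∀ j, |(∫ e, e ∂(κ y)) j| ≤ μ j)
    (hint : ∀ a j, Integrable (fun y => ⟪a, w y⟫_ℝ * (∫ e, e ∂(κ y)) j) PY)
    (hmean : ∀ a j, ∫ y, ⟪a, w y⟫_ℝ * (∫ e, e ∂(κ y)) j ∂PY = 0)
    (hdesign : (Measure.pi fun _ : Fin n => PY) {y | sigmaMin (rowMatrix fun i => w (y i)) < σ} ≤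
      ENNReal.ofReal (2 * Real.exp (-t))) :
    ∃ G : Set ((Fin n → EuclideanSpace ℝ (Fin M)) × (Fin n → EuclideanSpace ℝ (Fin N))),
      MeasurableSet G ∧
      1 - 3 * Real.exp (-t) - N * Real.exp (-s) ≤
        ((Measure.pi fun _ : Fin n => PY) ⊗ₘ piKernel n κ).real G ∧
      ∀ p ∈ G, σ ≤ sigmaMin (rowMatrix fun i => w (p.1 i)) ∧
        (∀ j, ∑ k, (∑ i, w (p.1 i) k * (∫ e, e ∂(κ (p.1 i))) j) ^ 2 ≤
          3 / 2 * v * μ j ^ 2 * n * (M + 2 * √(M * s) + 2 * s)) ∧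
        ∑ k, ∑ j, (pinv (rowMatrix fun i => w (p.1 i)) * rowMatrix p.2) k j ^ 2 ≤
          (C.trace * M + 2 * √(M * (C ^ 2).trace * t) + 2 * spectralNorm C * t) / σ ^ 2 +
          (∑ k, ∑ j, (pinv (rowMatrix fun i => w (p.1 i)) *
            rowMatrix fun i => ∫ e, e ∂(κ (p.1 i))) k j ^ 2) *
            (1 + 2 * √t * spectralNorm C / √(M * (C ^ 2).trace)) := by
  set Q := (Measure.pi fun _ : Fin n => PY) ⊗ₘ piKernel n κ with hQ
  have hm : Measurable fun y => ∫ e, e ∂(κ y) :=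
    (StronglyMeasurable.integral_kernel (κ := κ) stronglyMeasurable_id).measurable
  have hw' : ∀ (i : Fin n) k, Measurable fun y : Fin n → EuclideanSpace ℝ (Fin M) => w (y i) k :=
    fun i k => (by fun_prop : Measurable fun x : EuclideanSpace ℝ (Fin M) => x k).comp
      (hw.comp (measurable_pi_apply i))
  have hm' : ∀ (i : Fin n) j, Measurable fun y : Fin n → EuclideanSpace ℝ (Fin M) =>
      (∫ e, e ∂(κ (y i))) j :=
    fun i j => (by fun_prop : Measurable fun x : EuclideanSpace ℝ (Fin N) => x j).comp
      (hm.comp (measurable_pi_apply i))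
  have hwm : Measurable fun (y : Fin n → EuclideanSpace ℝ (Fin M)) i => w (y i) :=
    measurable_pi_lambda _ fun i => hw.comp (measurable_pi_apply i)
  -- the events on which one of the three bounds fails
  let S1 : Set (Fin n → EuclideanSpace ℝ (Fin M)) := {y | σ ≤ sigmaMin (rowMatrix fun i => w (y i))}
  have hS1 : MeasurableSet S1 := hwm (measurableSet_le_sigmaMin hM σ)
  let S2 : Fin N → Set (Fin n → EuclideanSpace ℝ (Fin M)) := fun j =>
    {y | 3 / 2 * v * μ j ^ 2 * n * (M + 2 * √(M * s) + 2 * s) <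
      ∑ k, (∑ i, w (y i) k * (∫ e, e ∂(κ (y i))) j) ^ 2}
  have hS2 : ∀ j, MeasurableSet (S2 j) := fun j => by
    refine measurableSet_lt measurable_const (Finset.measurable_sum _ fun k _ => ?_)
    exact (Finset.measurable_sum _ fun i _ => (hw' i k).mul (hm' i j)).pow_const 2
  let S3 : Set ((Fin n → EuclideanSpace ℝ (Fin M)) × (Fin n → EuclideanSpace ℝ (Fin N))) :=
    {p | (C.trace * M + 2 * √(M * (C ^ 2).trace * t) + 2 * spectralNorm C * t) / σ ^ 2 +
      (∑ k, ∑ j, (pinv (rowMatrix fun i => w (p.1 i)) *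
        rowMatrix fun i => ∫ e, e ∂(κ (p.1 i))) k j ^ 2) *
        (1 + 2 * √t * spectralNorm C / √(M * (C ^ 2).trace)) <
      ∑ k, ∑ j, (pinv (rowMatrix fun i => w (p.1 i)) * rowMatrix p.2) k j ^ 2}
  have hS3 : MeasurableSet S3 := by
    refine measurableSet_lt (measurable_const.add (Measurable.mul_const ?_ _)) ?_
    · exact measurable_sum_sq_pinv_mul (fun i k => (hw' i k).comp measurable_fst)
        fun i j => (hm' i j).comp measurable_fst
    · refine measurable_sum_sq_pinv_mul (fun i k => (hw' i k).comp measurable_fst) fun i j => ?_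
      exact (by fun_prop : Measurable fun x : EuclideanSpace ℝ (Fin N) => x j).comp
        ((measurable_pi_apply i).comp measurable_snd)
  let B : Set ((Fin n → EuclideanSpace ℝ (Fin M)) × (Fin n → EuclideanSpace ℝ (Fin N))) :=
    Prod.fst ⁻¹' S1ᶜ ∪ (⋃ j, Prod.fst ⁻¹' S2 j) ∪ (Prod.fst ⁻¹' S1 ∩ S3)
  have hB : MeasurableSet B :=
    ((measurable_fst hS1.compl).union (MeasurableSet.iUnion fun j => measurable_fst (hS2 j))).union
      ((measurable_fst hS1).inter hS3)
  have hB1 : Q (Prod.fst ⁻¹' S1ᶜ) ≤ ENNReal.ofReal (2 * Real.exp (-t)) := by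
    rw [hQ, measure_compProd_fst_preimage _ _ hS1.compl]
    refine le_trans (measure_mono fun y hy => ?_) hdesign
    simpa [S1] using hy
  have hB2 : ∀ j, Q (Prod.fst ⁻¹' S2 j) ≤ ENNReal.ofReal (Real.exp (-s)) := fun j => by
    rw [hQ, measure_compProd_fst_preimage _ _ (hS2 j)]
    refine measure_bias_gt_le hn hM hw hv hmgf ?_ (hμ.mono fun y hy => hy j) (fun a => hint a j)
      (fun a => hmean a j) hs
    exact (by fun_prop : Measurable fun x : EuclideanSpace ℝ (Fin N) => x j).comp hm
  have hB3 : Q (Prod.fst ⁻¹' S1 ∩ S3) ≤ ENNReal.ofReal (Real.exp (-t)) :=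
    measure_compProd_noise_le hM hN hC hκ hσ ht ((measurable_fst hS1).inter hS3) fun p hp => hp
  have hQB : Q B ≤ ENNReal.ofReal (3 * Real.exp (-t) + N * Real.exp (-s)) := by
    have e : 3 * Real.exp (-t) + N * Real.exp (-s) =
        2 * Real.exp (-t) + ∑ _j : Fin N, Real.exp (-s) + Real.exp (-t) := by
      simp only [Finset.sum_const, Finset.card_univ, Fintype.card_fin, nsmul_eq_mul]
      ring
    rw [e, ENNReal.ofReal_add (by positivity) (by positivity),
      ENNReal.ofReal_add (by positivity) (by positivity),
      ENNReal.ofReal_sum_of_nonneg fun _ _ => (Real.exp_pos _).le]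
    refine (measure_union_le _ _).trans (add_le_add ((measure_union_le _ _).trans
      (add_le_add hB1 ((measure_iUnion_le _).trans ?_))) hB3)
    rw [tsum_fintype]
    exact Finset.sum_le_sum fun j _ => hB2 j
  refine ⟨Bᶜ, hB.compl, ?_, fun p hp => ?_⟩
  · rw [probReal_compl_eq_one_sub hB]
    have := ENNReal.toReal_le_of_le_ofReal (by positivity) hQB
    rw [measureReal_def]
    linarith
  · simp only [B, Set.mem_compl_iff, Set.mem_union, not_or, Set.mem_iUnion, not_exists,
      Set.mem_inter_iff, not_and, Set.mem_preimage, not_not] at hp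
    obtain ⟨⟨h1, h2⟩, h3⟩ := hp
    exact ⟨h1, fun j => not_lt.1 (h2 j), not_lt.1 (h3 h1)⟩

/-! ### Degenerate dimensions and whitened data -/

/-- If one of the dimensions vanishes, there is only one linear estimator. -/
lemma degenerate_bound {Ω : Type*} [MeasurableSpace Ω] {P : Measure Ω} [IsProbabilityMeasure P]
    {n N M : ℕ} (hMN : M = 0 ∨ N = 0) (Y : Ω → EuclideanSpace ℝ (Fin M))
    (x : Ω → Fin n → EuclideanSpace ℝ (Fin N)) (y : Ω → Fin n → EuclideanSpace ℝ (Fin M))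
    (Θs : Matrix (Fin M) (Fin N) ℝ) (c : ℝ) {ρ t s : ℝ} (ht : 0 ≤ t) (hs : 0 ≤ s)
    {C : Matrix (Fin N) (Fin N) ℝ} (hC : C.PosDef) (μ : EuclideanSpace ℝ (Fin N)) :
    1 - 3 * Real.exp (-t) - N * Real.exp (-s) ≤
      P.real {ω | ∃ Θhat : Matrix (Fin M) (Fin N) ℝ,
        IsLeastSquaresEstimator (x ω) (y ω) Θhat ∧
        approxError P Y Θhat Θs ≤ epsErr n M c ρ t C + epsBias n M c ρ t s C μ} := by
  have hsub : Subsingleton (Matrix (Fin M) (Fin N) ℝ) := by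
    rcases hMN with rfl | rfl <;> infer_instance
  have huniv : {ω | ∃ Θhat : Matrix (Fin M) (Fin N) ℝ,
      IsLeastSquaresEstimator (x ω) (y ω) Θhat ∧
      approxError P Y Θhat Θs ≤ epsErr n M c ρ t C + epsBias n M c ρ t s C μ} = Set.univ := by
    refine Set.eq_univ_of_forall fun ω => ⟨Θs, fun Θ' h => (h (Subsingleton.elim _ _)).elim, ?_⟩
    have h1 := epsErr_nonneg n M c ρ ht hC
    have h2 := epsBias_nonneg n M c ρ t hs C μ
    simpa [approxError] using add_nonneg h1 h2
  rw [huniv, probReal_univ]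
  have h1 := Real.exp_pos (-t)
  have h2 : 0 ≤ N * Real.exp (-s) := by positivity
  linarith

/-- The sub-Gaussian parameter of a vector with identity covariance matrix is positive. -/
lemma sq_pos_of_covMat_eq_one {Ω : Type*} [MeasurableSpace Ω] {P : Measure Ω}
    [IsProbabilityMeasure P] {M : ℕ} (hM : 0 < M) {Y : Ω → EuclideanSpace ℝ (Fin M)}
    (hY : AEMeasurable Y P) {w : EuclideanSpace ℝ (Fin M) → EuclideanSpace ℝ (Fin M)}
    (hw : Measurable w) (h2 : MemLp (fun ω => w (Y ω)) 2 P) (h0 : ∫ ω, w (Y ω) ∂P = 0)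
    (hcov : covMat (fun ω => w (Y ω)) P = 1) {r : ℝ}
    (hmgf : ∀ a : EuclideanSpace ℝ (Fin M), ‖a‖ = 1 → ∀ s : ℝ,
      ∫⁻ y, ENNReal.ofReal (Real.exp (s * ⟪a, w y⟫_ℝ)) ∂(P.map Y) ≤
        ENNReal.ofReal (Real.exp (r ^ 2 * s ^ 2 / 2))) : 0 < r ^ 2 := by
  have : IsProbabilityMeasure (P.map Y) := Measure.isProbabilityMeasure_map hY
  set a : EuclideanSpace ℝ (Fin M) := EuclideanSpace.single ⟨0, hM⟩ 1 with ha
  have ha1 : ‖a‖ = 1 := by simp [ha]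
  have hm : Measurable fun y => ⟪a, w y⟫_ℝ := by fun_prop
  have hint := (h2.const_inner (𝕜 := ℝ) a).integrable_mul (h2.const_inner (𝕜 := ℝ) a)
  refine lt_of_lt_of_le one_pos (one_le_of_integral_sq_eq_one hm (sq_nonneg r) (hmgf a ha1) ?_ ?_)
  · rw [integrable_map_measure (by fun_prop) hY]
    refine hint.congr (ae_of_all _ fun ω => ?_)
    simp [sq]
  · rw [integral_map hY (by fun_prop)]
    have h := integral_inner_mul_inner h2 h0 a a
    rw [hcov, mulVecE_one, real_inner_self_eq_norm_sq, ha1, one_pow] at h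
    simpa [sq] using h

end LMMSE

end

theorem mainTheorem1 :
    (∃ c : ℝ, 0 < c ∧ LMMSE.IsSingularValueConstant c) ∧
    ∀ c : ℝ, 0 < c → LMMSE.IsSingularValueConstant c →
    ∀ (n N M : ℕ) (Ω : Type*) [MeasurableSpace Ω] (P : Measure Ω) [IsProbabilityMeasure P]
      (A : Matrix (Fin M) (Fin N) ℝ)
      (X : Ω → EuclideanSpace ℝ (Fin N)) (Z Y : Ω → EuclideanSpace ℝ (Fin M))
      (Xs : Fin n → Ω → EuclideanSpace ℝ (Fin N)) (Ys : Fin n → Ω → EuclideanSpace ℝ (Fin M))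
      (Θs : Matrix (Fin M) (Fin N) ℝ) (E : Ω → EuclideanSpace ℝ (Fin N)),
    -- the model
    MemLp X 2 P → MemLp Z 2 P → IndepFun X Z P →
    ∫ ω, X ω ∂P = 0 → ∫ ω, Z ω ∂P = 0 →
    IsUnit (LMMSE.covMat X P) → IsUnit (LMMSE.covMat Z P) →
    Y = LMMSE.obs A X Z →
    -- the LMMSE estimator and its estimation error
    Θs = LMMSE.lmmseMatrix A (LMMSE.covMat X P) (LMMSE.covMat Z P) →
    E = LMMSE.estError Θs X Y →
    -- the samples: independent copies of `(X, Y)`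
    iIndepFun (fun i ω => (Xs i ω, Ys i ω)) P →
    (∀ i, IdentDistrib (fun ω => (Xs i ω, Ys i ω)) (fun ω => (X ω, Y ω)) P P) →
    ∀ (C : Matrix (Fin N) (Fin N) ℝ) (μ : EuclideanSpace ℝ (Fin N)) (ρ : NNReal),
    -- `E | Y` is almost surely sub-Gaussian with companion matrix `C`
    C.PosDef →
    (∀ᵐ y ∂(P.map Y), LMMSE.HasCompanionMatrix (condDistrib E Y P y) C) →
    -- the components of the conditional mean of `E` given `Y` are bounded by those of `μ`
    (∀ᵐ y ∂(P.map Y), ∀ i, |(∫ e, e ∂(condDistrib E Y P y)) i| ≤ μ i) →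
    -- the whitened data is sub-Gaussian
    LMMSE.IsSubGaussianVector
      (fun ω => LMMSE.mulVecE (LMMSE.invSqrt (LMMSE.covMat Y P)) (Y ω)) ρ P →
    ∀ t s : ℝ, 0 ≤ t → 0 ≤ s → 0 < √n - c * ρ ^ 2 * (√M + √t) →
      1 - 3 * Real.exp (-t) - N * Real.exp (-s) ≤
        P.real {ω | ∃ Θhat : Matrix (Fin M) (Fin N) ℝ,
          LMMSE.IsLeastSquaresEstimator (fun i => Xs i ω) (fun i => Ys i ω) Θhat ∧
          LMMSE.approxError P Y Θhat Θs ≤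
            LMMSE.epsErr n M c ρ t C + LMMSE.epsBias n M c ρ t s C μ} := by
  refine ⟨⟨132096, by norm_num, LMMSE.isSingularValueConstant_absolute⟩, ?_⟩
  intro c hc hsv n N M Ω _ P _ A X Z Y Xs Ys Θs E hX hZ hXZ hX0 hZ0 hXu hZu hYdef hΘs hEdef hind hid
    C μ ρ hC hκ hμ hsub t s ht hs hσ
  have hY : MemLp Y 2 P := hYdef ▸ LMMSE.memLp_obs hX hZ
  have hY0 : ∫ ω, Y ω ∂P = 0 := hYdef ▸ LMMSE.integral_obs hX hZ hX0 hZ0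
  have hE : MemLp E 2 P := hEdef ▸ LMMSE.memLp_estError hX hY Θs
  by_cases hMN : M = 0 ∨ N = 0
  · exact LMMSE.degenerate_bound hMN _ _ _ _ _ ht hs hC μ
  obtain ⟨hM, hN⟩ : 0 < M ∧ 0 < N := by omega
  have hn : 0 < n := by
    rcases Nat.eq_zero_or_pos n with rfl | h
    · have : 0 ≤ c * (ρ : ℝ) ^ 2 * (√M + √t) := by positivity
      simp only [Nat.cast_zero, Real.sqrt_zero] at hσ
      linarith
    · exact h
  have hcov : (LMMSE.covMat Y P).PosDef := hYdef ▸ LMMSE.covMat_obs_posDef hX hZ hXZ hX0 hZ0 hZu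
  have hYm := hY.1.aemeasurable
  have : IsProbabilityMeasure (P.map Y) := Measure.isProbabilityMeasure_map hYm
  set w := LMMSE.mulVecE (LMMSE.invSqrt (LMMSE.covMat Y P)) with hwdef
  have hw : Measurable w := (LinearMap.continuous_of_finiteDimensional _).measurable
  have hwY : MemLp (fun ω => w (Y ω)) 2 P := LMMSE.MemLp.mulVecE hY _
  have hwY0 : ∫ ω, w (Y ω) ∂P = 0 := LMMSE.integral_mulVecE (hY.integrable one_le_two) hY0 _
  have hwcov : LMMSE.covMat (fun ω => w (Y ω)) P = 1 := LMMSE.covMat_whitened hY hY0 hcov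
  have hmgf : ∀ a : EuclideanSpace ℝ (Fin M), ‖a‖ = 1 → ∀ s : ℝ,
      ∫⁻ y, ENNReal.ofReal (Real.exp (s * ⟪a, w y⟫_ℝ)) ∂(P.map Y) ≤
        ENNReal.ofReal (Real.exp ((ρ : ℝ) ^ 2 * s ^ 2 / 2)) := by
    intro a ha s
    rw [lintegral_map' (by fun_prop) hYm]
    exact hsub.lintegral_exp_le (hwY.integrable one_le_two) hwY0 ha s
  have hρ : 0 < (ρ : ℝ) ^ 2 :=
    LMMSE.sq_pos_of_covMat_eq_one hM hYm hw hwY hwY0 hwcov hmgf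
  -- the whitened data and the estimation error are uncorrelated
  have hcond := fun (a : EuclideanSpace ℝ (Fin M)) (j : Fin N) =>
    LMMSE.integral_mul_condMean (f := fun y => ⟪a, w y⟫_ℝ) hYm (hE.integrable one_le_two)
      (by fun_prop) j
      ((hwY.const_inner a).integrable_mul (LMMSE.MemLp.euclidean_apply hE j))
  have horth : ∀ (a : EuclideanSpace ℝ (Fin M)) (j : Fin N),
      ∫ ω, ⟪a, w (Y ω)⟫_ℝ * E ω j ∂P = 0 := by
    intro a j
    have h := LMMSE.integral_inner_obs_mul_inner_estError (A := A) hX hZ hXZ hX0 hZ0 hXu hZu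
      (LMMSE.mulVecE (LMMSE.invSqrt (LMMSE.covMat Y P)) a) (EuclideanSpace.single j 1)
    rw [← hYdef, ← hΘs, ← hEdef] at h
    rw [← h]
    refine integral_congr_ae (ae_of_all _ fun ω => ?_)
    simp only [hwdef, LMMSE.inner_mulVecE_right, LMMSE.transpose_invSqrt]
    rw [EuclideanSpace.inner_single_left, map_one, one_mul]
  obtain ⟨G, hG, hprob, hgood⟩ := LMMSE.exists_measurableSet_good (κ := condDistrib E Y P) hn hM hN
    hC hκ hw hρ hσ ht hs hmgf hμ (fun a j => (hcond a j).1)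
    (fun a j => (hcond a j).2.trans (horth a j))
    (hsv.measure_sigmaMin_lt_le hM hYm hw hwY hwY0 hwcov hsub ht)
  obtain ⟨hTm, hT⟩ := LMMSE.map_sample_eq hX.1.aemeasurable hYm hind hid Θs
  rw [← hEdef] at hT
  rw [← hT, map_measureReal_apply_of_aemeasurable hTm hG] at hprob
  refine hprob.trans (measureReal_mono fun ω hω => ?_)
  obtain ⟨h1, h2, h3⟩ := hgood _ hω
  exact LMMSE.exists_leastSquares_approxError_le hn hM hY hY0 hcov Θs hc.le hs hσ _ _ rfl h1 h2 h3
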